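/- Let $M$ be a smooth (Hausdorff) manifold of dimension $n\ge 1$, let $\pi:\Phi\to M$ be a smooth fibre bundle (more generally a smooth surjective submersion) with $N$-dimensional fibres, $\Phi$ Hausdorff, and let $k\ge 1$. Put $Q=J^{k-1}\Phi$ and let $P=V^*Q\otimes_Q\Lambda^{n-1}T^*M$ be the phase bundle, i.e. $P_x=T^*Q_x\otimes\Lambda^{n-1}T_x^*M$. A fibred chart $(x^\mu,\varphi^K)$ of $\Phi$ (coordinates on $M$ together with a local trivialisation) induces coordinates $(x^\mu,\varphi^K_{\bar\mu})$, $|\bar\mu|\le k-1$, on $Q$ ($\bar\mu$ a multi-index, $\varphi^K_{\bar\mu}$ the partial derivatives of $\varphi^K$) and coordinates $(x^\mu,\varphi^K_{\bar\mu},p^{\bar\mu\lambda}_K)$ on $P$ through $$p=\sum_{|\bar\mu|\le k-1}\sum_{\lambda,K}p^{\bar\mu\lambda}_K\,\delta\varphi^K_{\bar\mu}\otimes(\partial_\lambda\lrcorner\, d^nx),\qquad d^nx=dx^1\wedge\dots\wedge dx^n ,$$ where $\delta$ is the vertical differential. Write $\bar\mu\lambda$ for $\bar\mu$ with one more index $\lambda$,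 and $p^{\bar\nu}_K=\sum_{\bar\mu\lambda=\bar\nu}p^{\bar\mu\lambda}_K$ for $1\le|\bar\nu|\le k$ (the symmetrised momenta), $p^{\bar\nu}_K=0$ for $\bar\nu=0$. Let $\mathcal L=L\,d^nx$ be a smooth Lagrangian density of order $k$ (an $n$-form-valued function on $J^k\Phi$ over $M$) which is regular: in every fibred chart the equations $p^{\bar\nu}_K=\partial L/\partial\varphi^K_{\bar\nu}$, $|\bar\nu|=k$, have, for every $(x^\mu,\varphi^K_{\bar\mu})_{|\bar\mu|\le k-1}$ in the chart and every $(p^{\bar\nu}_K)_{|\bar\nu|=k}$, a unique solution $(\varphi^K_{\bar\nu})_{|\bar\nu|=k}$, depending smoothly on these data. With the $k$-th order derivatives expressed in this way, set in each fibred chart $$h=\sum_{|\bar\nu|=k}p^{\bar\nu}_K\varphi^K_{\bar\nu}-L,\qquad H=\sum_{|\bar\mu|\le k-1}p^{\bar\mu\lambda}_K\varphi^K_{\bar\mu\lambda}-L=\sum_{1\le|\bar\nu|\le k-1}p^{\bar\nu}_K\varphi^K_{\bar\nu}+h ,$$ so that $h$ is a function of $x^\mu$, $\varphi^K_{\bar\mu}$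 ($|\bar\mu|\le k-1$), $p^{\bar\nu}_K$ ($|\bar\nu|=k$), and $H$ is a function of the coordinates of $P$. Here and below, repeated indices $\lambda$, $K$ are summed over. 1. There is a unique smooth $(n+1)$-form $\Omega$ on $P$ which in the coordinates induced by every fibred chart of $\Phi$ is $$\Omega=\sum_{|\bar\mu|\le k-1}dp^{\bar\mu\lambda}_K\wedge dx^1\wedge\dots\wedge\underbrace{d\varphi^K_{\bar\mu}}_{\lambda\text{-th place}}\wedge\dots\wedge dx^n-dH\wedge dx^1\wedge\dots\wedge dx^n .$$ That is, this expression does not depend on the choice of trivialisation and coordinates. 2. Let $\sigma$ be a smooth section of $P\to M$ over an open set $U\subseteq M$ (for instance $U=M$). Then $$\sigma^*(X\lrcorner\,\Omega)=0\quad\text{for all smooth vector fields }X\text{ on }P$$ if and only if both of the following hold: (a) $\sigma$ is holonomic: its projection to $Q=J^{k-1}\Phi$ is the jet prolongation $j^{k-1}s$ of a section $s$ of $\Phi$ over $U$; (b) in every fibred chart $\sigma$ satisfies the Hamiltonian form of the field equations $$\partial_{\bar\nu}\varphi^K=\frac{\partial h}{\partial p^{\bar\nu}_K}\quad(|\bar\nu|=k),\qquad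 p^{\bar\mu}_K=-\frac{\partial h}{\partial\varphi^K_{\bar\mu}}-\partial_\lambda p^{\bar\mu\lambda}_K\quad(0\le|\bar\mu|\le k-1),$$ where for $\bar\mu=0$ the left-hand side of the last equation is $0$. -/

import Mathlib

open scoped Manifold ContDiff Topology

noncomputable section

namespace PoincareCartan

/-! ### Multi-indices and partial derivatives -/

/-- Multi-indices `α = (α₁, …, αₙ)` of length `|α| ≤ r`. -/
abbrev MultiIndex (n r : ℕ) : Type := {α : Fin n → ℕ // ∑ i, α i ≤ r}

/-- Multi-indices `α = (α₁, …, αₙ)` of length `|α| = r`. -/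
abbrev TopIndex (n r : ℕ) : Type := {α : Fin n → ℕ // ∑ i, α i = r}

instance (n r : ℕ) : Finite (MultiIndex n r) :=
  Set.Finite.to_subtype <| (Set.finite_Iic (fun _ : Fin n => r)).subset fun α hα i =>
    (Finset.single_le_sum (f := α) (fun _ _ => Nat.zero_le _) (Finset.mem_univ i)).trans hα

instance (n r : ℕ) : Finite (TopIndex n r) :=
  Set.Finite.to_subtype <| (Set.finite_Iic (fun _ : Fin n => r)).subset fun α hα i =>
    (Finset.single_le_sum (f := α) (fun _ _ => Nat.zero_le _) (Finset.mem_univ i)).trans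
      (le_of_eq hα)

instance (n r : ℕ) : Fintype (MultiIndex n r) := Fintype.ofFinite _

instance (n r : ℕ) : Fintype (TopIndex n r) := Fintype.ofFinite _

/-- The multi-index `0`. -/
def MultiIndex.zero (n r : ℕ) : MultiIndex n r := ⟨0, by simp⟩

/-- The multi-index `αμ`, i.e. `α` with one more derivative in the direction `μ`. -/
def MultiIndex.succ {n r : ℕ} (α : MultiIndex n r) (μ : Fin n) : MultiIndex n (r + 1) :=
  ⟨α.1 + Pi.single μ 1, by
    simpa [Finset.sum_add_distrib] using α.2⟩

/-- A multi-index of length `r`, seen as one of length `≤ r`. -/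
def TopIndex.toMultiIndex {n r : ℕ} (ν : TopIndex n r) : MultiIndex n r := ⟨ν.1, le_of_eq ν.2⟩

/-- The partial derivative `∂ᵢ f`. -/
def partialDeriv {n : ℕ} {F : Type*} [NormedAddCommGroup F] [NormedSpace ℝ F]
    (i : Fin n) (f : (Fin n → ℝ) → F) : (Fin n → ℝ) → F :=
  fun y => fderiv ℝ f y (Pi.single i 1)

/-- The iterated partial derivative `∂^α f = ∂₁^{α₁} ⋯ ∂ₙ^{αₙ} f`. -/
def multiDeriv {n : ℕ} {F : Type*} [NormedAddCommGroup F] [NormedSpace ℝ F]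
    (α : Fin n → ℕ) (f : (Fin n → ℝ) → F) : (Fin n → ℝ) → F :=
  (List.finRange n).foldr (fun i g => (partialDeriv i)^[α i] g) f

/-! ### Coordinate spaces -/

/-- The values of the fibre coordinates `φ^K_α`, `|α| ≤ r`, of an `r`-jet. -/
abbrev JetFibre (n N r : ℕ) : Type := MultiIndex n r × Fin N → ℝ

/-- Coordinates `(x^μ, φ^K_α)` on the bundle of `r`-jets. -/
abbrev JetModel (n N r : ℕ) : Type := (Fin n → ℝ) × JetFibre n N r

/-- Coordinates `(x^μ, φ^K_α, p^{αμ}_K)`, `|α| ≤ r`, on the phase bundle. -/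
abbrev PhaseModel (n N r : ℕ) : Type :=
  (Fin n → ℝ) × JetFibre n N r × ((MultiIndex n r × Fin N) × Fin n → ℝ)

/-- Values `w^K_ν`, or `π^ν_K`, indexed by the multi-indices `ν` of the highest length. -/
abbrev TopFibre (n N k : ℕ) : Type := TopIndex n k × Fin N → ℝ

/-- The fibre coordinates of a `(r+1)`-jet, assembled from those of length `≤ r` and those
of length `r + 1`. -/
def assemble {n N r : ℕ} (u : JetFibre n N r) (w : TopFibre n N (r + 1)) :
    JetFibre n N (r + 1) :=
  fun a => if h : ∑ i, a.1.1 i ≤ r then u (⟨a.1.1, h⟩, a.2)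
    else w (⟨a.1.1, le_antisymm a.1.2 (not_le.mp h)⟩, a.2)

/-- The momenta `p^ν_K = ∑_{αμ = ν} p^{αμ}_K` for a multi-index `ν` (this is the totally
symmetric part of the momenta, in multi-index notation; it is `0` for `ν = 0`). -/
def symMomentum {n N r : ℕ} (P : (MultiIndex n r × Fin N) × Fin n → ℝ)
    (ν : Fin n → ℕ) (K : Fin N) : ℝ :=
  ∑ α : MultiIndex n r, ∑ μ : Fin n, if (α.succ μ).1 = ν then P ((α, K), μ) else 0

/-- The symmetrised momenta of highest order. -/
def topMomentum {n N r : ℕ} (P : (MultiIndex n r × Fin N) × Fin n → ℝ) :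
    TopFibre n N (r + 1) :=
  fun a => symMomentum P a.1.1 a.2

/-- The exterior product of `m` linear forms, `(a₁ ∧ ⋯ ∧ aₘ)(v₁, …, vₘ) = det (aⱼ(vᵢ))`. -/
def wedge {E : Type*} [AddCommGroup E] [Module ℝ E] {m : ℕ} (a : Fin m → (E →ₗ[ℝ] ℝ)) :
    E [⋀^Fin m]→ₗ[ℝ] ℝ :=
  (Matrix.detRowAlternating (R := ℝ) (n := Fin m)).compLinearMap (LinearMap.pi a)

/-- The one-form `dx^μ` on the coordinate space. -/
def dx {n N r : ℕ} (μ : Fin n) : PhaseModel n N r →ₗ[ℝ] ℝ :=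
  LinearMap.proj μ ∘ₗ LinearMap.fst ℝ _ _

/-- The one-form `dφ^K_α` on the coordinate space. -/
def dφ {n N r : ℕ} (a : MultiIndex n r × Fin N) : PhaseModel n N r →ₗ[ℝ] ℝ :=
  LinearMap.proj a ∘ₗ LinearMap.fst ℝ _ _ ∘ₗ LinearMap.snd ℝ _ _

/-- The one-form `dp^{αμ}_K` on the coordinate space. -/
def dp {n N r : ℕ} (a : MultiIndex n r × Fin N) (μ : Fin n) : PhaseModel n N r →ₗ[ℝ] ℝ :=
  LinearMap.proj (a, μ) ∘ₗ LinearMap.snd ℝ _ _ ∘ₗ LinearMap.snd ℝ _ _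

/-! ### Fibred manifolds, adapted charts, jets

The base `M` has dimension `d + 1`, the total space `Φ` has dimension `d + 1 + N`. -/

section Geometry

variable {d N : ℕ}
  {M : Type*} [TopologicalSpace M] [ChartedSpace (EuclideanSpace ℝ (Fin (d + 1))) M]
  {Φ : Type*} [TopologicalSpace Φ] [ChartedSpace (EuclideanSpace ℝ (Fin (d + 1 + N))) Φ]

variable (d N) in
/-- A smooth chart `(x^μ, φ^K)` of the total space adapted to the projection: its first
components are the pull-back of a smooth chart `(x^μ)` of the base. The choice of an adapted
chart comprises both the coordinates on the base and the local trivialisation. -/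
structure AdaptedChart (π : Φ → M) where
  /-- the chart of the base -/
  base : OpenPartialHomeomorph M (Fin (d + 1) → ℝ)
  /-- the chart of the total space -/
  total : OpenPartialHomeomorph Φ ((Fin (d + 1) → ℝ) × (Fin N → ℝ))
  mapsTo : ∀ z ∈ total.source, π z ∈ base.source
  fst_eq : ∀ z ∈ total.source, (total z).1 = base (π z)
  smooth_base : ContMDiffOn (𝓡 (d + 1)) 𝓘(ℝ, Fin (d + 1) → ℝ) ∞ base base.source
  smooth_base_symm : ContMDiffOn 𝓘(ℝ, Fin (d + 1) → ℝ) (𝓡 (d + 1)) ∞ base.symm base.target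
  smooth_total : ContMDiffOn (𝓡 (d + 1 + N)) 𝓘(ℝ, (Fin (d + 1) → ℝ) × (Fin N → ℝ)) ∞
    total total.source
  smooth_total_symm : ContMDiffOn 𝓘(ℝ, (Fin (d + 1) → ℝ) × (Fin N → ℝ)) (𝓡 (d + 1 + N)) ∞
    total.symm total.target

variable (d N) in
/-- `π : Φ → M` is a fibred manifold: a smooth surjection admitting adapted charts around every
point of `Φ` (equivalently a smooth surjective submersion). Every smooth fibre bundle with
`N`-dimensional fibre is one. -/
structure IsFibredManifold (π : Φ → M) : Prop where
  smooth : ContMDiff (𝓡 (d + 1 + N)) (𝓡 (d + 1)) ∞ π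
  surjective : Function.Surjective π
  exists_chart : ∀ z : Φ, ∃ c : AdaptedChart d N π, z ∈ c.total.source

/-- The coordinate vector `∂/∂x^μ ∈ T_xM` of the base chart of `c`. -/
def AdaptedChart.coordVec {π : Φ → M} (c : AdaptedChart d N π) (x : M) (μ : Fin (d + 1)) :
    TangentSpace (𝓡 (d + 1)) x :=
  (mfderiv 𝓘(ℝ, Fin (d + 1) → ℝ) (𝓡 (d + 1)) c.base.symm (c.base x) (Pi.single μ 1) :)

variable (d N) in
/-- A smooth local section of `π` around a point. -/
structure LocalSection (π : Φ → M) where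
  /-- the point around which the section is defined -/
  pt : M
  /-- the section (only its germ at `pt` matters) -/
  toFun : M → Φ
  isSection : ∀ᶠ y in 𝓝 pt, π (toFun y) = y
  smooth : ∀ᶠ y in 𝓝 pt, ContMDiffAt (𝓡 (d + 1)) (𝓡 (d + 1 + N)) ∞ toFun y

/-- All that is seen by an `r`-jet: the source point, the target point, and the partial derivatives
of order `≤ r` in every adapted chart around the target point. -/
def jetData {π : Φ → M} (r : ℕ) (s : LocalSection d N π) :
    M × Φ × (AdaptedChart d N π → JetFibre (d + 1) N r) :=
  open Classical in
  (s.pt, s.toFun s.pt, fun c =>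
    if s.toFun s.pt ∈ c.total.source then
      fun a => multiDeriv a.1.1 (fun y => (c.total (s.toFun (c.base.symm y))).2) (c.base s.pt) a.2
    else 0)

variable (d N) in
/-- The `r`-jets of local sections of `π`: local sections modulo contact of order `r`. -/
def Jet (π : Φ → M) (r : ℕ) :=
  Quotient (Setoid.ker (jetData (d := d) (N := N) (π := π) r))

/-- The `r`-jet of a local section at its source point. -/
def jetOf {π : Φ → M} (r : ℕ) (s : LocalSection d N π) : Jet d N π r := Quotient.mk _ s

namespace Jet

variable {π : Φ → M} {r : ℕ}

/-- The data of a jet, see `jetData`. -/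
def data (q : Jet d N π r) : M × Φ × (AdaptedChart d N π → JetFibre (d + 1) N r) :=
  Quotient.lift (jetData r) (fun _ _ h => h) q

/-- The point of the base manifold at which the jet is taken. -/
def base (q : Jet d N π r) : M := q.data.1

/-- The value of the jet in `Φ`. -/
def val (q : Jet d N π r) : Φ := q.data.2.1

/-- The jets in the domain of the chart induced by an adapted chart. -/
def dom (c : AdaptedChart d N π) : Set (Jet d N π r) := {q | q.val ∈ c.total.source}

/-- The fibre coordinates `φ^K_α` of a jet in an adapted chart (`0` off the chart domain). -/
def fibreCoord (c : AdaptedChart d N π) (q : Jet d N π r) : JetFibre (d + 1) N r := q.data.2.2 c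

/-- The coordinates `(x^μ, φ^K_α)` of a jet in an adapted chart. -/
def coord (c : AdaptedChart d N π) (q : Jet d N π r) : JetModel (d + 1) N r :=
  (c.base q.base, q.fibreCoord c)

/-- The vertical tangent space `V_q = T_q(J^r_xΦ)` of the jet bundle at `q`, spanned by the
velocities of curves in the fibre `J^r_xΦ` through `q`. A tangent vector is given by the family of
its components in all adapted charts around `q` (entries at other charts being `0`). -/
def vertical (q : Jet d N π r) : Submodule ℝ (AdaptedChart d N π → JetFibre (d + 1) N r) :=
  Submodule.span ℝ {v | ∃ γ : ℝ → Jet d N π r, γ 0 = q ∧ (∀ t, (γ t).base = q.base) ∧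
    ∀ c : AdaptedChart d N π,
      (q ∈ dom c → (∀ᶠ t in 𝓝 0, γ t ∈ dom c) ∧
        HasDerivAt (fun t => (γ t).fibreCoord c) (v c) 0) ∧
      (q ∉ dom c → v c = 0)}

/-- The coordinate vector `∂/∂φ^K_α ∈ V_q` of an adapted chart around `q`: the vertical vector whose
components in that chart are those of a standard basis vector. -/
def coordVec (q : Jet d N π r) (c : AdaptedChart d N π) (a : MultiIndex (d + 1) r × Fin N) :
    q.vertical :=
  Function.invFun (fun v : q.vertical => v.1 c) (Pi.single a 1)

end Jet

/-! ### The phase bundle -/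

variable (d N) in
/-- The phase bundle `P = V^*Q ⊗ Λ^{n-1}M` over `Q = J^rΦ`, where `n = d + 1 = dim M`: an element
over the jet `q` at `x` is a linear map `V_q → Λ^{n-1} T_x^*M`. -/
def Phase (π : Φ → M) (r : ℕ) :=
  Σ q : Jet d N π r, q.vertical →ₗ[ℝ] (TangentSpace (𝓡 (d + 1)) q.base [⋀^Fin d]→ₗ[ℝ] ℝ)

namespace Phase

variable {π : Φ → M} {r : ℕ}

/-- The projection of the phase bundle to `Q = J^rΦ`. -/
def jet (z : Phase d N π r) : Jet d N π r := z.1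

/-- The points of the phase bundle in the domain of the chart induced by an adapted chart. -/
def dom (c : AdaptedChart d N π) : Set (Phase d N π r) := {z | z.jet ∈ Jet.dom c}

/-- The coordinate `p^{αμ}_K`, where `p = ∑ p^{αμ}_K δφ^K_α ⊗ (∂_μ ⌟ dx^1 ∧ ⋯ ∧ dx^n)`; that is,
up to the sign `(-1)^{μ-1}` (for `μ` counted from `1`), the value of the `(n-1)`-form
`p(∂/∂φ^K_α)` on the coordinate vectors other than `∂_μ`. -/
def momentum (c : AdaptedChart d N π) (z : Phase d N π r) :
    (MultiIndex (d + 1) r × Fin N) × Fin (d + 1) → ℝ :=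
  fun a => (-1 : ℝ) ^ (a.2 : ℕ) *
    z.2 (z.1.coordVec c a.1) (fun j : Fin d => c.coordVec z.1.base (a.2.succAbove j))

/-- The coordinates `(x^μ, φ^K_α, p^{αμ}_K)` of a point of the phase bundle. -/
def coord (c : AdaptedChart d N π) (z : Phase d N π r) : PhaseModel (d + 1) N r :=
  (c.base z.jet.base, z.jet.fibreCoord c, z.momentum c)

/-- The tangent space `T_zP`, spanned by the velocities of curves in `P` through `z`. A tangent
vector is given by the family of its components in all charts induced by adapted charts around `z`
(entries at other charts being `0`). -/
def tangent (z : Phase d N π r) : Submodule ℝ (AdaptedChart d N π → PhaseModel (d + 1) N r) :=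
  Submodule.span ℝ {v | ∃ γ : ℝ → Phase d N π r, γ 0 = z ∧
    ∀ c : AdaptedChart d N π,
      (z ∈ dom c → (∀ᶠ t in 𝓝 0, γ t ∈ dom c) ∧
        HasDerivAt (fun t => (γ t).coord c) (v c) 0) ∧
      (z ∉ dom c → v c = 0)}

/-- The differential at `z` of the coordinate map of an adapted chart. -/
def dcoord (c : AdaptedChart d N π) (z : Phase d N π r) :
    z.tangent →ₗ[ℝ] PhaseModel (d + 1) N r :=
  LinearMap.proj c ∘ₗ z.tangent.subtype

end Phase

variable (d N) in
/-- A smooth vector field on the phase bundle. -/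
structure PhaseVectorField (π : Φ → M) (r : ℕ) where
  /-- the value of the vector field at a point -/
  toFun : ∀ z : Phase d N π r, z.tangent
  smooth : ∀ c : AdaptedChart d N π, ∃ f : PhaseModel (d + 1) N r → PhaseModel (d + 1) N r,
    ContDiffOn ℝ ∞ f (Phase.coord c '' Phase.dom c) ∧
    ∀ z ∈ Phase.dom c, z.dcoord c (toFun z) = f (z.coord c)

variable (d N) in
/-- A smooth differential form of degree `m` on the phase bundle. -/
structure PhaseForm (π : Φ → M) (r m : ℕ) where
  /-- the value of the form at a point -/
  toFun : ∀ z : Phase d N π r, z.tangent [⋀^Fin m]→ₗ[ℝ] ℝ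
  smooth : ∀ c : AdaptedChart d N π,
    ∃ g : PhaseModel (d + 1) N r → PhaseModel (d + 1) N r [⋀^Fin m]→ₗ[ℝ] ℝ,
      (∀ v, ContDiffOn ℝ ∞ (fun y => g y v) (Phase.coord c '' Phase.dom c)) ∧
      ∀ z ∈ Phase.dom c, toFun z = (g (z.coord c)).compLinearMap (z.dcoord c)

variable (d N) in
/-- A smooth section of the phase bundle over an open subset `U` of `M`
(the values off `U` are irrelevant). -/
structure PhaseSection (π : Φ → M) (r : ℕ) (U : TopologicalSpace.Opens M) where
  /-- the value of the section at a point -/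
  toFun : M → Phase d N π r
  base_eq : ∀ x ∈ U, (toFun x).jet.base = x
  smooth_val : ContMDiffOn (𝓡 (d + 1)) (𝓡 (d + 1 + N)) ∞ (fun x => (toFun x).jet.val) U
  smooth_coord : ∀ c : AdaptedChart d N π,
    ContMDiffOn (𝓡 (d + 1)) 𝓘(ℝ, PhaseModel (d + 1) N r) ∞ (fun x => (toFun x).coord c)
      {x | x ∈ U ∧ toFun x ∈ Phase.dom c}

namespace PhaseSection

variable {π : Φ → M} {r : ℕ} {U : TopologicalSpace.Opens M}

theorem eventually_mem_dom (σ : PhaseSection d N π r U) {x : M} (hx : x ∈ U)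
    (c : AdaptedChart d N π) (h : σ.toFun x ∈ Phase.dom c) :
    ∀ᶠ y in 𝓝 x, y ∈ U ∧ σ.toFun y ∈ Phase.dom c := by
  have hU : (U : Set M) ∈ 𝓝 x := U.isOpen.mem_nhds hx
  have hcont : ContinuousAt (fun x => (σ.toFun x).jet.val) x :=
    σ.smooth_val.continuousOn.continuousAt hU
  have hpre := hcont.preimage_mem_nhds (c.total.open_source.mem_nhds h)
  filter_upwards [hU, hpre] with y hy hy'
  exact ⟨hy, hy'⟩

/-- The derivative at `x` of the local expression of a section in the coordinates of `c`. -/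
def coordDeriv (σ : PhaseSection d N π r U) (x : M) (c : AdaptedChart d N π) :
    TangentSpace (𝓡 (d + 1)) x →L[ℝ] PhaseModel (d + 1) N r :=
  mfderiv (𝓡 (d + 1)) 𝓘(ℝ, PhaseModel (d + 1) N r) (fun y => (σ.toFun y).coord c) x

theorem diff_mem (σ : PhaseSection d N π r U) {x : M} (hx : x ∈ U)
    (v : AdaptedChart d N π → PhaseModel (d + 1) N r) (w : EuclideanSpace ℝ (Fin (d + 1)))
    (hv : ∀ c, σ.toFun x ∈ Phase.dom c → v c = σ.coordDeriv x c w)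
    (hv' : ∀ c, σ.toFun x ∉ Phase.dom c → v c = 0) :
    v ∈ (σ.toFun x).tangent := by
  set e := extChartAt (𝓡 (d + 1)) x with he
  have hline : HasDerivAt (fun t : ℝ => e x + t • w) w 0 := by
    simpa using ((hasDerivAt_id (0 : ℝ)).smul_const w).const_add (e x)
  have hδ0 : e.symm (e x + (0 : ℝ) • w) = x := by
    rw [zero_smul, add_zero]; exact extChartAt_to_inv (I := 𝓡 (d + 1)) x
  have hδ : Filter.Tendsto (fun t : ℝ => e.symm (e x + t • w)) (𝓝 0) (𝓝 x) := by
    have h1 : ContinuousAt e.symm (e x + (0 : ℝ) • w) := by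
      rw [zero_smul, add_zero]
      exact continuousAt_extChartAt_symm x
    have h2 := (ContinuousAt.comp_of_eq (f := fun t : ℝ => e x + t • w) (x := (0 : ℝ)) h1
      hline.continuousAt rfl).tendsto
    simp only [Function.comp_def] at h2
    rwa [hδ0] at h2
  refine Submodule.subset_span ⟨fun t => σ.toFun (e.symm (e x + t • w)), ?_, ?_⟩
  · exact congrArg σ.toFun hδ0
  · intro c
    refine ⟨fun hc => ?_, hv' c⟩
    have hev := σ.eventually_mem_dom hx c hc
    refine ⟨(hδ.eventually hev).mono fun t ht => ht.2, ?_⟩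
    have hmd : MDifferentiableAt (𝓡 (d + 1)) 𝓘(ℝ, PhaseModel (d + 1) N r)
        (fun y => (σ.toFun y).coord c) x :=
      ((σ.smooth_coord c).contMDiffAt hev).mdifferentiableAt (by simp)
    have hf := hmd.hasMFDerivAt.2
    rw [ModelWithCorners.range_eq_univ] at hf
    have hf' : HasFDerivAt (fun a => (σ.toFun (e.symm a)).coord c)
        (σ.coordDeriv x c : EuclideanSpace ℝ (Fin (d + 1)) →L[ℝ] PhaseModel (d + 1) N r)
        (e x) := hasFDerivWithinAt_univ.mp hf
    rw [hv c hc]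
    exact HasFDerivAt.comp_hasDerivAt_of_eq (0 : ℝ) hf' hline (by simp)

/-- The differential `T_xM → T_{σ(x)}P` of a section. -/
def diff (σ : PhaseSection d N π r U) {x : M} (hx : x ∈ U) :
    TangentSpace (𝓡 (d + 1)) x →ₗ[ℝ] (σ.toFun x).tangent :=
  open Classical in
  { toFun := fun w => ⟨fun c => if σ.toFun x ∈ Phase.dom c then σ.coordDeriv x c w else 0,
      σ.diff_mem hx _ w (fun c hc => if_pos hc) (fun c hc => if_neg hc)⟩
    map_add' := fun w w' => by
      ext1; funext c
      by_cases hc : σ.toFun x ∈ Phase.dom c <;> simp [hc]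
    map_smul' := fun a w => by
      ext1; funext c
      by_cases hc : σ.toFun x ∈ Phase.dom c <;> simp [hc] }

/-- The pull-back `σ^*(X ⌟ Ω)`, evaluated at `x`. -/
def pullbackContraction (σ : PhaseSection d N π r U) (X : PhaseVectorField d N π r) {m : ℕ}
    (Ω : PhaseForm d N π r (m + 1)) {x : M} (hx : x ∈ U) :
    TangentSpace (𝓡 (d + 1)) x [⋀^Fin m]→ₗ[ℝ] ℝ :=
  ((Ω.toFun (σ.toFun x)).curryLeft (X.toFun (σ.toFun x))).compLinearMap (σ.diff hx)

/-- The multi-symplectic equation: `σ^*(X ⌟ Ω) = 0` for all smooth vector fields `X` on `P`. -/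
def IsMultisymplectic (σ : PhaseSection d N π r U) {m : ℕ} (Ω : PhaseForm d N π r (m + 1)) : Prop :=
  ∀ (X : PhaseVectorField d N π r) (x : M) (hx : x ∈ U), σ.pullbackContraction X Ω hx = 0

/-- A section of the phase bundle is holonomic if its projection to `Q = J^rΦ` is the `r`-th jet
prolongation of a section of `Φ`. -/
def IsHolonomic (σ : PhaseSection d N π r U) : Prop :=
  ∃ s : M → Φ, ∀ x ∈ U, ∃ a : LocalSection d N π,
    a.pt = x ∧ a.toFun = s ∧ (σ.toFun x).jet = jetOf r a

/-- The local expression `y ↦ (y, φ^K_α(y), p^{αμ}_K(y))` of a section in an adapted chart. -/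
def localRep (σ : PhaseSection d N π r U) (c : AdaptedChart d N π) :
    (Fin (d + 1) → ℝ) → PhaseModel (d + 1) N r :=
  fun y => (σ.toFun (c.base.symm y)).coord c

end PhaseSection

/-! ### Lagrangians and the Poincaré–Cartan form -/

variable (d N) in
/-- A smooth Lagrangian density of order `k`: an `n`-form-valued function
`j ↦ 𝓛(j) ∈ Λ^n T_x^*M` on `J^kΦ`. -/
structure Lagrangian (π : Φ → M) (k : ℕ) where
  /-- the value of the density on a jet -/
  toFun : ∀ j : Jet d N π k, TangentSpace (𝓡 (d + 1)) j.base [⋀^Fin (d + 1)]→ₗ[ℝ] ℝ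
  smooth : ∀ c : AdaptedChart d N π, ∃ f : JetModel (d + 1) N k → ℝ,
    ContDiffOn ℝ ∞ f (Jet.coord c '' Jet.dom c) ∧
    ∀ j ∈ Jet.dom c, toFun j (c.coordVec j.base) = f (j.coord c)

namespace Lagrangian

variable {π : Φ → M}

/-- The Lagrangian function `L(x^μ, φ^K_α)` in an adapted chart, `𝓛 = L dx^1 ∧ ⋯ ∧ dx^n`
(set to `0` off the range of the chart). -/
def fn {k : ℕ} (𝓛 : Lagrangian d N π k) (c : AdaptedChart d N π) : JetModel (d + 1) N k → ℝ :=
  Function.extend (fun j : (Jet.dom c : Set (Jet d N π k)) => j.1.coord c)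
    (fun j => 𝓛.toFun j.1 (c.coordVec j.1.base)) 0

variable {r : ℕ} (𝓛 : Lagrangian d N π (r + 1)) (c : AdaptedChart d N π)

/-- The derivatives `∂L/∂φ^K_ν`, `|ν| = r + 1`, at the jet with coordinates `(x, u, w)`. -/
def topDerivative (b : JetModel (d + 1) N r) (w : TopFibre (d + 1) N (r + 1)) :
    TopFibre (d + 1) N (r + 1) :=
  fun a => fderiv ℝ (𝓛.fn c) (b.1, assemble b.2 w) (0, Pi.single (a.1.toMultiIndex, a.2) 1)

/-- The highest derivatives `φ^K_ν`, `|ν| = r + 1`, obtained by solving the equation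
`∂L/∂φ^K_ν = p^ν_K` at given `(x^μ, φ^K_α)`, `|α| ≤ r`, and `p^ν_K`, `|ν| = r + 1`. -/
def solve (b : JetModel (d + 1) N r) (p : TopFibre (d + 1) N (r + 1)) :
    TopFibre (d + 1) N (r + 1) :=
  Function.invFun (𝓛.topDerivative c b) p

/-- The Lagrangian is (hyper)regular: in every adapted chart the equation `∂L/∂φ^K_ν = p^ν_K`,
`|ν| = r + 1`, has exactly one solution `φ^K_ν`, which depends smoothly on the other variables. -/
def IsRegular : Prop :=
  ∀ c : AdaptedChart d N π,
    (∀ b ∈ Jet.coord (r := r) c '' Jet.dom c, Function.Bijective (𝓛.topDerivative c b)) ∧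
    ContDiffOn ℝ ∞ (fun y : JetModel (d + 1) N r × TopFibre (d + 1) N (r + 1) =>
      𝓛.solve c y.1 y.2) ((Jet.coord (r := r) c '' Jet.dom c) ×ˢ Set.univ)

/-- The Legendre transform `h(x^μ, φ^K_α, p^ν_K) = ∑_{|ν| = r + 1} p^ν_K φ^K_ν - L` with respect to
the highest order momenta. -/
def legendre (y : (Fin (d + 1) → ℝ) × JetFibre (d + 1) N r × TopFibre (d + 1) N (r + 1)) : ℝ :=
  ∑ a, y.2.2 a * 𝓛.solve c (y.1, y.2.1) y.2.2 a -
    𝓛.fn c (y.1, assemble y.2.1 (𝓛.solve c (y.1, y.2.1) y.2.2))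

/-- The Hamiltonian `H = ∑_{|α| ≤ r} p^{αμ}_K φ^K_{αμ} - L`, the derivatives of order `r + 1` being
expressed through the highest order momenta. -/
def hamiltonian (y : PhaseModel (d + 1) N r) : ℝ :=
  let φ := assemble y.2.1 (𝓛.solve c (y.1, y.2.1) (topMomentum y.2.2))
  ∑ α : MultiIndex (d + 1) r, ∑ K : Fin N, ∑ μ : Fin (d + 1),
    y.2.2 ((α, K), μ) * φ (α.succ μ, K) - 𝓛.fn c (y.1, φ)

/-- The coordinate expression of the Poincaré–Cartan form,
`∑ dp^{αμ}_K ∧ dx^1 ∧ ⋯ ∧ dφ^K_α ∧ ⋯ ∧ dx^n - dH ∧ dx^1 ∧ ⋯ ∧ dx^n`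
with `dφ^K_α` at the `μ`-th place. -/
def cartanForm (y : PhaseModel (d + 1) N r) :
    PhaseModel (d + 1) N r [⋀^Fin (d + 1 + 1)]→ₗ[ℝ] ℝ :=
  ∑ α : MultiIndex (d + 1) r, ∑ K : Fin N, ∑ μ : Fin (d + 1),
    wedge (Fin.cons (dp (α, K) μ) (Function.update dx μ (dφ (α, K)))) -
  wedge (Fin.cons (fderiv ℝ (𝓛.hamiltonian c) y).toLinearMap dx)

/-- The form `Ω` on the phase bundle is given in every adapted chart by the coordinate expression
of the Poincaré–Cartan form. -/
def IsCartanForm (Ω : PhaseForm d N π r (d + 1 + 1)) : Prop :=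
  ∀ c : AdaptedChart d N π, ∀ z ∈ Phase.dom c,
    Ω.toFun z = (𝓛.cartanForm c (z.coord c)).compLinearMap (z.dcoord c)

/-- The Hamiltonian form of the field equations for a section `σ` of the phase bundle, in every
adapted chart: `∂_ν φ^K = ∂h/∂p^ν_K` for `|ν| = r + 1`, and
`p^α_K = -∂h/∂φ^K_α - ∂_μ p^{αμ}_K` for `|α| ≤ r` (with `p^α_K = 0` for `α = 0`). -/
def FieldEquations {U : TopologicalSpace.Opens M} (σ : PhaseSection d N π r U) : Prop :=
  ∀ c : AdaptedChart d N π, ∀ x ∈ U, σ.toFun x ∈ Phase.dom c →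
    let f := σ.localRep c
    let y := c.base x
    let h' := fderiv ℝ (𝓛.legendre c) (y, (f y).2.1, topMomentum (f y).2.2)
    (∀ (ν : TopIndex (d + 1) (r + 1)) (K : Fin N),
      multiDeriv ν.1 (fun y' => (f y').2.1 (MultiIndex.zero (d + 1) r, K)) y =
        h' (0, 0, Pi.single (ν, K) 1)) ∧
    (∀ (α : MultiIndex (d + 1) r) (K : Fin N),
      symMomentum (f y).2.2 α.1 K =
        - h' (0, Pi.single (α, K) 1, 0) -
          ∑ μ, partialDeriv μ (fun y' => (f y').2.2 ((α, K), μ)) y)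

end Lagrangian

end Geometry

end PoincareCartan

end

open PoincareCartan

/-! Write `k = r + 1`, `n = d + 1`, and let `θ` be the `n`-form `∑ p^{αμ}_K dx^1 ∧ ⋯ ∧ dφ^K_α ∧ ⋯ ∧
dx^n - H d^nx`, so that `Ω = dθ`. Since `d` commutes with pull-back, chart independence of `Ω`
follows from that of `θ`.

Fix an `(r + 1)`-jet `j` over the `r`-jet underlying a point of `P`, and let `θ_j` be `θ` with `H`
replaced by `∑ p^{αμ}_K φ^K_{αμ}(j) - L(j)`. Then `θ_j` is the momentum applied to the contact forms
`dφ^K_α - φ^K_{αμ} dx^μ`, plus `L(j) d^nx` (`cartanPotential_eq`). Both pieces are intrinsic: the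
contact forms measure the deviation from the graph of a prolonged section and change like vertical
vectors (`contactPart_trans`), the momentum is a linear map on vertical vectors, and the Lagrangian
is an `n`-form. So `θ_j` is chart independent for every `j` (`cartanPotential_trans`). The jet used
in `H` is chart independent too: the equation `∂L/∂φ_ν = p^ν` says that `j` is a critical point of
`∑ p φ - L` among the jets over the given `r`-jet. By the first step this function changes between
charts only by reparametrisation, a constant factor and an additive constant, so critical points
correspond (`solvedJet_trans`).

For the second part, `X` may be taken vertical over `M`, because `Ω` vanishes when the inserted
vector is tangent to the section. Since `X` takes arbitrary values at a point (`exists_vectorField`,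
by bump functions on the Hausdorff manifold `Φ`), the equation is equivalent to `∂_μ φ^K_α =
∂H/∂p^{αμ}_K` and `∂_μ p^{αμ}_K = -∂H/∂φ^K_α` (`cartanForm_cons_eq_zero_iff`). As `H = ∑ p^ν φ_ν +
h`, the first family reads `∂_μ φ_α = φ_{αμ}` for `|α| < r`, and `∂_μ φ_α = ∂h/∂p^{αμ}` for `|α| =
r`. By induction on the order this is holonomy together with the first field equation
(`prolongation_iff`); the second family is the second field equation.

Jets and tangent vectors are given by their components in all adapted charts, so the groundwork is
that one chart determines the others. A jet is represented by a Taylor polynomial, and the higher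
chain rule shows that coordinate changes preserve contact of order `r`. -/

noncomputable section

namespace PoincareCartan

/-! ### Calculus of partial derivatives -/

section Calculus

variable {n : ℕ} {E F G : Type*} [NormedAddCommGroup E] [NormedSpace ℝ E]
  [NormedAddCommGroup F] [NormedSpace ℝ F] [NormedAddCommGroup G] [NormedSpace ℝ G]

/-- The iterated partial derivatives along the directions in a list. -/
def listDeriv (l : List (Fin n)) (α : Fin n → ℕ) (f : (Fin n → ℝ) → F) : (Fin n → ℝ) → F :=
  l.foldr (fun i g => (partialDeriv i)^[α i] g) f

theorem multiDeriv_eq_listDeriv (α : Fin n → ℕ) (f : (Fin n → ℝ) → F) :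
    multiDeriv α f = listDeriv (List.finRange n) α f := rfl

theorem listDeriv_cons (i : Fin n) (l : List (Fin n)) (α : Fin n → ℕ) (f : (Fin n → ℝ) → F) :
    listDeriv (i :: l) α f = (partialDeriv i)^[α i] (listDeriv l α f) := rfl

@[simp]
theorem multiDeriv_zero (f : (Fin n → ℝ) → F) : multiDeriv 0 f = f := by
  rw [multiDeriv_eq_listDeriv]
  induction List.finRange n with
  | nil => rfl
  | cons i l ih => simpa [listDeriv_cons] using ih

variable {S : Set (Fin n → ℝ)}

theorem contDiffOn_partialDeriv (hS : IsOpen S) {f : (Fin n → ℝ) → F} (hf : ContDiffOn ℝ ∞ f S)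
    (i : Fin n) : ContDiffOn ℝ ∞ (partialDeriv i f) S :=
  (hf.fderiv_of_isOpen (m := ∞) hS (by simp)).clm_apply contDiffOn_const

theorem contDiffOn_iterate_partialDeriv (hS : IsOpen S) {f : (Fin n → ℝ) → F}
    (hf : ContDiffOn ℝ ∞ f S) (i : Fin n) (m : ℕ) :
    ContDiffOn ℝ ∞ ((partialDeriv i)^[m] f) S := by
  induction m with
  | zero => exact hf
  | succ m ih => rw [Function.iterate_succ_apply']; exact contDiffOn_partialDeriv hS ih i

theorem contDiffOn_listDeriv (hS : IsOpen S) {f : (Fin n → ℝ) → F} (hf : ContDiffOn ℝ ∞ f S)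
    (l : List (Fin n)) (α : Fin n → ℕ) : ContDiffOn ℝ ∞ (listDeriv l α f) S := by
  induction l with
  | nil => exact hf
  | cons i l ih => exact contDiffOn_iterate_partialDeriv hS ih i _

theorem contDiffOn_multiDeriv (hS : IsOpen S) {f : (Fin n → ℝ) → F} (hf : ContDiffOn ℝ ∞ f S)
    (α : Fin n → ℕ) : ContDiffOn ℝ ∞ (multiDeriv α f) S :=
  contDiffOn_listDeriv hS hf _ α

theorem eqOn_partialDeriv (hS : IsOpen S) {f g : (Fin n → ℝ) → F} (h : Set.EqOn f g S)
    (i : Fin n) : Set.EqOn (partialDeriv i f) (partialDeriv i g) S := fun y hy => by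
  have : f =ᶠ[𝓝 y] g := h.eventuallyEq_of_mem (hS.mem_nhds hy)
  simp only [partialDeriv, this.fderiv_eq]

theorem eqOn_iterate_partialDeriv (hS : IsOpen S) {f g : (Fin n → ℝ) → F} (h : Set.EqOn f g S)
    (i : Fin n) (m : ℕ) : Set.EqOn ((partialDeriv i)^[m] f) ((partialDeriv i)^[m] g) S := by
  induction m with
  | zero => exact h
  | succ m ih => simp only [Function.iterate_succ_apply']; exact eqOn_partialDeriv hS ih i

theorem eqOn_listDeriv (hS : IsOpen S) {f g : (Fin n → ℝ) → F} (h : Set.EqOn f g S)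
    (l : List (Fin n)) (α : Fin n → ℕ) : Set.EqOn (listDeriv l α f) (listDeriv l α g) S := by
  induction l with
  | nil => exact h
  | cons i l ih => exact eqOn_iterate_partialDeriv hS ih i _

/-- An iterated derivative at a point depends on the germ there, so the agreement is first spread
over an open set, on which every single differentiation preserves it. -/
theorem multiDeriv_congr {f g : (Fin n → ℝ) → F} {y : Fin n → ℝ} (h : f =ᶠ[𝓝 y] g)
    (α : Fin n → ℕ) : multiDeriv α f y = multiDeriv α g y := by
  obtain ⟨t, ht, hto, hyt⟩ := eventually_nhds_iff.mp h
  exact eqOn_listDeriv hto ht _ α hyt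

theorem partialDeriv_comm (hS : IsOpen S) {f : (Fin n → ℝ) → F} (hf : ContDiffOn ℝ ∞ f S)
    (i j : Fin n) :
    Set.EqOn (partialDeriv i (partialDeriv j f)) (partialDeriv j (partialDeriv i f)) S := by
  intro y hy
  have hfy : ContDiffAt ℝ ∞ f y := hf.contDiffAt (hS.mem_nhds hy)
  have hd : DifferentiableAt ℝ (fderiv ℝ f) y :=
    ((hf.fderiv_of_isOpen (m := ∞) hS (by simp)).contDiffAt (hS.mem_nhds hy)).differentiableAt
      (by simp)
  have key (i j : Fin n) : partialDeriv i (partialDeriv j f) y =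
      fderiv ℝ (fderiv ℝ f) y (Pi.single i 1) (Pi.single j 1) := by
    rw [partialDeriv, show partialDeriv j f = fun y => fderiv ℝ f y (Pi.single j 1) from rfl,
      fderiv_clm_apply hd (differentiableAt_const _)]
    simp
  rw [key, key]
  exact hfy.isSymmSndFDerivAt (by simpa using ENat.LEInfty.out) _ _

theorem partialDeriv_iterate_comm (hS : IsOpen S) {f : (Fin n → ℝ) → F} (hf : ContDiffOn ℝ ∞ f S)
    (i j : Fin n) (m : ℕ) :
    Set.EqOn ((partialDeriv i)^[m] (partialDeriv j f)) (partialDeriv j ((partialDeriv i)^[m] f))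
      S := by
  induction m with
  | zero => exact fun _ _ => rfl
  | succ m ih =>
    simp only [Function.iterate_succ_apply']
    exact (eqOn_partialDeriv hS ih i).trans
      (partialDeriv_comm hS (contDiffOn_iterate_partialDeriv hS hf i m) i j)

theorem listDeriv_add_single_of_notMem {l : List (Fin n)} {μ : Fin n} (h : μ ∉ l)
    (α : Fin n → ℕ) (f : (Fin n → ℝ) → F) :
    listDeriv l (α + Pi.single μ 1) f = listDeriv l α f := by
  induction l with
  | nil => rfl
  | cons i l ih =>
    simp only [List.mem_cons, not_or] at h
    rw [listDeriv_cons, listDeriv_cons, ih h.2]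
    simp [Ne.symm h.1]

/-- The operators are grouped by direction in the order of the list. The additional `∂_μ` appears in
the block of `μ`, and symmetry of second derivatives moves it outward past the blocks of the
preceding directions. -/
theorem listDeriv_add_single (hS : IsOpen S) {f : (Fin n → ℝ) → F} (hf : ContDiffOn ℝ ∞ f S)
    {l : List (Fin n)} (hl : l.Nodup) {μ : Fin n} (h : μ ∈ l) (α : Fin n → ℕ) :
    Set.EqOn (listDeriv l (α + Pi.single μ 1) f) (partialDeriv μ (listDeriv l α f)) S := by
  induction l with
  | nil => simp at h
  | cons i l ih =>
    rw [List.nodup_cons] at hl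
    rw [listDeriv_cons, listDeriv_cons]
    by_cases hi : i = μ
    · subst hi
      rw [listDeriv_add_single_of_notMem hl.1]
      simp only [Pi.add_apply, Pi.single_eq_same, Function.iterate_succ_apply']
      exact fun _ _ => rfl
    · have hm : μ ∈ l := by simpa [Ne.symm hi] using h
      have : (α + Pi.single μ 1 : Fin n → ℕ) i = α i := by simp [hi]
      rw [this]
      exact (eqOn_iterate_partialDeriv hS (ih hl.2 hm) i _).trans
        (partialDeriv_iterate_comm hS (contDiffOn_listDeriv hS hf l α) i μ _)

/-- `∂^{αμ} f = ∂_μ ∂^α f`. -/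
theorem multiDeriv_add_single (hS : IsOpen S) {f : (Fin n → ℝ) → F} (hf : ContDiffOn ℝ ∞ f S)
    (α : Fin n → ℕ) (μ : Fin n) :
    Set.EqOn (multiDeriv (α + Pi.single μ 1) f) (partialDeriv μ (multiDeriv α f)) S :=
  listDeriv_add_single hS hf (List.nodup_finRange n) (List.mem_finRange μ) α

theorem clm_comp_multiDeriv (hS : IsOpen S) {f : (Fin n → ℝ) → F} (hf : ContDiffOn ℝ ∞ f S)
    (A : F →L[ℝ] G) (α : Fin n → ℕ) :
    Set.EqOn (multiDeriv α (fun x => A (f x))) (fun x => A (multiDeriv α f x)) S := by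
  have step {g : (Fin n → ℝ) → F} (hg : ContDiffOn ℝ ∞ g S) (i : Fin n) :
      Set.EqOn (partialDeriv i (fun x => A (g x))) (fun x => A (partialDeriv i g x)) S := by
    intro y hy
    have hd : DifferentiableAt ℝ g y :=
      (hg.contDiffAt (hS.mem_nhds hy)).differentiableAt (by simp)
    have := (A.hasFDerivAt.comp y hd.hasFDerivAt).fderiv
    simp only [partialDeriv]
    rw [show (fun x => A (g x)) = (A ∘ g) from rfl, this]
    rfl
  have steps {g : (Fin n → ℝ) → F} (hg : ContDiffOn ℝ ∞ g S) (i : Fin n) (m : ℕ) :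
      Set.EqOn ((partialDeriv i)^[m] (fun x => A (g x)))
        (fun x => A ((partialDeriv i)^[m] g x)) S := by
    induction m with
    | zero => exact fun _ _ => rfl
    | succ m ih =>
      simp only [Function.iterate_succ_apply']
      exact (eqOn_partialDeriv hS ih i).trans
        (step (contDiffOn_iterate_partialDeriv hS hg i m) i)
  rw [multiDeriv_eq_listDeriv, multiDeriv_eq_listDeriv]
  induction List.finRange n with
  | nil => exact fun _ _ => rfl
  | cons i l ih =>
    rw [listDeriv_cons, listDeriv_cons]
    exact (eqOn_iterate_partialDeriv hS ih i _).trans (steps (contDiffOn_listDeriv hS hf l α) i _)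

theorem multiDeriv_apply {ι : Type*} [Fintype ι] (hS : IsOpen S) {f : (Fin n → ℝ) → ι → ℝ}
    (hf : ContDiffOn ℝ ∞ f S) (α : Fin n → ℕ) (K : ι) {y : Fin n → ℝ} (hy : y ∈ S) :
    multiDeriv α (fun x => f x K) y = multiDeriv α f y K :=
  clm_comp_multiDeriv hS hf (ContinuousLinearMap.proj (R := ℝ) (φ := fun _ : ι => ℝ) K) α hy

/-! ### Contact of functions -/

/-- Dictionary between multi-index derivatives and Fréchet derivatives; the higher chain rule is
used in terms of the latter. -/
theorem iteratedFDeriv_apply_single (hS : IsOpen S) {f : (Fin n → ℝ) → F}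
    (hf : ContDiffOn ℝ ∞ f S) (m : ℕ) (ι : Fin m → Fin n) :
    Set.EqOn (fun y => iteratedFDeriv ℝ m f y (fun j => Pi.single (ι j) 1))
      (multiDeriv (∑ j, Pi.single (ι j) 1) f) S := by
  induction m with
  | zero => intro y _; simp
  | succ m ih =>
    intro y hy
    have hd : DifferentiableAt ℝ (iteratedFDeriv ℝ m f) y := by
      have := hf.contDiffAt (hS.mem_nhds hy)
      exact this.differentiableAt_iteratedFDeriv (by exact_mod_cast ENat.natCast_lt_top m)
    have hsum : ∑ j, (Pi.single (ι j) 1 : Fin n → ℕ) =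
        (∑ j : Fin m, Pi.single (ι j.succ) 1) + Pi.single (ι 0) 1 := by
      rw [Fin.sum_univ_succ, add_comm]
    rw [hsum, multiDeriv_add_single hS hf _ _ hy]
    simp only [iteratedFDeriv_succ_apply_left]
    rw [← eqOn_partialDeriv hS (ih (fun j => ι j.succ)) (ι 0) hy]
    exact (fderiv_continuousMultilinear_apply_const_apply hd _ _).symm

/-- An `m`-linear map is determined by its values on tuples of basis vectors, which here are partial
derivatives of order `m ≤ r`. -/
theorem iteratedFDeriv_eq_of_multiDeriv_eq {S' : Set (Fin n → ℝ)} (hS : IsOpen S)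
    (hS' : IsOpen S') {f g : (Fin n → ℝ) → F}
    (hf : ContDiffOn ℝ ∞ f S) (hg : ContDiffOn ℝ ∞ g S') {y : Fin n → ℝ} (hy : y ∈ S)
    (hy' : y ∈ S') {r : ℕ}
    (h : ∀ α : Fin n → ℕ, ∑ i, α i ≤ r → multiDeriv α f y = multiDeriv α g y) {m : ℕ}
    (hm : m ≤ r) : iteratedFDeriv ℝ m f y = iteratedFDeriv ℝ m g y := by
  apply ContinuousMultilinearMap.toMultilinearMap_injective
  refine Module.Basis.ext_multilinear (fun _ => Pi.basisFun ℝ (Fin n)) fun ι => ?_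
  simp only [Pi.basisFun_apply, ContinuousMultilinearMap.coe_coe]
  have h1 := iteratedFDeriv_apply_single hS hf m ι hy
  have h2 := iteratedFDeriv_apply_single hS' hg m ι hy'
  simp only at h1 h2
  rw [h1, h2]
  apply h
  rw [show ∑ i, (∑ j, Pi.single (ι j) 1 : Fin n → ℕ) i = m by
    simp only [Finset.sum_apply]
    rw [Finset.sum_comm]
    simp]
  exact hm

theorem multiDeriv_eq_of_iteratedFDeriv_eq {S' : Set (Fin n → ℝ)} (hS : IsOpen S)
    (hS' : IsOpen S') {f g : (Fin n → ℝ) → F}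
    (hf : ContDiffOn ℝ ∞ f S) (hg : ContDiffOn ℝ ∞ g S') {y : Fin n → ℝ} (hy : y ∈ S)
    (hy' : y ∈ S') {r : ℕ}
    (h : ∀ m ≤ r, iteratedFDeriv ℝ m f y = iteratedFDeriv ℝ m g y) {α : Fin n → ℕ}
    (hα : ∑ i, α i ≤ r) : multiDeriv α f y = multiDeriv α g y := by
  -- Every multi-index of order `m` is a sum of `m` unit multi-indices, so `∂^α` is a value of the
  -- `m`-th Fréchet derivative on basis vectors.
  have key : ∀ m : ℕ, ∀ α : Fin n → ℕ, ∑ i, α i = m →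
      ∃ ι : Fin m → Fin n, ∑ j, Pi.single (ι j) 1 = α := by
    intro m
    induction m with
    | zero =>
      intro α hα
      refine ⟨Fin.elim0, ?_⟩
      funext i
      simp at hα
      simp [hα]
    | succ m ih =>
      intro α hα
      obtain ⟨i, hi⟩ : ∃ i, α i ≠ 0 := by
        by_contra! hc
        simp [hc] at hα
      have hle : Pi.single i 1 ≤ α := by
        intro j
        by_cases hj : j = i
        · subst hj; simp; omega
        · simp [hj]
      obtain ⟨β, rfl⟩ : ∃ β : Fin n → ℕ, α = Pi.single i 1 + β := exists_add_of_le hle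
      obtain ⟨ι, hι⟩ := ih β (by
        simp [Finset.sum_add_distrib] at hα
        omega)
      exact ⟨Fin.cons i ι, by rw [Fin.sum_univ_succ]; simp [hι]⟩
  obtain ⟨m, hm⟩ : ∃ m, ∑ i, α i = m := ⟨_, rfl⟩
  rw [hm] at hα
  obtain ⟨ι, rfl⟩ := key _ α hm
  rw [← iteratedFDeriv_apply_single hS hf _ ι hy, ← iteratedFDeriv_apply_single hS' hg _ ι hy']
  simp only
  rw [h _ hα]

/-- Faà di Bruno: the derivatives of order `m` of a composite involve those of its two factors only
up to order `m`. Hence contact of order `r` is stable under composition. -/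
theorem iteratedFDeriv_comp_congr {g g' : F → G} {f f' : E → F} {x : E} {r : ℕ}
    (hg : ContDiffAt ℝ ∞ g (f x)) (hf : ContDiffAt ℝ ∞ f x)
    (hg' : ContDiffAt ℝ ∞ g' (f x)) (hf' : ContDiffAt ℝ ∞ f' x)
    (hgg : ∀ m ≤ r, iteratedFDeriv ℝ m g (f x) = iteratedFDeriv ℝ m g' (f x))
    (hff : ∀ m ≤ r, iteratedFDeriv ℝ m f x = iteratedFDeriv ℝ m f' x) {m : ℕ} (hm : m ≤ r) :
    iteratedFDeriv ℝ m (g ∘ f) x = iteratedFDeriv ℝ m (g' ∘ f') x := by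
  have h0 : f' x = f x := by
    have := congrArg (fun A => A 0) (hff 0 (Nat.zero_le _))
    simpa using this.symm
  have hm' : (m : WithTop ℕ∞) ≤ ∞ := by exact_mod_cast le_top
  rw [iteratedFDeriv_comp hg hf hm', iteratedFDeriv_comp (by rwa [h0]) hf' hm', h0]
  simp only [FormalMultilinearSeries.taylorComp]
  refine Finset.sum_congr rfl fun c _ => ?_
  ext v
  simp only [FormalMultilinearSeries.compAlongOrderedFinpartition_apply]
  have h1 : ftaylorSeries ℝ g (f x) c.length = ftaylorSeries ℝ g' (f x) c.length :=
    hgg _ (c.length_le.trans hm)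
  rw [h1]
  congr 1
  funext j
  simp only [OrderedFinpartition.applyOrderedFinpartition]
  have h2 : ftaylorSeries ℝ f x (c.partSize j) = ftaylorSeries ℝ f' x (c.partSize j) :=
    hff _ ((c.partSize_le j).trans hm)
  rw [h2]

/-! ### Smooth dependence on parameters -/

/-- Differentiating in the second variable alone is joint differentiation in the direction `(0,
e_i)`, which preserves joint smoothness in the parameter and the point. -/
theorem exists_multiDeriv_param {S : Set (E × (Fin n → ℝ))} (hS : IsOpen S)
    {g : E × (Fin n → ℝ) → F} (hg : ContDiffOn ℝ ∞ g S) (α : Fin n → ℕ) :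
    ContDiffOn ℝ ∞ (fun p : E × (Fin n → ℝ) => multiDeriv α (fun x => g (p.1, x)) p.2) S := by
  have step {g : E → (Fin n → ℝ) → F} (hg : ContDiffOn ℝ ∞ (fun p : E × (Fin n → ℝ) => g p.1 p.2) S)
      (i : Fin n) :
      ContDiffOn ℝ ∞ (fun p : E × (Fin n → ℝ) => partialDeriv i (g p.1) p.2) S := by
    have h1 : ContDiffOn ℝ ∞ (fun p => fderiv ℝ (fun p : E × (Fin n → ℝ) => g p.1 p.2) p
        (0, Pi.single i 1)) S :=
      (hg.fderiv_of_isOpen (m := ∞) hS (by simp)).clm_apply contDiffOn_const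
    refine h1.congr fun p hp => ?_
    have hd : DifferentiableAt ℝ (fun p : E × (Fin n → ℝ) => g p.1 p.2) (p.1, p.2) :=
      (hg.contDiffAt (hS.mem_nhds hp)).differentiableAt (by simp)
    have h2 : HasFDerivAt (fun x : Fin n → ℝ => (p.1, x))
        (ContinuousLinearMap.inr ℝ E (Fin n → ℝ)) p.2 := hasFDerivAt_prodMk_right p.1 p.2
    have h3 := (hd.hasFDerivAt.comp p.2 h2).fderiv
    simp only [partialDeriv]
    rw [show g p.1 = (fun p : E × (Fin n → ℝ) => g p.1 p.2) ∘ fun x => (p.1, x) from rfl, h3]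
    simp
  have steps {g : E → (Fin n → ℝ) → F}
      (hg : ContDiffOn ℝ ∞ (fun p : E × (Fin n → ℝ) => g p.1 p.2) S) (i : Fin n) (m : ℕ) :
      ContDiffOn ℝ ∞ (fun p : E × (Fin n → ℝ) => (partialDeriv i)^[m] (g p.1) p.2) S := by
    induction m with
    | zero => exact hg
    | succ m ih =>
      simp only [Function.iterate_succ_apply']
      exact step (g := fun p => (partialDeriv i)^[m] (g p)) ih i
  simp only [multiDeriv_eq_listDeriv]
  induction List.finRange n with
  | nil => exact hg
  | cons i l ih =>
    simp only [listDeriv_cons]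
    exact steps (g := fun p => listDeriv l α fun x => g (p, x)) ih i _

/-! ### Taylor polynomials -/

theorem partialDeriv_prod {g : Fin n → ℝ → ℝ} (hg : ∀ i, ContDiff ℝ ∞ (g i)) (i : Fin n) :
    partialDeriv i (fun x : Fin n → ℝ => ∏ j, g j (x j)) =
      fun x => ∏ j, (Function.update g i (deriv (g i)) j) (x j) := by
  funext x
  have hd : ∀ j, HasFDerivAt (fun x : Fin n → ℝ => g j (x j))
      ((deriv (g j) (x j)) • ContinuousLinearMap.proj (R := ℝ) (φ := fun _ : Fin n => ℝ) j) x := by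
    intro j
    have h1 : HasDerivAt (g j) (deriv (g j) (x j)) (x j) :=
      ((hg j).differentiable (by simp) _).hasDerivAt
    exact h1.comp_hasFDerivAt x
      (ContinuousLinearMap.proj (R := ℝ) (φ := fun _ : Fin n => ℝ) j).hasFDerivAt
  have := (HasFDerivAt.finsetProd (u := Finset.univ) fun j _ => hd j).fderiv
  simp only [partialDeriv]
  rw [this, sum_apply]
  rw [Finset.sum_eq_single i]
  · rw [← Finset.mul_prod_erase Finset.univ _ (Finset.mem_univ i)]
    simp only [smul_apply, ContinuousLinearMap.proj_apply, Pi.single_eq_same,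
      smul_eq_mul, mul_one, Function.update_self]
    rw [mul_comm]
    congr 1
    exact Finset.prod_congr rfl fun j hj => by
      rw [Function.update_of_ne (Finset.ne_of_mem_erase hj)]
  · intro j _ hj
    simp [hj]
  · simp

/-- With separated variables each `∂_i` acts on its own factor only. This is what computes the
derivatives of Taylor monomials. -/
theorem multiDeriv_prod {g : Fin n → ℝ → ℝ} (hg : ∀ i, ContDiff ℝ ∞ (g i)) (α : Fin n → ℕ) :
    multiDeriv α (fun x : Fin n → ℝ => ∏ j, g j (x j)) =
      fun x => ∏ j, iteratedDeriv (α j) (g j) (x j) := by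
  have iter_smooth {f : ℝ → ℝ} (hf : ContDiff ℝ ∞ f) (m : ℕ) : ContDiff ℝ ∞ (deriv^[m] f) := by
    rw [← iteratedDeriv_eq_iterate]
    exact hf.iterate_deriv m |> fun h => by rwa [iteratedDeriv_eq_iterate]
  have steps {g : Fin n → ℝ → ℝ} (hg : ∀ i, ContDiff ℝ ∞ (g i)) (i : Fin n) (m : ℕ) :
      (partialDeriv i)^[m] (fun x : Fin n → ℝ => ∏ j, g j (x j)) =
        fun x => ∏ j, (Function.update g i (deriv^[m] (g i)) j) (x j) := by
    induction m with
    | zero => simp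
    | succ m ih =>
      rw [Function.iterate_succ_apply', ih, partialDeriv_prod]
      · simp [Function.iterate_succ_apply']
      · intro j
        by_cases hj : j = i
        · subst hj; simpa using iter_smooth (hg j) m
        · simpa [hj] using hg j
  have key : ∀ l : List (Fin n), l.Nodup →
      listDeriv l α (fun x : Fin n → ℝ => ∏ j, g j (x j)) =
        fun x => ∏ j, (if j ∈ l then deriv^[α j] (g j) else g j) (x j) := by
    intro l
    induction l with
    | nil => intro _; simp [listDeriv]
    | cons i l ih =>
      intro hl
      rw [List.nodup_cons] at hl
      rw [listDeriv_cons, ih hl.2]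
      rw [steps]
      · funext x
        refine Finset.prod_congr rfl fun j _ => ?_
        by_cases hj : j = i
        · subst hj; simp [hl.1]
        · simp [hj]
      · intro j
        split_ifs
        · exact iter_smooth (hg j) _
        · exact hg j
  rw [multiDeriv_eq_listDeriv, key _ (List.nodup_finRange n)]
  simp [iteratedDeriv_eq_iterate]

/-- The polynomial in `x` with prescribed partial derivatives of order `≤ r` at `y`. -/
def jetPoly {N r : ℕ} (y : Fin n → ℝ) (u : JetFibre n N r) (x : Fin n → ℝ) : Fin N → ℝ :=
  fun K => ∑ β : MultiIndex n r, u (β, K) * ∏ i, ((x i - y i) ^ β.1 i / (β.1 i).factorial)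

theorem contDiff_jetPoly {N r : ℕ} :
    ContDiff ℝ ∞ (fun p : ((Fin n → ℝ) × JetFibre n N r) × (Fin n → ℝ) =>
      jetPoly p.1.1 p.1.2 p.2) := by
  unfold jetPoly
  refine contDiff_pi.2 fun K => ContDiff.sum fun β _ => ContDiff.mul (by fun_prop) ?_
  exact contDiff_prod fun i _ => by fun_prop

/-- The monomials `(x - y)^β / β!` are dual to the functionals `f ↦ ∂^α f (y)`, so arbitrary
derivatives can be prescribed. -/
theorem multiDeriv_jetPoly {N r : ℕ} (y : Fin n → ℝ) (u : JetFibre n N r) (α : MultiIndex n r)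
    (K : Fin N) : multiDeriv α.1 (jetPoly y u) y K = u (α, K) := by
  have hsm (β : MultiIndex n r) (i : Fin n) :
      ContDiff ℝ ∞ (fun t : ℝ => (t - y i) ^ β.1 i / (β.1 i).factorial) := by fun_prop
  set e : (Fin n → ℝ) → MultiIndex n r → ℝ :=
    fun x β => ∏ i, ((x i - y i) ^ β.1 i / (β.1 i).factorial) with he
  have hes : ContDiffOn ℝ ∞ e Set.univ :=
    (contDiff_pi.2 fun β => contDiff_prod fun i _ => by fun_prop).contDiffOn
  let A : (MultiIndex n r → ℝ) →L[ℝ] (Fin N → ℝ) := LinearMap.toContinuousLinearMap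
    { toFun := fun w K => ∑ β, u (β, K) * w β
      map_add' := fun w w' => by
        funext K; simp [mul_add, Finset.sum_add_distrib]
      map_smul' := fun a w => by
        funext K; simp [Finset.mul_sum, mul_left_comm] }
  have h1 := clm_comp_multiDeriv isOpen_univ hes A α.1 (Set.mem_univ y)
  have h2 : (fun x => A (e x)) = jetPoly y u := rfl
  rw [h2] at h1
  rw [h1]
  change ∑ β, u (β, K) * multiDeriv α.1 e y β = _
  rw [Finset.sum_eq_single α]
  · rw [← multiDeriv_apply isOpen_univ hes _ _ (Set.mem_univ y)]
    simp only [he]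
    rw [multiDeriv_prod (hsm α)]
    beta_reduce
    rw [Finset.prod_eq_one, mul_one]
    intro i _
    rw [iteratedDeriv_div_const, iteratedDeriv_comp_sub_const (n := α.1 i) (f := fun t => t ^ α.1 i)]
    simp [iteratedDeriv_pow, Nat.descFactorial_self, Nat.factorial_ne_zero]
  · intro β _ hβ
    rw [← multiDeriv_apply isOpen_univ hes _ _ (Set.mem_univ y)]
    simp only [he]
    rw [multiDeriv_prod (hsm β)]
    -- If `β i < α i`, the derivative of order `α i` kills the `i`-th factor; if `β i > α i`, a
    -- positive power of `t - y i` survives and vanishes at `y i`.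
    obtain ⟨i, hi⟩ : ∃ i, β.1 i ≠ α.1 i := by
      by_contra! hc
      exact hβ (Subtype.ext (funext hc))
    beta_reduce
    rw [Finset.prod_eq_zero (Finset.mem_univ i), mul_zero]
    rw [iteratedDeriv_div_const, iteratedDeriv_comp_sub_const (n := α.1 i) (f := fun t => t ^ β.1 i)]
    rcases lt_or_gt_of_ne hi with h | h
    · simp [iteratedDeriv_pow, Nat.descFactorial_eq_zero_iff_lt.2 h]
    · simp [iteratedDeriv_pow, Nat.sub_ne_zero_of_lt h]
  · simp

end Calculus

end PoincareCartan

/-! ### Invariance of contact, and coordinates on jet bundles. -/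

namespace PoincareCartan

/-- Contact of order `r` is preserved by coordinate changes. -/
theorem multiDeriv_transport_congr {n N r : ℕ} {G : Type*} [NormedAddCommGroup G] [NormedSpace ℝ G]
    {A : (Fin n → ℝ) → (Fin n → ℝ)} {SA S : Set (Fin n → ℝ)} (hSA : IsOpen SA) (hS : IsOpen S)
    (hA : ContDiffOn ℝ ∞ A SA) {T : (Fin n → ℝ) × (Fin N → ℝ) → G}
    {ST : Set ((Fin n → ℝ) × (Fin N → ℝ))} (hST : IsOpen ST) (hT : ContDiffOn ℝ ∞ T ST)
    {f g : (Fin n → ℝ) → Fin N → ℝ} (hf : ContDiffOn ℝ ∞ f S) (hg : ContDiffOn ℝ ∞ g S)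
    {y : Fin n → ℝ} (hy : y ∈ SA) (hAy : A y ∈ S) (hTy : (A y, f (A y)) ∈ ST)
    (h : ∀ α : Fin n → ℕ, ∑ i, α i ≤ r → multiDeriv α f (A y) = multiDeriv α g (A y))
    {α : Fin n → ℕ} (hα : ∑ i, α i ≤ r) :
    multiDeriv α (fun x => T (A x, f (A x))) y = multiDeriv α (fun x => T (A x, g (A x))) y := by
  have hfg : g (A y) = f (A y) := by simpa using (h 0 (by simp)).symm
  have aux {f : (Fin n → ℝ) → Fin N → ℝ} (hf : ContDiffOn ℝ ∞ f S) :
      IsOpen (SA ∩ A ⁻¹' (S ∩ (fun x => (x, f x)) ⁻¹' ST)) ∧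
      ContDiffOn ℝ ∞ (fun x => T (A x, f (A x))) (SA ∩ A ⁻¹' (S ∩ (fun x => (x, f x)) ⁻¹' ST)) := by
    have hp : ContDiffOn ℝ ∞ (fun x => (x, f x)) S := contDiffOn_id.prodMk hf
    refine ⟨hA.continuousOn.isOpen_inter_preimage hSA (hp.continuousOn.isOpen_inter_preimage hS hST),
      ?_⟩
    refine (hT.comp (hp.comp (hA.mono ?_) ?_) ?_ :)
    · exact fun x hx => hx.1
    · exact fun x hx => hx.2.1
    · exact fun x hx => hx.2.2
  have hA' := hA.contDiffAt (hSA.mem_nhds hy)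
  have hf' := hf.contDiffAt (hS.mem_nhds hAy)
  have hg' := hg.contDiffAt (hS.mem_nhds hAy)
  have hpf : ContDiffAt ℝ ∞ (fun x => (x, f x)) (A y) := contDiffAt_id.prodMk hf'
  have hpg : ContDiffAt ℝ ∞ (fun x => (x, g x)) (A y) := contDiffAt_id.prodMk hg'
  have hT' := hT.contDiffAt (hST.mem_nhds hTy)
  refine multiDeriv_eq_of_iteratedFDeriv_eq (aux hf).1 (aux hg).1 (aux hf).2 (aux hg).2
    ⟨hy, hAy, hTy⟩ ⟨hy, hAy, by simpa [hfg] using hTy⟩ (r := r) ?_ hα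
  intro m hm
  -- The chain rule is used twice: for `(T ∘ graph) ∘ A`, then for `T ∘ graph`, where the graphs of
  -- `f` and `g` have equal derivatives at `A y` up to order `r`.
  refine iteratedFDeriv_comp_congr (f := A) (f' := A) (r := r) (g := T ∘ fun x => (x, f x))
    (g' := T ∘ fun x => (x, g x)) (ContDiffAt.comp (f := fun x => (x, f x)) (A y) hT' hpf) hA' ?_
    hA' ?_ (fun _ _ => rfl) hm
  · exact ContDiffAt.comp (f := fun x => (x, g x)) (A y) (by simpa [hfg] using hT') hpg
  intro m hm
  refine iteratedFDeriv_comp_congr (r := r) (f := fun x => (x, f x)) (f' := fun x => (x, g x))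
    (x := A y) hT' hpf hT' hpg (fun _ _ => rfl) ?_ hm
  intro m hm
  have hm' : (m : WithTop ℕ∞) ≤ ∞ := by exact_mod_cast le_top
  have h1 := iteratedFDeriv_prodMk (f := fun x : Fin n → ℝ => x) (g := f) (x := A y)
    (i := m) contDiffAt_id hf' hm'
  have h2 := iteratedFDeriv_prodMk (f := fun x : Fin n → ℝ => x) (g := g) (x := A y)
    (i := m) contDiffAt_id hg' hm'
  rw [h1, h2, iteratedFDeriv_eq_of_multiDeriv_eq hS hS hf hg hAy hAy h hm]

variable {d N : ℕ}
  {M : Type*} [TopologicalSpace M] [ChartedSpace (EuclideanSpace ℝ (Fin (d + 1))) M]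
  {Φ : Type*} [TopologicalSpace Φ] [ChartedSpace (EuclideanSpace ℝ (Fin (d + 1 + N))) Φ]
  {π : Φ → M}

/-! ### Transition maps of adapted charts -/

namespace AdaptedChart

variable (c c' : AdaptedChart d N π)

/-- The change of base coordinates. -/
def transBase : (Fin (d + 1) → ℝ) → (Fin (d + 1) → ℝ) := fun y => c'.base (c.base.symm y)

/-- The domain of the change of base coordinates. -/
def overlapBase : Set (Fin (d + 1) → ℝ) := c.base.target ∩ c.base.symm ⁻¹' c'.base.source

/-- The change of coordinates on the total space. -/
def transTotal : (Fin (d + 1) → ℝ) × (Fin N → ℝ) → (Fin (d + 1) → ℝ) × (Fin N → ℝ) :=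
  fun y => c'.total (c.total.symm y)

/-- The domain of the change of coordinates on the total space. -/
def overlap : Set ((Fin (d + 1) → ℝ) × (Fin N → ℝ)) :=
  c.total.target ∩ c.total.symm ⁻¹' c'.total.source

theorem isOpen_overlapBase : IsOpen (c.overlapBase c') :=
  c.base.isOpen_inter_preimage_symm c'.base.open_source

theorem isOpen_overlap : IsOpen (c.overlap c') :=
  c.total.isOpen_inter_preimage_symm c'.total.open_source

theorem contDiffOn_transBase : ContDiffOn ℝ ∞ (c.transBase c') (c.overlapBase c') :=
  contMDiffOn_iff_contDiffOn.1 <| c'.smooth_base.comp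
    (c.smooth_base_symm.mono Set.inter_subset_left) fun _ hy => hy.2

theorem contDiffOn_transTotal : ContDiffOn ℝ ∞ (c.transTotal c') (c.overlap c') :=
  contMDiffOn_iff_contDiffOn.1 <| c'.smooth_total.comp
    (c.smooth_total_symm.mono Set.inter_subset_left) fun _ hy => hy.2

theorem transBase_mem {y : Fin (d + 1) → ℝ} (hy : y ∈ c.overlapBase c') :
    c.transBase c' y ∈ c'.overlapBase c := by
  refine ⟨c'.base.map_source hy.2, ?_⟩
  simp only [transBase, Set.mem_preimage, c'.base.left_inv hy.2]
  exact c.base.map_target hy.1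

theorem transBase_transBase {y : Fin (d + 1) → ℝ} (hy : y ∈ c.overlapBase c') :
    c'.transBase c (c.transBase c' y) = y := by
  simp only [transBase, c'.base.left_inv hy.2, c.base.right_inv hy.1]

variable {c} in
theorem base_proj_symm {y : (Fin (d + 1) → ℝ) × (Fin N → ℝ)} (hy : y ∈ c.total.target) :
    π (c.total.symm y) = c.base.symm y.1 ∧ y.1 ∈ c.base.target := by
  have h1 := c.total.map_target hy
  have h2 := c.fst_eq _ h1
  have h3 := c.mapsTo _ h1
  rw [c.total.right_inv hy] at h2
  rw [h2, c.base.left_inv h3]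
  exact ⟨rfl, c.base.map_source h3⟩

theorem overlap_fst {y : (Fin (d + 1) → ℝ) × (Fin N → ℝ)} (hy : y ∈ c.overlap c') :
    y.1 ∈ c.overlapBase c' ∧ (c.transTotal c' y).1 = c.transBase c' y.1 := by
  have h := base_proj_symm hy.1
  refine ⟨⟨h.2, ?_⟩, ?_⟩
  · rw [Set.mem_preimage, ← h.1]; exact c'.mapsTo _ hy.2
  · simp only [transTotal, transBase, ← h.1]; exact c'.fst_eq _ hy.2

/-- The local expression of a section of `Φ` in an adapted chart. -/
def rep (s : M → Φ) : (Fin (d + 1) → ℝ) → Fin N → ℝ := fun y => (c.total (s (c.base.symm y))).2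

variable {c} in
theorem total_eq_rep {s : M → Φ} {y : Fin (d + 1) → ℝ} (hy : y ∈ c.base.target)
    (h : s (c.base.symm y) ∈ c.total.source) (h' : π (s (c.base.symm y)) = c.base.symm y) :
    c.total (s (c.base.symm y)) = (y, c.rep s y) := by
  refine Prod.ext ?_ rfl
  rw [c.fst_eq _ h, h', c.base.right_inv hy]

/-- The section property and smoothness are known only near `x`; this fixes one open set of
coordinates on which both hold and the section stays in the chart. -/
theorem exists_isOpen_rep {s : M → Φ} {x : M} (hx : s x ∈ c.total.source)
    (hs : ∀ᶠ y in 𝓝 x, π (s y) = y)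
    (hsm : ∀ᶠ y in 𝓝 x, ContMDiffAt (𝓡 (d + 1)) (𝓡 (d + 1 + N)) ∞ s y) :
    ∃ S, IsOpen S ∧ c.base x ∈ S ∧ S ⊆ c.base.target ∧ ContDiffOn ℝ ∞ (c.rep s) S ∧
      ∀ y ∈ S, s (c.base.symm y) ∈ c.total.source ∧ ∀ᶠ x in 𝓝 (c.base.symm y), π (s x) = x ∧
        ContMDiffAt (𝓡 (d + 1)) (𝓡 (d + 1 + N)) ∞ s x := by
  obtain ⟨W, hW, hWo, hxW⟩ := eventually_nhds_iff.1 (hs.and hsm)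
  have hxs : x ∈ c.base.source := by
    have := c.mapsTo _ hx
    rwa [hs.self_of_nhds] at this
  have hsW : ContMDiffOn (𝓡 (d + 1)) (𝓡 (d + 1 + N)) ∞ s W :=
    fun y hy => (hW y hy).2.contMDiffWithinAt
  have hWo' : IsOpen (W ∩ s ⁻¹' c.total.source) :=
    hsW.continuousOn.isOpen_inter_preimage hWo c.total.open_source
  refine ⟨c.base.target ∩ c.base.symm ⁻¹' (W ∩ s ⁻¹' c.total.source),
    c.base.isOpen_inter_preimage_symm hWo', ⟨c.base.map_source hxs, ?_⟩, Set.inter_subset_left,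
    ?_, ?_⟩
  · rw [Set.mem_preimage, c.base.left_inv hxs]
    exact ⟨hxW, hx⟩
  · have h1 : ContMDiffOn 𝓘(ℝ, Fin (d + 1) → ℝ) 𝓘(ℝ, (Fin (d + 1) → ℝ) × (Fin N → ℝ)) ∞
        (fun y => c.total (s (c.base.symm y)))
        (c.base.target ∩ c.base.symm ⁻¹' (W ∩ s ⁻¹' c.total.source)) :=
      c.smooth_total.comp (hsW.comp (c.smooth_base_symm.mono Set.inter_subset_left)
        fun y hy => hy.2.1) fun y hy => hy.2.2
    exact (contMDiffOn_iff_contDiffOn.1 h1).snd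
  · intro y hy
    exact ⟨hy.2.2, Filter.eventually_of_mem (hWo.mem_nhds hy.2.1) hW⟩

end AdaptedChart

/-! ### Jets in coordinates -/

/-- The part of order zero of the fibre coordinates of a jet. -/
def JetFibre.zeroPart {n N r : ℕ} (u : JetFibre n N r) : Fin N → ℝ :=
  fun K => u (MultiIndex.zero n r, K)

theorem contDiff_zeroPart {n N r : ℕ} :
    ContDiff ℝ ∞ (JetFibre.zeroPart : JetFibre n N r → Fin N → ℝ) := by
  unfold JetFibre.zeroPart; fun_prop

@[simp]
theorem jetPoly_self {n N r : ℕ} (y : Fin n → ℝ) (u : JetFibre n N r) :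
    jetPoly y u y = u.zeroPart := by
  funext K
  have := multiDeriv_jetPoly y u (MultiIndex.zero n r) K
  rw [JetFibre.zeroPart, ← this]
  simp [MultiIndex.zero]

theorem contDiff_jetPoly_right {n N r : ℕ} (y : Fin n → ℝ) (u : JetFibre n N r) :
    ContDiff ℝ ∞ (jetPoly y u) :=
  contDiff_jetPoly.comp (contDiff_const (c := (y, u)) |>.prodMk contDiff_id)

/-! ### Transition maps of the jet bundle. -/

namespace AdaptedChart

variable (c c' : AdaptedChart d N π) (r : ℕ)

/-- The range of the coordinates of `r`-jets. -/
def jetTarget : Set (JetModel (d + 1) N r) := {b | (b.1, b.2.zeroPart) ∈ c.total.target}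

/-- The coordinates in the first chart of the `r`-jets in the domains of two charts. -/
def jetOverlap : Set (JetModel (d + 1) N r) := {b | (b.1, b.2.zeroPart) ∈ c.overlap c'}

/-- The change of coordinates on the bundle of `r`-jets. -/
def jetTrans : JetModel (d + 1) N r → JetModel (d + 1) N r := fun b =>
  (c.transBase c' b.1, fun a => multiDeriv a.1.1 (fun x =>
    (c.transTotal c' (c'.transBase c x, jetPoly b.1 b.2 (c'.transBase c x))).2)
      (c.transBase c' b.1) a.2)

theorem contDiff_order_zero :
    ContDiff ℝ ∞ (fun b : JetModel (d + 1) N r => (b.1, b.2.zeroPart)) :=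
  contDiff_fst.prodMk (contDiff_zeroPart.comp contDiff_snd)

theorem isOpen_jetTarget : IsOpen (c.jetTarget r) :=
  c.total.open_target.preimage (contDiff_order_zero r).continuous

theorem isOpen_jetOverlap : IsOpen (c.jetOverlap c' r) :=
  (c.isOpen_overlap c').preimage (contDiff_order_zero r).continuous

/-- The jet is replaced by its Taylor polynomial, which depends smoothly on jet and point together.
Derivatives in the point remain smooth in both, and they are then evaluated along a smooth function
of the jet coordinates. -/
theorem contDiffOn_jetTrans : ContDiffOn ℝ ∞ (c.jetTrans c' r) (c.jetOverlap c' r) := by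
  set S₀ : Set (JetModel (d + 1) N r × (Fin (d + 1) → ℝ)) := Set.univ ×ˢ c'.overlapBase c with hS₀
  have hS₀o : IsOpen S₀ := isOpen_univ.prod (c'.isOpen_overlapBase c)
  have h1 : ContDiffOn ℝ ∞ (fun p : JetModel (d + 1) N r × (Fin (d + 1) → ℝ) =>
      c'.transBase c p.2) S₀ :=
    (c'.contDiffOn_transBase c).comp contDiffOn_snd fun p hp => hp.2
  have h2 : ContDiffOn ℝ ∞ (fun p : JetModel (d + 1) N r × (Fin (d + 1) → ℝ) =>
      (c'.transBase c p.2, jetPoly p.1.1 p.1.2 (c'.transBase c p.2))) S₀ :=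
    h1.prodMk (contDiff_jetPoly.comp_contDiffOn (contDiffOn_fst.prodMk h1))
  have hSo := h2.continuousOn.isOpen_inter_preimage hS₀o (c.isOpen_overlap c')
  have h3 := ((c.contDiffOn_transTotal c').comp (h2.mono Set.inter_subset_left)
    fun p hp => hp.2).snd
  have h4 (α : Fin (d + 1) → ℕ) := exists_multiDeriv_param hSo h3 α
  have hb : ContDiffOn ℝ ∞ (fun b : JetModel (d + 1) N r => c.transBase c' b.1)
      (c.jetOverlap c' r) :=
    (c.contDiffOn_transBase c').comp contDiffOn_fst fun b hb => (c.overlap_fst c' hb).1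
  refine hb.prodMk (contDiffOn_pi.2 fun a => ?_)
  refine contDiffOn_pi.1 ((h4 a.1.1).comp (contDiffOn_id.prodMk hb) ?_) a.2
  intro b hb
  have hb1 := (c.overlap_fst c' hb).1
  refine ⟨⟨trivial, c.transBase_mem c' hb1⟩, ?_⟩
  simp only [Set.mem_preimage, id, c.transBase_transBase c' hb1, jetPoly_self]
  exact hb

end AdaptedChart

namespace Jet

variable {r : ℕ} {c c' : AdaptedChart d N π}

theorem exists_rep (q : Jet d N π r) : ∃ s : LocalSection d N π, jetOf r s = q :=
  Quotient.exists_rep q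

theorem data_injective : Function.Injective (data : Jet d N π r → _) := by
  intro q q' h
  obtain ⟨s, rfl⟩ := q.exists_rep
  obtain ⟨s', rfl⟩ := q'.exists_rep
  exact Quotient.sound h

theorem proj_val (q : Jet d N π r) : π q.val = q.base := by
  obtain ⟨s, rfl⟩ := q.exists_rep
  exact s.isSection.self_of_nhds

theorem base_mem {q : Jet d N π r} (hq : q ∈ dom c) : q.base ∈ c.base.source := by
  have := c.mapsTo _ hq
  rwa [q.proj_val] at this

theorem fibreCoord_jetOf {s : LocalSection d N π} (h : s.toFun s.pt ∈ c.total.source)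
    (a : MultiIndex (d + 1) r × Fin N) :
    (jetOf r s).fibreCoord c a = multiDeriv a.1.1 (c.rep s.toFun) (c.base s.pt) a.2 := by
  simp only [fibreCoord, data, jetOf, Quotient.lift_mk, jetData, if_pos h]
  rfl

theorem fibreCoord_of_notMem {q : Jet d N π r} (h : q ∉ dom c) : q.fibreCoord c = 0 := by
  obtain ⟨s, rfl⟩ := q.exists_rep
  have h' : s.toFun s.pt ∉ c.total.source := h
  simp only [fibreCoord, data, jetOf, Quotient.lift_mk, jetData, if_neg h']

theorem total_val {q : Jet d N π r} (hq : q ∈ dom c) :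
    c.total q.val = ((q.coord c).1, (q.coord c).2.zeroPart) := by
  obtain ⟨s, rfl⟩ := q.exists_rep
  have hb := base_mem hq
  refine Prod.ext ((c.fst_eq _ hq).trans (congrArg c.base (proj_val _))) ?_
  funext K
  change _ = (jetOf r s).fibreCoord c (MultiIndex.zero _ _, K)
  rw [fibreCoord_jetOf hq]
  simp only [MultiIndex.zero, multiDeriv_zero, AdaptedChart.rep]
  have : c.base.symm (c.base s.pt) = s.pt := c.base.left_inv hb
  rw [this]
  rfl

theorem coord_mem {q : Jet d N π r} (hq : q ∈ dom c) : q.coord c ∈ c.jetTarget r := by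
  change ((q.coord c).1, (q.coord c).2.zeroPart) ∈ c.total.target
  rw [← total_val hq]
  exact c.total.map_source hq

theorem symm_coord {q : Jet d N π r} (hq : q ∈ dom c) :
    c.total.symm ((q.coord c).1, (q.coord c).2.zeroPart) = q.val := by
  rw [← total_val hq, c.total.left_inv hq]

theorem coord_mem_overlap {q : Jet d N π r} (hq : q ∈ dom c) (hq' : q ∈ dom c') :
    q.coord c ∈ c.jetOverlap c' r :=
  ⟨coord_mem hq, by rw [Set.mem_preimage, symm_coord hq]; exact hq'⟩

/-- The coordinate change of jets. -/
theorem coord_trans {q : Jet d N π r} (hq : q ∈ dom c) (hq' : q ∈ dom c') :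
    q.coord c' = c.jetTrans c' r (q.coord c) := by
  have hov := coord_mem_overlap hq hq'
  have hov1 := (c.overlap_fst c' hov).1
  obtain ⟨s, rfl⟩ := q.exists_rep
  have hb : s.pt ∈ c.base.source := base_mem hq
  have hb' : s.pt ∈ c'.base.source := base_mem hq'
  have hbase : c.transBase c' (c.base s.pt) = c'.base s.pt := by
    simp only [AdaptedChart.transBase, c.base.left_inv hb]
  refine Prod.ext hbase.symm ?_
  funext a
  change (jetOf r s).fibreCoord c' a = _
  rw [fibreCoord_jetOf hq']
  change _ = multiDeriv a.1.1 (fun x => (c.transTotal c' (c'.transBase c x,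
    jetPoly (c.base s.pt) ((jetOf r s).fibreCoord c) (c'.transBase c x))).2)
      (c.transBase c' (c.base s.pt)) a.2
  rw [hbase]
  obtain ⟨S, hSo, hxS, hSt, hSs, hS⟩ := c.exists_isOpen_rep hq s.isSection s.smooth
  have hAy : c'.transBase c (c'.base s.pt) = c.base s.pt := by
    simp only [AdaptedChart.transBase, c'.base.left_inv hb']
  have hmem : c'.base s.pt ∈ c'.overlapBase c :=
    ⟨c'.base.map_source hb', by rw [Set.mem_preimage, c'.base.left_inv hb']; exact hb⟩
  -- In the second chart the section is the image of its first local expression under the change of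
  -- total coordinates, with the argument moved back by the change of base coordinates.
  have h1 : c'.rep s.toFun =ᶠ[𝓝 (c'.base s.pt)] fun x =>
      (c.transTotal c' (c'.transBase c x, c.rep s.toFun (c'.transBase c x))).2 := by
    have hop := (c'.contDiffOn_transBase c).continuousOn.isOpen_inter_preimage
      (c'.isOpen_overlapBase c) hSo
    filter_upwards [hop.mem_nhds ⟨hmem, by rw [Set.mem_preimage, hAy]; exact hxS⟩] with x hx
    have hxx := hS _ hx.2
    rw [← AdaptedChart.total_eq_rep (hSt hx.2) hxx.1 hxx.2.self_of_nhds.1]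
    simp only [AdaptedChart.transTotal, AdaptedChart.rep]
    rw [c.total.left_inv hxx.1]
    simp only [AdaptedChart.transBase]
    rw [c.base.left_inv hx.1.2]
  rw [multiDeriv_congr h1]
  have hrep : (c.base s.pt, c.rep s.toFun (c.base s.pt)) ∈ c.overlap c' := by
    change (c.base s.pt, JetFibre.zeroPart ((jetOf r s).fibreCoord c)) ∈ c.overlap c' at hov
    convert hov using 2
    funext K
    change _ = (jetOf r s).fibreCoord c (MultiIndex.zero _ _, K)
    rw [fibreCoord_jetOf hq]
    simp [MultiIndex.zero]
  -- The local expression may now be replaced by its Taylor polynomial: both have the same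
  -- derivatives of order `≤ r` at the point, and the coordinate change preserves this.
  refine congrFun (multiDeriv_transport_congr (r := r) (c'.isOpen_overlapBase c) hSo
    (c'.contDiffOn_transBase c) (T := fun p => (c.transTotal c' p).2) (c.isOpen_overlap c')
    (c.contDiffOn_transTotal c').snd hSs
    (g := jetPoly (c.base s.pt) ((jetOf r s).fibreCoord c)) ?_ hmem ?_ ?_ ?_ a.1.2) a.2
  · exact (contDiff_jetPoly_right _ _).contDiffOn
  · rwa [hAy]
  · rwa [hAy]
  · intro α hα
    rw [hAy]
    funext K
    rw [multiDeriv_jetPoly (c.base s.pt) ((jetOf r s).fibreCoord c) ⟨α, hα⟩ K,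
      fibreCoord_jetOf hq]

/-- The coordinates in one chart give the value of the jet, hence its base point, and through
`coord_trans` the coordinates in every other chart around it. At the remaining charts both jets
carry the default `0`. -/
theorem coord_injOn : Set.InjOn (coord c : Jet d N π r → _) (dom c) := by
  intro q hq q' hq' h
  have hval : q.val = q'.val := by rw [← symm_coord hq, h, symm_coord hq']
  refine data_injective (Prod.ext ?_ (Prod.ext hval ?_))
  · change q.base = q'.base
    rw [← q.proj_val, ← q'.proj_val, hval]
  · funext c'
    change q.fibreCoord c' = q'.fibreCoord c'
    by_cases h1 : q ∈ dom c'
    · have h2 : q' ∈ dom c' := by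
        change q'.val ∈ c'.total.source; rw [← hval]; exact h1
      have := (coord_trans hq h1).trans ((congrArg _ h).trans (coord_trans hq' h2).symm)
      exact congrArg Prod.snd this
    · have h2 : q' ∉ dom c' := by
        change q'.val ∉ c'.total.source; rw [← hval]; exact h1
      rw [fibreCoord_of_notMem h1, fibreCoord_of_notMem h2]

/-- The Taylor polynomial is a section realising the given coordinates. Only the order zero part is
constrained by the chart; the higher derivatives are free. -/
theorem exists_localSection {b : JetModel (d + 1) N r} (hb : b ∈ c.jetTarget r) :
    ∃ s : LocalSection d N π, jetOf r s ∈ dom c ∧ (jetOf r s).coord c = b ∧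
      s.pt = c.base.symm b.1 := by
  have hb1 := AdaptedChart.base_proj_symm hb
  have hcont : ContDiff ℝ ∞ (fun y => (y, jetPoly b.1 b.2 y)) :=
    contDiff_id.prodMk (contDiff_jetPoly_right _ _)
  have hpt : c.base.symm b.1 ∈ c.base.source := c.base.map_target hb1.2
  have hWo : IsOpen (c.base.source ∩ c.base ⁻¹' ((fun y => (y, jetPoly b.1 b.2 y)) ⁻¹'
      c.total.target)) :=
    c.base.isOpen_inter_preimage (c.total.open_target.preimage hcont.continuous)
  have hmem : c.base.symm b.1 ∈ c.base.source ∩ c.base ⁻¹' ((fun y => (y, jetPoly b.1 b.2 y)) ⁻¹'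
      c.total.target) := by
    refine ⟨hpt, ?_⟩
    simp only [Set.mem_preimage, c.base.right_inv hb1.2, jetPoly_self]
    exact hb
  have hsm : ContMDiffOn (𝓡 (d + 1)) (𝓡 (d + 1 + N)) ∞
      (fun x => c.total.symm (c.base x, jetPoly b.1 b.2 (c.base x)))
      (c.base.source ∩ c.base ⁻¹' ((fun y => (y, jetPoly b.1 b.2 y)) ⁻¹' c.total.target)) :=
    c.smooth_total_symm.comp (hcont.contMDiff.comp_contMDiffOn
      (c.smooth_base.mono Set.inter_subset_left)) fun x hx => hx.2
  let s : LocalSection d N π :=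
    { pt := c.base.symm b.1
      toFun := fun x => c.total.symm (c.base x, jetPoly b.1 b.2 (c.base x))
      isSection := by
        filter_upwards [hWo.mem_nhds hmem] with x hx
        rw [(AdaptedChart.base_proj_symm hx.2).1]
        exact c.base.left_inv hx.1
      smooth := by
        filter_upwards [hWo.mem_nhds hmem] with x hx
        exact hsm.contMDiffAt (hWo.mem_nhds hx) }
  have hdom : jetOf r s ∈ dom c := c.total.map_target hmem.2
  refine ⟨s, hdom, Prod.ext (c.base.right_inv hb1.2) ?_, rfl⟩
  funext a
  change (jetOf r s).fibreCoord c a = _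
  rw [fibreCoord_jetOf hdom, ← multiDeriv_jetPoly b.1 b.2 a.1 a.2]
  have hy : c.base s.pt = b.1 := c.base.right_inv hb1.2
  rw [hy]
  have hev : c.rep s.toFun =ᶠ[𝓝 b.1] jetPoly b.1 b.2 := by
    have hop := (c.total.open_target.preimage hcont.continuous).inter c.base.open_target
    have hb' : b.1 ∈ (fun y => (y, jetPoly b.1 b.2 y)) ⁻¹' c.total.target ∩ c.base.target :=
      ⟨by rw [Set.mem_preimage, jetPoly_self]; exact hb, hb1.2⟩
    filter_upwards [hop.mem_nhds hb'] with y hy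
    simp only [AdaptedChart.rep, s, c.base.right_inv hy.2]
    rw [c.total.right_inv hy.1]
  rw [multiDeriv_congr hev]

theorem image_coord : coord (r := r) c '' dom c = c.jetTarget r := by
  ext b
  constructor
  · rintro ⟨q, hq, rfl⟩
    exact coord_mem hq
  · intro hb
    obtain ⟨s, h1, h2, -⟩ := exists_localSection hb
    exact ⟨_, h1, h2⟩

end Jet

end PoincareCartan

namespace PoincareCartan

/-! ### Expansion of alternating forms of codimension one -/

section Algebra

variable {n : ℕ} {V : Type*} [AddCommGroup V] [Module ℝ V]

theorem alternating_sum_apply {W ι κ : Type*} [AddCommGroup W] [Module ℝ W] (s : Finset ι)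
    (f : ι → V [⋀^κ]→ₗ[ℝ] W) (v : κ → V) : (∑ i ∈ s, f i) v = ∑ i ∈ s, f i v :=
  map_sum (AddMonoidHom.mk' (fun g : V [⋀^κ]→ₗ[ℝ] W => g v) fun _ _ => rfl) f s

/-- The pairing of a covector-valued vector density with a vector and an `n`-tuple of vectors. -/
def densityPairing {A : Type*} [Fintype A] (P : A × Fin (n + 1) → ℝ) (w : A → ℝ)
    (x : Fin n → Fin (n + 1) → ℝ) : ℝ :=
  ∑ a, ∑ μ, P (a, μ) * (w a * Matrix.det (Fin.cons (Pi.single μ 1) x : Fin (n + 1) → _))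

/-- For `μ = ν`, moving the top row down past `μ` rows yields the identity matrix; for `μ ≠ ν` the
row `e_μ` occurs twice. -/
theorem det_cons_single_succAbove (μ ν : Fin (n + 1)) :
    Matrix.det (Fin.cons (Pi.single μ 1) (fun j => Pi.single (ν.succAbove j) 1) :
      Fin (n + 1) → Fin (n + 1) → ℝ) = if μ = ν then (-1) ^ (ν : ℕ) else 0 := by
  split_ifs with h
  · subst h
    have h1 := AlternatingMap.map_insertNth (Matrix.detRowAlternating (R := ℝ) (n := Fin (n + 1)))
      μ (Pi.single μ 1) (fun j => Pi.single (μ.succAbove j) 1)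
    have h2 : (μ.insertNth (Pi.single μ 1) (fun j => Pi.single (μ.succAbove j) 1) :
        Fin (n + 1) → Fin (n + 1) → ℝ) = (1 : Matrix (Fin (n + 1)) (Fin (n + 1)) ℝ) := by
      funext i
      refine Fin.succAboveCases μ ?_ (fun j => ?_) i
      · rw [Fin.insertNth_apply_same]; funext k; simp [Matrix.one_apply, Pi.single_apply, eq_comm]
      · rw [Fin.insertNth_apply_succAbove]
        funext k; simp [Matrix.one_apply, Pi.single_apply, eq_comm]
    rw [h2] at h1
    have h3 : (1 : ℝ) = (-1) ^ (μ : ℕ) * Matrix.det (Fin.cons (Pi.single μ 1)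
      (fun j => Pi.single (μ.succAbove j) 1) : Fin (n + 1) → Fin (n + 1) → ℝ) := by
      exact Matrix.det_one.symm.trans (h1.trans (by simp; rfl))
    calc _ = ((-1) ^ (μ : ℕ) * (-1) ^ (μ : ℕ)) * Matrix.det (Fin.cons (Pi.single μ 1)
          (fun j => Pi.single (μ.succAbove j) 1) : Fin (n + 1) → Fin (n + 1) → ℝ) := by
            rw [← mul_pow]; simp
      _ = _ := by rw [mul_assoc, ← h3, mul_one]
  · obtain ⟨j, rfl⟩ := Fin.exists_succAbove_eq h
    exact Matrix.det_zero_of_row_eq (i := 0) (j := j.succ) (Fin.succ_ne_zero j).symm (by simp)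

/-- A form of codimension one has one component for each omitted basis vector, and the contractions
of the determinant with the basis vectors are dual to these components up to sign. This is the
expansion in the forms `∂_μ ⌟ d^nx` that defines the momentum coordinates. -/
theorem alternating_eq_sum (e : Module.Basis (Fin (n + 1)) ℝ V) (η : V [⋀^Fin n]→ₗ[ℝ] ℝ)
    (u : Fin n → V) :
    η u = ∑ μ : Fin (n + 1), (-1) ^ (μ : ℕ) * η (fun j => e (μ.succAbove j)) *
      Matrix.det (Fin.cons (Pi.single μ 1) (fun j => e.equivFun (u j)) :
        Fin (n + 1) → Fin (n + 1) → ℝ) := by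
  have key : η = ∑ μ : Fin (n + 1), ((-1) ^ (μ : ℕ) * η (fun j => e (μ.succAbove j))) •
      (((Matrix.detRowAlternating (R := ℝ) (n := Fin (n + 1))).curryLeft
        (Pi.single μ 1)).compLinearMap e.equivFun.toLinearMap) := by
    refine Module.Basis.ext_alternating e fun ι hι => ?_
    -- An injective choice of `n` among `n + 1` basis vectors misses exactly one, so it is
    -- `ν.succAbove` up to a permutation.
    obtain ⟨ν, hν⟩ : ∃ ν, ν ∉ Set.range ι := by
      by_contra! h
      have := Fintype.card_le_of_surjective ι h
      simp at this
    choose τ hτ using fun j => Fin.exists_succAbove_eq (x := ι j) (y := ν)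
      fun h => hν ⟨j, h⟩
    have hinj : Function.Injective τ := fun a b h => hι (by rw [← hτ a, ← hτ b, h])
    let τ' : Equiv.Perm (Fin n) := Equiv.ofBijective τ (Finite.injective_iff_bijective.1 hinj)
    have hι' : (fun j => e (ι j)) = (fun j => e (ν.succAbove j)) ∘ τ' := by
      funext j; simp [τ', hτ]
    rw [hι', AlternatingMap.map_perm, AlternatingMap.map_perm]
    congr 1
    have h3 : (e.equivFun ∘ fun j => e (ν.succAbove j)) =
        fun j => Pi.single (ν.succAbove j) (1 : ℝ) := by
      funext j i; simp [Pi.single_apply, eq_comm]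
    have h4 (μ : Fin (n + 1)) :
        (((Matrix.detRowAlternating (R := ℝ) (n := Fin (n + 1))).curryLeft
          (Pi.single μ 1)).compLinearMap e.equivFun.toLinearMap) (fun j => e (ν.succAbove j)) =
        if μ = ν then (-1) ^ (ν : ℕ) else 0 := by
      rw [← det_cons_single_succAbove μ ν, ← h3]
      rfl
    rw [alternating_sum_apply, Finset.sum_eq_single ν]
    · rw [AlternatingMap.smul_apply, h4, if_pos rfl, smul_eq_mul, mul_right_comm, ← mul_pow]
      simp
    · intro μ _ hμ
      rw [AlternatingMap.smul_apply, h4, if_neg hμ, smul_zero]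
    · simp
  conv_lhs => rw [key]
  rw [alternating_sum_apply]
  rfl

end Algebra

/-! ### Coordinate vectors on the base -/

variable {d N : ℕ}
  {M : Type*} [TopologicalSpace M] [ChartedSpace (EuclideanSpace ℝ (Fin (d + 1))) M]
  {Φ : Type*} [TopologicalSpace Φ] [ChartedSpace (EuclideanSpace ℝ (Fin (d + 1 + N))) Φ]
  {π : Φ → M}

namespace AdaptedChart

variable (c c' : AdaptedChart d N π) {x : M}

/-- The differential of the base coordinates. -/
def baseDiff (x : M) : TangentSpace (𝓡 (d + 1)) x →ₗ[ℝ] (Fin (d + 1) → ℝ) where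
  toFun v := mfderiv (𝓡 (d + 1)) 𝓘(ℝ, Fin (d + 1) → ℝ) c.base x v
  map_add' := map_add _
  map_smul' := map_smul _

/-- The differential of the inverse of the base coordinates. -/
def baseSymmDiff (x : M) : (Fin (d + 1) → ℝ) →ₗ[ℝ] TangentSpace (𝓡 (d + 1)) x where
  toFun v := (mfderiv 𝓘(ℝ, Fin (d + 1) → ℝ) (𝓡 (d + 1)) c.base.symm (c.base x) v :)
  map_add' := map_add (mfderiv 𝓘(ℝ, Fin (d + 1) → ℝ) (𝓡 (d + 1)) c.base.symm (c.base x))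
  map_smul' := map_smul (mfderiv 𝓘(ℝ, Fin (d + 1) → ℝ) (𝓡 (d + 1)) c.base.symm (c.base x))

theorem baseSymmDiff_single (x : M) (μ : Fin (d + 1)) :
    c.baseSymmDiff x (Pi.single μ 1) = c.coordVec x μ := rfl

variable {c}

theorem mdifferentiableAt_base (hx : x ∈ c.base.source) :
    MDifferentiableAt (𝓡 (d + 1)) 𝓘(ℝ, Fin (d + 1) → ℝ) c.base x :=
  (c.smooth_base.contMDiffAt (c.base.open_source.mem_nhds hx)).mdifferentiableAt (by simp)

theorem mdifferentiableAt_base_symm (hx : x ∈ c.base.source) :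
    MDifferentiableAt 𝓘(ℝ, Fin (d + 1) → ℝ) (𝓡 (d + 1)) c.base.symm (c.base x) :=
  (c.smooth_base_symm.contMDiffAt
    (c.base.open_target.mem_nhds (c.base.map_source hx))).mdifferentiableAt (by simp)

theorem baseSymmDiff_baseDiff (hx : x ∈ c.base.source) (v : TangentSpace (𝓡 (d + 1)) x) :
    c.baseSymmDiff x (c.baseDiff x v) = v := by
  have h1 := mfderiv_comp_apply x (mdifferentiableAt_base_symm hx) (mdifferentiableAt_base hx) v
  have h2 : c.base.symm ∘ c.base =ᶠ[𝓝 x] id :=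
    Filter.eventually_of_mem (c.base.open_source.mem_nhds hx) fun y hy => c.base.left_inv hy
  rw [h2.mfderiv_eq, mfderiv_id] at h1
  exact h1.symm

theorem baseDiff_coordVec (hx : x ∈ c.base.source) {c' : AdaptedChart d N π}
    (hx' : x ∈ c'.base.source) (v : Fin (d + 1) → ℝ) :
    c.baseDiff x (c'.baseSymmDiff x v) = fderiv ℝ (c'.transBase c) (c'.base x) v := by
  have hxx : c'.base.symm (c'.base x) = x := c'.base.left_inv hx'
  have h1 := mfderiv_comp_of_eq (x := c'.base x) (mdifferentiableAt_base hx)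
    (mdifferentiableAt_base_symm hx') hxx
  rw [mfderiv_eq_fderiv] at h1
  have h2 := congrArg (fun A => A v) h1
  rw [show (c'.transBase c) = c.base ∘ c'.base.symm from rfl]
  refine Eq.trans ?_ h2.symm
  change mfderiv (𝓡 (d + 1)) 𝓘(ℝ, Fin (d + 1) → ℝ) c.base x _ =
    mfderiv (𝓡 (d + 1)) 𝓘(ℝ, Fin (d + 1) → ℝ) c.base (c'.base.symm (c'.base x)) _
  rw [mfderiv_congr_point hxx]
  rfl

theorem baseDiff_baseSymmDiff (hx : x ∈ c.base.source) (v : Fin (d + 1) → ℝ) :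
    c.baseDiff x (c.baseSymmDiff x v) = v := by
  rw [baseDiff_coordVec hx hx]
  have : c.transBase c =ᶠ[𝓝 (c.base x)] id :=
    Filter.eventually_of_mem (c.base.open_target.mem_nhds (c.base.map_source hx))
      fun y hy => c.base.right_inv hy
  rw [this.fderiv_eq, fderiv_id]
  rfl

/-- The differential of the base coordinates as an isomorphism. -/
def baseEquiv (hx : x ∈ c.base.source) : TangentSpace (𝓡 (d + 1)) x ≃ₗ[ℝ] (Fin (d + 1) → ℝ) :=
  LinearEquiv.ofLinearMap (c.baseDiff x) (c.baseSymmDiff x)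
    (LinearMap.ext (baseDiff_baseSymmDiff hx)) (LinearMap.ext (baseSymmDiff_baseDiff hx))

/-- The basis of coordinate vectors of the tangent space of the base. -/
def coordBasis (hx : x ∈ c.base.source) :
    Module.Basis (Fin (d + 1)) ℝ (TangentSpace (𝓡 (d + 1)) x) :=
  Module.Basis.ofEquivFun (baseEquiv hx)

theorem coordBasis_apply (hx : x ∈ c.base.source) (μ : Fin (d + 1)) :
    coordBasis hx μ = c.coordVec x μ := by
  rw [coordBasis, Module.Basis.coe_ofEquivFun]
  rfl

theorem form_eq_sum (hx : x ∈ c.base.source) (η : TangentSpace (𝓡 (d + 1)) x [⋀^Fin d]→ₗ[ℝ] ℝ)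
    (u : Fin d → TangentSpace (𝓡 (d + 1)) x) :
    η u = ∑ μ : Fin (d + 1), (-1) ^ (μ : ℕ) * η (fun j => c.coordVec x (μ.succAbove j)) *
      Matrix.det (Fin.cons (Pi.single μ 1) (fun j => c.baseDiff x (u j)) :
        Fin (d + 1) → Fin (d + 1) → ℝ) := by
  rw [alternating_eq_sum (coordBasis hx) η u]
  simp only [coordBasis_apply]
  rw [coordBasis, Module.Basis.equivFun_ofEquivFun]
  rfl

theorem top_form_eq (hx : x ∈ c.base.source)
    (η : TangentSpace (𝓡 (d + 1)) x [⋀^Fin (d + 1)]→ₗ[ℝ] ℝ)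
    (u : Fin (d + 1) → TangentSpace (𝓡 (d + 1)) x) :
    η u = η (c.coordVec x) * Matrix.det (fun j => c.baseDiff x (u j)) := by
  have h1 : (coordBasis hx : Fin (d + 1) → _) = c.coordVec x := funext (coordBasis_apply hx)
  conv_lhs => rw [η.eq_smul_basis_det (coordBasis hx)]
  rw [AlternatingMap.smul_apply, h1, smul_eq_mul, Module.Basis.det_apply, ← Matrix.det_transpose]
  rfl

end AdaptedChart

/-! ### Vertical vectors in coordinates -/

theorem hasDerivAt_snd {E F : Type*} [NormedAddCommGroup E] [NormedSpace ℝ E]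
    [NormedAddCommGroup F] [NormedSpace ℝ F] {f : ℝ → E × F} {f' : E × F} {t : ℝ}
    (h : HasDerivAt f f' t) : HasDerivAt (fun t => (f t).2) f'.2 t :=
  HasFDerivAt.comp_hasDerivAt (l := Prod.snd) (l' := ContinuousLinearMap.snd ℝ E F) t
    hasFDerivAt_snd h

namespace Jet

variable {r : ℕ} {c c' : AdaptedChart d N π} {q : Jet d N π r}

theorem contDiffAt_jetTrans (hq : q ∈ dom c) (hq' : q ∈ dom c') :
    ContDiffAt ℝ ∞ (c.jetTrans c' r) (q.coord c) :=
  (c.contDiffOn_jetTrans c' r).contDiffAt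
    ((c.isOpen_jetOverlap c' r).mem_nhds (coord_mem_overlap hq hq'))

theorem hasFDerivAt_jetTrans (hq : q ∈ dom c) (hq' : q ∈ dom c') :
    HasFDerivAt (c.jetTrans c' r) (fderiv ℝ (c.jetTrans c' r) (q.coord c)) (q.coord c) :=
  ((contDiffAt_jetTrans hq hq').differentiableAt (by simp)).hasFDerivAt

/-- The change of components of vertical vectors. -/
theorem vertical_trans (hq : q ∈ dom c) (hq' : q ∈ dom c')
    {v : AdaptedChart d N π → JetFibre (d + 1) N r} (hv : v ∈ q.vertical) :
    v c' = (fderiv ℝ (c.jetTrans c' r) (q.coord c) (0, v c)).2 := by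
  let A : JetFibre (d + 1) N r →ₗ[ℝ] JetFibre (d + 1) N r :=
    LinearMap.snd ℝ _ _ ∘ₗ (fderiv ℝ (c.jetTrans c' r) (q.coord c)).toLinearMap ∘ₗ
      LinearMap.inr ℝ _ _
  let B : (AdaptedChart d N π → JetFibre (d + 1) N r) →ₗ[ℝ] JetFibre (d + 1) N r :=
    LinearMap.proj c' - A ∘ₗ (LinearMap.proj c :
      (AdaptedChart d N π → JetFibre (d + 1) N r) →ₗ[ℝ] JetFibre (d + 1) N r)
  -- The law is linear in `v`, so it is checked on the velocities spanning `q.vertical`, where it is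
  -- the chain rule.
  suffices h : q.vertical ≤ LinearMap.ker B from sub_eq_zero.1 (h hv)
  refine Submodule.span_le.2 ?_
  rintro v ⟨γ, h0, hb, hγ⟩
  refine sub_eq_zero.2 ?_
  obtain ⟨hd, hder⟩ := (hγ c).1 hq
  obtain ⟨hd', hder'⟩ := (hγ c').1 hq'
  have h1 : HasDerivAt (fun t => (γ t).coord c) (0, v c) 0 := by
    simp only [coord, hb]
    exact (hasDerivAt_const _ _).prodMk hder
  have h2 := hasDerivAt_snd (HasFDerivAt.comp_hasDerivAt_of_eq (0 : ℝ)
    (hasFDerivAt_jetTrans hq hq') h1 (by rw [h0]))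
  refine hder'.unique (h2.congr_of_eventuallyEq ?_)
  filter_upwards [hd, hd'] with t ht ht'
  exact congrArg Prod.snd (coord_trans ht ht')

theorem vertical_eq_zero (hq : q ∉ dom c) {v : AdaptedChart d N π → JetFibre (d + 1) N r}
    (hv : v ∈ q.vertical) : v c = 0 := by
  suffices h : q.vertical ≤ LinearMap.ker (LinearMap.proj c : (AdaptedChart d N π →
    JetFibre (d + 1) N r) →ₗ[ℝ] JetFibre (d + 1) N r) from h hv
  refine Submodule.span_le.2 ?_
  rintro v ⟨γ, -, -, hγ⟩
  exact (hγ c).2 hq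

/-- Lifts a coordinate curve to a curve of jets. At `t = 0` and wherever `δ` leaves the chart range
the lift is set to `q`, which is harmless near `0`. -/
theorem exists_curve (hq : q ∈ dom c) {δ : ℝ → JetModel (d + 1) N r} (hδ : ContinuousAt δ 0)
    (h0 : δ 0 = q.coord c) : ∃ γ : ℝ → Jet d N π r, γ 0 = q ∧
      ∀ᶠ t in 𝓝 0, γ t ∈ dom c ∧ (γ t).coord c = δ t := by
  classical
  choose f hf hf' using fun b : c.jetTarget r => (image_coord (c := c) (r := r)).ge b.2
  refine ⟨fun t => if h : t ≠ 0 ∧ δ t ∈ c.jetTarget r then f ⟨δ t, h.2⟩ else q, by simp, ?_⟩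
  have hev : ∀ᶠ t in 𝓝 (0 : ℝ), δ t ∈ c.jetTarget r :=
    hδ.eventually_mem ((c.isOpen_jetTarget r).mem_nhds (by rw [h0]; exact coord_mem hq))
  filter_upwards [hev] with t ht
  by_cases h : t = 0
  · subst h
    simp [hq, h0]
  · rw [dif_pos ⟨h, ht⟩]
    exact ⟨hf _, hf' _⟩

/-- A straight line in the coordinates has the prescribed velocity. Together with `vertical_ext`
this identifies the vertical space, defined as a span, with the space of components in one chart. -/
theorem exists_vertical (hq : q ∈ dom c) (w : JetFibre (d + 1) N r) :
    ∃ v : q.vertical, v.1 c = w := by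
  classical
  have hδ : HasDerivAt (fun t : ℝ => q.coord c + t • ((0, w) : JetModel (d + 1) N r)) (0, w) 0 := by
    simpa using ((hasDerivAt_id (0 : ℝ)).smul_const
      ((0, w) : JetModel (d + 1) N r)).const_add (q.coord c)
  obtain ⟨γ, h0, hγ⟩ := exists_curve (δ := fun t => q.coord c + t • ((0, w) : JetModel (d + 1) N r))
    hq hδ.continuousAt (by simp)
  -- The definition of vertical vectors asks for a constant base point at all `t`, not only near
  -- `0`; resetting the curve to `q` wherever it fails to follow the line ensures this.
  let γ' : ℝ → Jet d N π r := fun t =>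
    if γ t ∈ dom c ∧ (γ t).coord c = q.coord c + t • ((0, w) : JetModel (d + 1) N r) then γ t else q
  have hγ' : ∀ᶠ t in 𝓝 (0 : ℝ), γ' t ∈ dom c ∧
      (γ' t).coord c = q.coord c + t • ((0, w) : JetModel (d + 1) N r) := by
    filter_upwards [hγ] with t ht
    simp only [γ', if_pos ht]
    exact ht
  have h0' : γ' 0 = q := by simp only [γ', h0, ite_self]
  have hb (t : ℝ) : (γ' t).base = q.base := by
    by_cases ht : γ t ∈ dom c ∧ (γ t).coord c = q.coord c + t • ((0, w) : JetModel (d + 1) N r)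
    · simp only [γ', if_pos ht]
      have := congrArg Prod.fst ht.2
      simp only [coord, Prod.fst_add, Prod.smul_fst, smul_zero, add_zero] at this
      exact c.base.injOn (base_mem ht.1) (base_mem hq) this
    · simp only [γ', if_neg ht]
  have hder : HasDerivAt (fun t => (γ' t).coord c) (0, w) 0 :=
    hδ.congr_of_eventuallyEq (hγ'.mono fun t ht => ht.2)
  have hcomp (c' : AdaptedChart d N π) (hq' : q ∈ dom c') :
      (∀ᶠ t in 𝓝 (0 : ℝ), γ' t ∈ dom c') ∧ HasDerivAt (fun t => (γ' t).coord c')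
        (fderiv ℝ (c.jetTrans c' r) (q.coord c) (0, w)) 0 := by
    have hev : ∀ᶠ t in 𝓝 (0 : ℝ), γ' t ∈ dom c' := by
      have : ∀ᶠ t in 𝓝 (0 : ℝ), (γ' t).coord c ∈ c.jetOverlap c' r :=
        hder.continuousAt.eventually_mem ((c.isOpen_jetOverlap c' r).mem_nhds
          (by rw [h0']; exact coord_mem_overlap hq hq'))
      filter_upwards [this, hγ'] with t ht ht'
      have := ht.2
      rw [Set.mem_preimage, symm_coord ht'.1] at this
      exact this
    refine ⟨hev, ?_⟩
    refine (HasFDerivAt.comp_hasDerivAt_of_eq (0 : ℝ) (hasFDerivAt_jetTrans hq hq') hder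
      (by rw [h0'])).congr_of_eventuallyEq ?_
    filter_upwards [hev, hγ'] with t ht ht'
    exact coord_trans ht'.1 ht
  refine ⟨⟨fun c' => if q ∈ dom c' then (fderiv ℝ (c.jetTrans c' r) (q.coord c) (0, w)).2 else 0,
    Submodule.subset_span ⟨γ', h0', hb, fun c' => ⟨fun hq' => ?_, fun hq' => if_neg hq'⟩⟩⟩, ?_⟩
  · simp only [if_pos hq']
    exact ⟨(hcomp c' hq').1, hasDerivAt_snd (hcomp c' hq').2⟩
  · simp only [if_pos hq]
    exact (hasDerivAt_snd (hcomp c hq).2).unique (hasDerivAt_snd hder)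

theorem coordVec_apply (hq : q ∈ dom c) (a : MultiIndex (d + 1) r × Fin N) :
    (q.coordVec c a).1 c = Pi.single a 1 :=
  Function.invFun_eq (f := fun v : q.vertical => v.1 c) (exists_vertical hq _)

theorem vertical_ext (hq : q ∈ dom c) {v w : q.vertical} (h : v.1 c = w.1 c) : v = w := by
  refine Subtype.ext (funext fun c' => ?_)
  by_cases hq' : q ∈ dom c'
  · rw [vertical_trans hq hq' v.2, vertical_trans hq hq' w.2, h]
  · rw [vertical_eq_zero hq' v.2, vertical_eq_zero hq' w.2]

theorem vertical_eq_sum (hq : q ∈ dom c) (v : q.vertical) :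
    v = ∑ a, v.1 c a • q.coordVec c a := by
  refine vertical_ext hq ?_
  funext b
  simp only [AddSubmonoidClass.coe_finsetSum, Finset.sum_apply, Submodule.coe_smul, Pi.smul_apply,
    coordVec_apply hq, smul_eq_mul]
  rw [Finset.sum_eq_single b] <;> simp +contextual [eq_comm]

end Jet

end PoincareCartan

namespace PoincareCartan

/-! ### The phase bundle in coordinates -/

theorem contDiffOn_det {E : Type*} [NormedAddCommGroup E] [NormedSpace ℝ E] {m : ℕ} {S : Set E}
    {A : E → Matrix (Fin m) (Fin m) ℝ} (hA : ∀ i j, ContDiffOn ℝ ∞ (fun y => A y i j) S) :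
    ContDiffOn ℝ ∞ (fun y => (A y).det) S := by
  simp only [Matrix.det_apply]
  exact ContDiffOn.sum fun σ _ => ContDiffOn.const_smul _ (contDiffOn_prod fun i _ => hA _ _)

variable {d N : ℕ}
  {M : Type*} [TopologicalSpace M] [ChartedSpace (EuclideanSpace ℝ (Fin (d + 1))) M]
  {Φ : Type*} [TopologicalSpace Φ] [ChartedSpace (EuclideanSpace ℝ (Fin (d + 1 + N))) Φ]
  {π : Φ → M}

namespace AdaptedChart

variable (c c' : AdaptedChart d N π) (r : ℕ)

/-- The range of the coordinates of the phase bundle. -/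
def phaseTarget : Set (PhaseModel (d + 1) N r) := {y | (y.1, y.2.1) ∈ c.jetTarget r}

/-- The coordinates in the first chart of the points of the phase bundle in two chart domains. -/
def phaseOverlap : Set (PhaseModel (d + 1) N r) := {y | (y.1, y.2.1) ∈ c.jetOverlap c' r}

/-- The change of coordinates on the phase bundle. -/
def phaseTrans : PhaseModel (d + 1) N r → PhaseModel (d + 1) N r := fun y =>
  ((c.jetTrans c' r (y.1, y.2.1)).1, (c.jetTrans c' r (y.1, y.2.1)).2, fun a =>
    (-1) ^ (a.2 : ℕ) * densityPairing y.2.2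
      (fderiv ℝ (c'.jetTrans c r) (c.jetTrans c' r (y.1, y.2.1)) (0, Pi.single a.1 1)).2
      (fun j => fderiv ℝ (c'.transBase c) (c.jetTrans c' r (y.1, y.2.1)).1
        (Pi.single (a.2.succAbove j) 1)))

theorem isOpen_phaseTarget : IsOpen (c.phaseTarget r) :=
  (c.isOpen_jetTarget r).preimage (by fun_prop)

theorem isOpen_phaseOverlap : IsOpen (c.phaseOverlap c' r) :=
  (c.isOpen_jetOverlap c' r).preimage (by fun_prop)

theorem jetTrans_mem {b : JetModel (d + 1) N r} (hb : b ∈ c.jetOverlap c' r) :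
    c.jetTrans c' r b ∈ c'.jetOverlap c r := by
  obtain ⟨q, hq, rfl⟩ := (Jet.image_coord (c := c) (r := r)).ge
    (show b ∈ c.jetTarget r from hb.1)
  have hq' : q ∈ Jet.dom c' := by
    have := hb.2
    rwa [Set.mem_preimage, Jet.symm_coord hq] at this
  rw [← Jet.coord_trans hq hq']
  exact Jet.coord_mem_overlap hq' hq

theorem contDiffOn_phaseTrans : ContDiffOn ℝ ∞ (c.phaseTrans c' r) (c.phaseOverlap c' r) := by
  have hb : ContDiffOn ℝ ∞ (fun y : PhaseModel (d + 1) N r => c.jetTrans c' r (y.1, y.2.1))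
      (c.phaseOverlap c' r) :=
    (c.contDiffOn_jetTrans c' r).comp (by fun_prop) fun y hy => hy
  have hmaps : Set.MapsTo (fun y : PhaseModel (d + 1) N r => c.jetTrans c' r (y.1, y.2.1))
      (c.phaseOverlap c' r) (c'.jetOverlap c r) := fun y hy => c.jetTrans_mem c' r hy
  have hJ : ContDiffOn ℝ ∞ (fun y : PhaseModel (d + 1) N r =>
      fderiv ℝ (c'.jetTrans c r) (c.jetTrans c' r (y.1, y.2.1))) (c.phaseOverlap c' r) :=
    ((c'.contDiffOn_jetTrans c r).fderiv_of_isOpen (m := ∞) (c'.isOpen_jetOverlap c r)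
      (by simp)).comp hb hmaps
  have hB : ContDiffOn ℝ ∞ (fun y : PhaseModel (d + 1) N r =>
      fderiv ℝ (c'.transBase c) (c.jetTrans c' r (y.1, y.2.1)).1) (c.phaseOverlap c' r) :=
    ((c'.contDiffOn_transBase c).fderiv_of_isOpen (m := ∞) (c'.isOpen_overlapBase c)
      (by simp)).comp hb.fst fun y hy => (c'.overlap_fst c (hmaps hy)).1
  refine hb.fst.prodMk (hb.snd.prodMk (contDiffOn_pi.2 fun a => contDiffOn_const.mul ?_))
  refine ContDiffOn.sum fun b _ => ContDiffOn.sum fun μ _ => ContDiffOn.mul ?_ (ContDiffOn.mul ?_ ?_)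
  · fun_prop
  · exact contDiffOn_pi.1 ((hJ.clm_apply contDiffOn_const).snd) b
  · change ContDiffOn ℝ ∞ (fun y : PhaseModel (d + 1) N r => Matrix.det (Fin.cons (Pi.single μ 1)
      (fun j => fderiv ℝ (c'.transBase c) (c.jetTrans c' r (y.1, y.2.1)).1
        (Pi.single (a.2.succAbove j) 1)) : Fin (d + 1) → Fin (d + 1) → ℝ)) _
    refine contDiffOn_det fun i k => ?_
    refine Fin.cases ?_ (fun j => ?_) i
    · exact contDiffOn_const
    · exact contDiffOn_pi.1 (hB.clm_apply contDiffOn_const) k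

end AdaptedChart

namespace Phase

variable {r : ℕ} {c c' : AdaptedChart d N π} {z : Phase d N π r}

/-- A point of the phase bundle as a linear map on vertical vectors. -/
def form (z : Phase d N π r) :
    z.jet.vertical →ₗ[ℝ] (TangentSpace (𝓡 (d + 1)) z.jet.base [⋀^Fin d]→ₗ[ℝ] ℝ) := z.2

theorem momentum_apply (c : AdaptedChart d N π) (z : Phase d N π r)
    (a : (MultiIndex (d + 1) r × Fin N) × Fin (d + 1)) :
    z.momentum c a = (-1) ^ (a.2 : ℕ) * z.form (z.jet.coordVec c a.1)
      (fun j : Fin d => c.coordVec z.jet.base (a.2.succAbove j)) := rfl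

/-- The left side mentions no chart; comparing the right sides in two charts gives the
transformation law of the momenta. -/
theorem form_apply_eq (hz : z ∈ dom c) (v : z.jet.vertical)
    (u : Fin d → TangentSpace (𝓡 (d + 1)) z.jet.base) :
    z.form v u = densityPairing (z.momentum c) (v.1 c) (fun j => c.baseDiff _ (u j)) := by
  have hb : z.jet.base ∈ c.base.source := Jet.base_mem hz
  conv_lhs => rw [Jet.vertical_eq_sum hz v, map_sum, alternating_sum_apply]
  refine Finset.sum_congr rfl fun a _ => ?_
  rw [map_smul, AlternatingMap.smul_apply, AdaptedChart.form_eq_sum hb, smul_eq_mul,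
    Finset.mul_sum]
  refine Finset.sum_congr rfl fun μ _ => ?_
  rw [momentum_apply]
  ring

theorem coord_mem (hz : z ∈ dom c) : z.coord c ∈ c.phaseTarget r := Jet.coord_mem hz

theorem coord_mem_overlap (hz : z ∈ dom c) (hz' : z ∈ dom c') :
    z.coord c ∈ c.phaseOverlap c' r := Jet.coord_mem_overlap hz hz'

theorem mem_dom_of_overlap (hz : z ∈ dom c) (h : z.coord c ∈ c.phaseOverlap c' r) :
    z ∈ dom c' := by
  have := h.2
  rw [Set.mem_preimage] at this
  change c.total.symm ((z.jet.coord c).1, (z.jet.coord c).2.zeroPart) ∈ _ at this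
  rwa [Jet.symm_coord hz] at this

/-- The coordinate change on the phase bundle. -/
theorem coord_trans (hz : z ∈ dom c) (hz' : z ∈ dom c') :
    z.coord c' = c.phaseTrans c' r (z.coord c) := by
  have h := Jet.coord_trans hz hz'
  refine Prod.ext (congrArg Prod.fst h :) (Prod.ext (congrArg Prod.snd h :) ?_)
  funext a
  change z.momentum c' a = (-1) ^ (a.2 : ℕ) * densityPairing (z.momentum c)
    (fderiv ℝ (c'.jetTrans c r) (c.jetTrans c' r (z.jet.coord c)) (0, Pi.single a.1 1)).2
      (fun j => fderiv ℝ (c'.transBase c) (c.jetTrans c' r (z.jet.coord c)).1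
        (Pi.single (a.2.succAbove j) 1))
  rw [← h, momentum_apply, form_apply_eq hz, Jet.vertical_trans (c := c') (c' := c) hz' hz
    (z.jet.coordVec c' a.1).2, Jet.coordVec_apply hz']
  congr 2
  funext j
  rw [← AdaptedChart.baseSymmDiff_single]
  exact AdaptedChart.baseDiff_coordVec (Jet.base_mem hz) (Jet.base_mem hz') _

theorem exists_coord {y : PhaseModel (d + 1) N r} (hy : y ∈ c.phaseTarget r) :
    ∃ z : Phase d N π r, z ∈ dom c ∧ z.coord c = y := by
  obtain ⟨q, hq, hqy⟩ := (Jet.image_coord (c := c) (r := r)).ge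
    (show (y.1, y.2.1) ∈ c.jetTarget r from hy)
  -- `D μ` is the form `∂_μ ⌟ d^nx` at the base point; its value on the coordinate vectors other
  -- than `∂_μ` is the sign `(-1)^μ` that the definition of `momentum` removes.
  let D (μ : Fin (d + 1)) : TangentSpace (𝓡 (d + 1)) q.base [⋀^Fin d]→ₗ[ℝ] ℝ :=
    ((Matrix.detRowAlternating (R := ℝ) (n := Fin (d + 1))).curryLeft
      (Pi.single μ 1)).compLinearMap (c.baseDiff q.base)
  let p : q.vertical →ₗ[ℝ] (TangentSpace (𝓡 (d + 1)) q.base [⋀^Fin d]→ₗ[ℝ] ℝ) :=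
    { toFun := fun v => ∑ a, v.1 c a • ∑ μ, y.2.2 (a, μ) • D μ
      map_add' := fun v w => by simp [add_smul, Finset.sum_add_distrib]
      map_smul' := fun t v => by simp [mul_smul, Finset.smul_sum] }
  refine ⟨⟨q, p⟩, hq, Prod.ext (congrArg Prod.fst hqy :)
    (Prod.ext (congrArg Prod.snd hqy :) ?_)⟩
  funext ⟨a, μ⟩
  change (-1 : ℝ) ^ (μ : ℕ) * p (q.coordVec c a) (fun j : Fin d => c.coordVec q.base
    (μ.succAbove j)) = _
  have hp : p (q.coordVec c a) = ∑ μ, y.2.2 (a, μ) • D μ := by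
    change ∑ b, (q.coordVec c a).1 c b • ∑ μ, y.2.2 (b, μ) • D μ = _
    rw [Jet.coordVec_apply hq, Finset.sum_eq_single a]
    · simp
    · intro b _ hb; simp [hb]
    · simp
  have hD (ν : Fin (d + 1)) : D ν (fun j : Fin d => c.coordVec q.base (μ.succAbove j)) =
      if ν = μ then (-1) ^ (μ : ℕ) else 0 := by
    rw [← det_cons_single_succAbove]
    have : (fun j => c.baseDiff q.base (c.coordVec q.base (μ.succAbove j))) =
        fun j => Pi.single (μ.succAbove j) (1 : ℝ) := by
      funext j
      rw [← AdaptedChart.baseSymmDiff_single, AdaptedChart.baseDiff_baseSymmDiff (Jet.base_mem hq)]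
    rw [← this]
    rfl
  rw [hp, alternating_sum_apply, Finset.sum_eq_single μ]
  · rw [AlternatingMap.smul_apply, hD, if_pos rfl, smul_eq_mul, mul_left_comm, ← mul_pow]
    simp
  · intro ν _ hν
    rw [AlternatingMap.smul_apply, hD, if_neg hν, smul_zero]
  · simp

theorem image_coord : coord (r := r) c '' dom c = c.phaseTarget r := by
  ext y
  constructor
  · rintro ⟨z, hz, rfl⟩
    exact coord_mem hz
  · intro hy
    obtain ⟨z, h1, h2⟩ := exists_coord hy
    exact ⟨z, h1, h2⟩

theorem contDiffAt_phaseTrans (hz : z ∈ dom c) (hz' : z ∈ dom c') :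
    ContDiffAt ℝ ∞ (c.phaseTrans c' r) (z.coord c) :=
  (c.contDiffOn_phaseTrans c' r).contDiffAt
    ((c.isOpen_phaseOverlap c' r).mem_nhds (coord_mem_overlap hz hz'))

theorem hasFDerivAt_phaseTrans (hz : z ∈ dom c) (hz' : z ∈ dom c') :
    HasFDerivAt (c.phaseTrans c' r) (fderiv ℝ (c.phaseTrans c' r) (z.coord c)) (z.coord c) :=
  ((contDiffAt_phaseTrans hz hz').differentiableAt (by simp)).hasFDerivAt

/-- The change of components of tangent vectors of the phase bundle. -/
theorem tangent_trans (hz : z ∈ dom c) (hz' : z ∈ dom c')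
    {v : AdaptedChart d N π → PhaseModel (d + 1) N r} (hv : v ∈ z.tangent) :
    v c' = fderiv ℝ (c.phaseTrans c' r) (z.coord c) (v c) := by
  let B : (AdaptedChart d N π → PhaseModel (d + 1) N r) →ₗ[ℝ] PhaseModel (d + 1) N r :=
    LinearMap.proj c' - (fderiv ℝ (c.phaseTrans c' r) (z.coord c)).toLinearMap ∘ₗ
      (LinearMap.proj c :
        (AdaptedChart d N π → PhaseModel (d + 1) N r) →ₗ[ℝ] PhaseModel (d + 1) N r)
  suffices h : z.tangent ≤ LinearMap.ker B from sub_eq_zero.1 (h hv)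
  refine Submodule.span_le.2 ?_
  rintro v ⟨γ, h0, hγ⟩
  refine sub_eq_zero.2 ?_
  obtain ⟨hd, hder⟩ := (hγ c).1 hz
  obtain ⟨hd', hder'⟩ := (hγ c').1 hz'
  have h2 := HasFDerivAt.comp_hasDerivAt_of_eq (0 : ℝ) (hasFDerivAt_phaseTrans hz hz') hder
    (by rw [h0])
  refine hder'.unique (h2.congr_of_eventuallyEq ?_)
  filter_upwards [hd, hd'] with t ht ht'
  exact coord_trans ht ht'

/-- As for vertical vectors, a straight line in the coordinates has the required velocity, but now
the base point is free to move. In particular `dcoord` is onto. -/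
theorem exists_tangent (hz : z ∈ dom c) (w : PhaseModel (d + 1) N r) :
    ∃ v : z.tangent, v.1 c = w := by
  classical
  have hδ : HasDerivAt (fun t : ℝ => z.coord c + t • w) w 0 := by
    simpa using ((hasDerivAt_id (0 : ℝ)).smul_const w).const_add (z.coord c)
  choose f hf hf' using fun y : c.phaseTarget r => exists_coord y.2
  let γ : ℝ → Phase d N π r := fun t =>
    if h : t ≠ 0 ∧ z.coord c + t • w ∈ c.phaseTarget r then f ⟨_, h.2⟩ else z
  have h0 : γ 0 = z := by simp [γ]
  have hγ : ∀ᶠ t in 𝓝 (0 : ℝ), γ t ∈ dom c ∧ (γ t).coord c = z.coord c + t • w := by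
    have hev : ∀ᶠ t in 𝓝 (0 : ℝ), z.coord c + t • w ∈ c.phaseTarget r :=
      hδ.continuousAt.eventually_mem ((c.isOpen_phaseTarget r).mem_nhds
        (by simpa using coord_mem hz))
    filter_upwards [hev] with t ht
    by_cases h : t = 0
    · subst h
      simp [γ, hz]
    · simp only [γ, dif_pos (show t ≠ 0 ∧ z.coord c + t • w ∈ c.phaseTarget r from ⟨h, ht⟩)]
      exact ⟨hf _, hf' _⟩
  have hder : HasDerivAt (fun t => (γ t).coord c) w 0 :=
    hδ.congr_of_eventuallyEq (hγ.mono fun t ht => ht.2)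
  have hcomp (c' : AdaptedChart d N π) (hz' : z ∈ dom c') :
      (∀ᶠ t in 𝓝 (0 : ℝ), γ t ∈ dom c') ∧ HasDerivAt (fun t => (γ t).coord c')
        (fderiv ℝ (c.phaseTrans c' r) (z.coord c) w) 0 := by
    have hev : ∀ᶠ t in 𝓝 (0 : ℝ), γ t ∈ dom c' := by
      have : ∀ᶠ t in 𝓝 (0 : ℝ), (γ t).coord c ∈ c.phaseOverlap c' r :=
        hder.continuousAt.eventually_mem ((c.isOpen_phaseOverlap c' r).mem_nhds
          (by rw [h0]; exact coord_mem_overlap hz hz'))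
      filter_upwards [this, hγ] with t ht ht'
      exact mem_dom_of_overlap ht'.1 ht
    refine ⟨hev, ?_⟩
    refine (HasFDerivAt.comp_hasDerivAt_of_eq (0 : ℝ) (hasFDerivAt_phaseTrans hz hz') hder
      (by rw [h0])).congr_of_eventuallyEq ?_
    filter_upwards [hev, hγ] with t ht ht'
    exact coord_trans ht'.1 ht
  refine ⟨⟨fun c' => if z ∈ dom c' then fderiv ℝ (c.phaseTrans c' r) (z.coord c) w else 0,
    Submodule.subset_span ⟨γ, h0, fun c' => ⟨fun hz' => ?_, fun hz' => if_neg hz'⟩⟩⟩, ?_⟩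
  · simp only [if_pos hz']
    exact hcomp c' hz'
  · simp only [if_pos hz]
    exact (hcomp c hz).2.unique hder

theorem dcoord_trans (hz : z ∈ dom c) (hz' : z ∈ dom c') (v : z.tangent) :
    z.dcoord c' v = fderiv ℝ (c.phaseTrans c' r) (z.coord c) (z.dcoord c v) :=
  tangent_trans hz hz' v.2

end Phase

end PoincareCartan

namespace PoincareCartan

/-! ### Algebra of the Poincaré–Cartan form -/

section Algebra

variable {n N r : ℕ}

theorem wedge_apply {E : Type*} [AddCommGroup E] [Module ℝ E] {m : ℕ} (a : Fin m → (E →ₗ[ℝ] ℝ))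
    (v : Fin m → E) : wedge a v = Matrix.det (Matrix.of fun i j => a j (v i)) := rfl

theorem wedge_cons {E : Type*} [AddCommGroup E] [Module ℝ E] {m : ℕ} (b : E →ₗ[ℝ] ℝ)
    (a : Fin m → (E →ₗ[ℝ] ℝ)) (v : Fin (m + 1) → E) :
    wedge (Fin.cons b a : Fin (m + 1) → (E →ₗ[ℝ] ℝ)) v =
      ∑ i : Fin (m + 1), (-1) ^ (i : ℕ) * (b (v i) * wedge a (i.removeNth v)) := by
  rw [wedge_apply, Matrix.det_succ_column_zero]
  refine Finset.sum_congr rfl fun i _ => ?_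
  rw [mul_assoc]
  rfl

/-- Laplace expansion along the column `μ`, with each cofactor written as a determinant with top row
`e_μ`, the shape occurring in `densityPairing`. -/
theorem det_updateCol_eq_sum (X : Matrix (Fin (n + 1)) (Fin (n + 1)) ℝ) (μ : Fin (n + 1))
    (t : Fin (n + 1) → ℝ) :
    (X.updateCol μ t).det = ∑ i : Fin (n + 1), (-1) ^ (i : ℕ) * (t i *
      Matrix.det (Fin.cons (Pi.single μ 1) (fun j => X (i.succAbove j)) :
        Fin (n + 1) → Fin (n + 1) → ℝ)) := by
  rw [Matrix.det_succ_column _ μ]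
  refine Finset.sum_congr rfl fun i _ => ?_
  have h : Matrix.det (Fin.cons (Pi.single μ 1) (fun j => X (i.succAbove j)) :
        Fin (n + 1) → Fin (n + 1) → ℝ) =
      (-1) ^ (μ : ℕ) * ((X.updateCol μ t).submatrix i.succAbove μ.succAbove).det := by
    refine (Matrix.det_succ_row_zero _).trans ?_
    rw [Finset.sum_eq_single μ]
    · simp only [Fin.cons_zero, Pi.single_eq_same, mul_one]
      congr 2
      ext k l
      simp [Matrix.submatrix]
    · intro j _ hj
      simp [hj]
    · simp
  rw [h, Matrix.updateCol_self, pow_add]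
  ring

/-- Cramer's rule: putting `X w` in the column `μ` multiplies the determinant by `w μ`. -/
theorem det_updateCol_sub (X : Matrix (Fin n) (Fin n) ℝ) (μ : Fin n) (s w : Fin n → ℝ) :
    (X.updateCol μ (fun i => s i - ∑ ν, X i ν * w ν)).det =
      (X.updateCol μ s).det - w μ * X.det := by
  have h : (fun i => s i - ∑ ν, X i ν * w ν) = s - X.mulVec w := rfl
  rw [h, ← Matrix.cramer_apply, ← Matrix.cramer_apply, map_sub, Pi.sub_apply,
    Matrix.cramer_eq_adjugate_mulVec X (X.mulVec w), Matrix.mulVec_mulVec, Matrix.adjugate_mul,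
    Matrix.smul_mulVec, Matrix.one_mulVec, Pi.smul_apply, smul_eq_mul, mul_comm X.det]

/-- The sum `∑ p^{αμ}_K φ^K_{αμ}`. -/
def momentumPairing (P : (MultiIndex n r × Fin N) × Fin n → ℝ) (φ : JetFibre n N (r + 1)) : ℝ :=
  ∑ α : MultiIndex n r, ∑ K : Fin N, ∑ μ : Fin n, P ((α, K), μ) * φ (α.succ μ, K)

/-- The value of `∑ p^{αμ}_K dx^1 ∧ ⋯ ∧ dφ^K_α ∧ ⋯ ∧ dx^n - h dx^1 ∧ ⋯ ∧ dx^n` on an `n`-tuple of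
vectors with the components `ξ` and `η`. -/
def cartanPotential (P : (MultiIndex n r × Fin N) × Fin n → ℝ) (h : ℝ)
    (ξ : Fin n → Fin n → ℝ) (η : Fin n → JetFibre n N r) : ℝ :=
  ∑ a, ∑ μ, P (a, μ) * ((Matrix.of ξ).updateCol μ (fun i => η i a)).det -
    h * (Matrix.of ξ).det

/-- The values of the contact forms `dφ^K_α - φ^K_{αμ} dx^μ`. -/
def contactPart (φ : JetFibre n N (r + 1)) (ξ : Fin n → ℝ) (η : JetFibre n N r) : JetFibre n N r :=
  fun a => η a - ∑ ν, ξ ν * φ (a.1.succ ν, a.2)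

/-- By Cramer's rule the term `∑ p φ_{αμ} d^nx` is absorbed by replacing each `dφ_α` with the
contact form `dφ_α - φ_{αν} dx^ν`. The right side has two separately intrinsic pieces, the momentum
paired with contact forms and the Lagrangian density. -/
theorem cartanPotential_eq (P : (MultiIndex (n + 1) r × Fin N) × Fin (n + 1) → ℝ)
    (φ : JetFibre (n + 1) N (r + 1)) (L : ℝ)
    (ξ : Fin (n + 1) → Fin (n + 1) → ℝ) (η : Fin (n + 1) → JetFibre (n + 1) N r) :
    cartanPotential P (momentumPairing P φ - L) ξ η =
      ∑ i : Fin (n + 1), (-1) ^ (i : ℕ) * densityPairing P (contactPart φ (ξ i) (η i))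
        (fun j => ξ (i.succAbove j)) + L * (Matrix.of ξ).det := by
  have h1 : ∑ i : Fin (n + 1), (-1) ^ (i : ℕ) * densityPairing P (contactPart φ (ξ i) (η i))
        (fun j => ξ (i.succAbove j)) = ∑ a, ∑ μ, P (a, μ) *
          (((Matrix.of ξ).updateCol μ (fun i => η i a)).det -
            φ (a.1.succ μ, a.2) * (Matrix.of ξ).det) := by
    simp only [densityPairing, Finset.mul_sum]
    rw [Finset.sum_comm]
    refine Finset.sum_congr rfl fun a _ => ?_
    rw [Finset.sum_comm]
    refine Finset.sum_congr rfl fun μ _ => ?_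
    rw [← det_updateCol_sub (Matrix.of ξ) μ (fun i => η i a) (fun ν => φ (a.1.succ ν, a.2)),
      det_updateCol_eq_sum, Finset.mul_sum]
    refine Finset.sum_congr rfl fun i _ => ?_
    have hξ : (fun j => Matrix.of ξ (i.succAbove j)) = fun j => ξ (i.succAbove j) := rfl
    rw [hξ]
    simp only [contactPart, Matrix.of_apply]
    ring
  rw [h1]
  simp only [cartanPotential, momentumPairing, mul_sub, Finset.sum_sub_distrib]
  have h2 : ∑ a : MultiIndex (n + 1) r × Fin N, ∑ μ, P (a, μ) * (φ (a.1.succ μ, a.2) *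
      (Matrix.of ξ).det) = (∑ α : MultiIndex (n + 1) r, ∑ K : Fin N, ∑ μ : Fin (n + 1),
        P ((α, K), μ) * φ (α.succ μ, K)) * (Matrix.of ξ).det := by
    simp only [Fintype.sum_prod_type, Finset.sum_mul, mul_assoc]
  rw [h2]
  ring

/-! ### Splitting off the highest order -/

theorem sum_multiIndex_succ (f : MultiIndex n (r + 1) → ℝ) :
    ∑ β, f β = ∑ α : MultiIndex n r, f ⟨α.1, α.2.trans (Nat.le_succ r)⟩ +
      ∑ ν : TopIndex n (r + 1), f ν.toMultiIndex := by
  rw [← Finset.sum_filter_add_sum_filter_not Finset.univ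
    (fun β : MultiIndex n (r + 1) => ∑ i, β.1 i ≤ r)]
  congr 1
  · refine Finset.sum_bij' (fun β hβ => ⟨β.1, (Finset.mem_filter.1 hβ).2⟩)
      (fun α _ => ⟨α.1, α.2.trans (Nat.le_succ r)⟩) ?_ ?_ ?_ ?_ ?_
    · simp
    · intro α _; simpa using α.2
    · simp
    · simp
    · simp
  · refine Finset.sum_bij' (fun β hβ => ⟨β.1, ?_⟩)
      (fun ν _ => ν.toMultiIndex) ?_ ?_ ?_ ?_ ?_
    · have h1 := (Finset.mem_filter.1 hβ).2
      have h2 := β.2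
      omega
    · simp
    · intro ν _
      have := ν.2
      simp [TopIndex.toMultiIndex, this]
    · simp [TopIndex.toMultiIndex]
    · simp [TopIndex.toMultiIndex]
    · simp [TopIndex.toMultiIndex]

/-- The jet coordinate `φ_{αμ}` depends only on the multi-index `αμ`, so collecting equal
multi-indices leaves the symmetrised momenta. -/
theorem momentumPairing_eq_sum (P : (MultiIndex n r × Fin N) × Fin n → ℝ)
    (φ : JetFibre n N (r + 1)) :
    momentumPairing P φ = ∑ β : MultiIndex n (r + 1), ∑ K, symMomentum P β.1 K * φ (β, K) := by
  have h (K : Fin N) : ∑ β : MultiIndex n (r + 1), symMomentum P β.1 K * φ (β, K) =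
      ∑ α : MultiIndex n r, ∑ μ, P ((α, K), μ) * φ (α.succ μ, K) := by
    simp only [symMomentum, Finset.sum_mul]
    rw [Finset.sum_comm]
    refine Finset.sum_congr rfl fun α _ => ?_
    rw [Finset.sum_comm]
    refine Finset.sum_congr rfl fun μ _ => ?_
    rw [Finset.sum_eq_single (α.succ μ)]
    · simp
    · intro β _ hβ
      rw [if_neg (fun h => hβ (Subtype.ext h.symm)), zero_mul]
    · simp
  rw [Finset.sum_comm]
  simp only [h, momentumPairing]
  rw [Finset.sum_comm]

theorem assemble_of_le (u : JetFibre n N r) (w : TopFibre n N (r + 1)) (α : MultiIndex n (r + 1))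
    (h : ∑ i, α.1 i ≤ r) (K : Fin N) : assemble u w (α, K) = u (⟨α.1, h⟩, K) := dif_pos h

theorem assemble_top (u : JetFibre n N r) (w : TopFibre n N (r + 1)) (ν : TopIndex n (r + 1))
    (K : Fin N) : assemble u w (ν.toMultiIndex, K) = w (ν, K) := by
  have h : ¬ ∑ i, ν.toMultiIndex.1 i ≤ r := by
    have := ν.2
    simp [TopIndex.toMultiIndex, this]
  exact dif_neg h

/-- The part of order `≤ r` of the fibre coordinates of an `(r + 1)`-jet. -/
def lowPart (φ : JetFibre n N (r + 1)) : JetFibre n N r :=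
  fun a => φ (⟨a.1.1, a.1.2.trans (Nat.le_succ r)⟩, a.2)

/-- The highest order part of the fibre coordinates of an `(r + 1)`-jet. -/
def topPart (φ : JetFibre n N (r + 1)) : TopFibre n N (r + 1) := fun a => φ (a.1.toMultiIndex, a.2)

@[simp]
theorem assemble_lowPart_topPart (φ : JetFibre n N (r + 1)) :
    assemble (lowPart φ) (topPart φ) = φ := by
  funext a
  rw [assemble]
  split_ifs <;> rfl

@[simp]
theorem lowPart_assemble (u : JetFibre n N r) (w : TopFibre n N (r + 1)) :
    lowPart (assemble u w) = u := by
  funext a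
  exact assemble_of_le u w _ a.1.2 a.2

@[simp]
theorem topPart_assemble (u : JetFibre n N r) (w : TopFibre n N (r + 1)) :
    topPart (assemble u w) = w := by
  funext a
  exact assemble_top u w a.1 a.2

theorem zeroPart_assemble (u : JetFibre n N r) (w : TopFibre n N (r + 1)) :
    (assemble u w).zeroPart = u.zeroPart := by
  funext K
  exact assemble_of_le u w _ (by simp [MultiIndex.zero]) K

variable (n N r) in
/-- The map `(u, w) ↦ assemble u w` as a continuous linear map. -/
def assembleL : JetFibre n N r × TopFibre n N (r + 1) →L[ℝ] JetFibre n N (r + 1) :=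
  LinearMap.toContinuousLinearMap
    { toFun := fun p => assemble p.1 p.2
      map_add' := fun p p' => by
        funext a; simp only [assemble, Pi.add_apply, Prod.fst_add, Prod.snd_add]; split_ifs <;> rfl
      map_smul' := fun t p => by
        funext a
        simp only [assemble, Pi.smul_apply, Prod.smul_fst, Prod.smul_snd, RingHom.id_apply]
        split_ifs <;> rfl }

theorem assemble_zero_single (a : TopIndex n (r + 1) × Fin N) :
    assemble (r := r) 0 (Pi.single a 1) = Pi.single (a.1.toMultiIndex, a.2) 1 := by
  funext ⟨β, K⟩
  by_cases h : ∑ i, β.1 i ≤ r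
  · rw [assemble_of_le _ _ _ h, Pi.single_eq_of_ne]
    · rfl
    · rintro h'
      have h1 := a.1.2
      rw [Prod.ext_iff] at h'
      have h2 : β.1 = a.1.1 := congrArg Subtype.val h'.1
      rw [h2] at h
      omega
  · obtain ⟨ν, rfl⟩ : ∃ ν : TopIndex n (r + 1), ν.toMultiIndex = β :=
      ⟨⟨β.1, le_antisymm β.2 (not_le.1 h)⟩, rfl⟩
    rw [assemble_top]
    have : ((ν.toMultiIndex, K) = (a.1.toMultiIndex, a.2)) ↔ (ν, K) = a := by
      simp only [Prod.ext_iff, TopIndex.toMultiIndex, Subtype.ext_iff]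
    simp only [Pi.single_apply, this]

/-- The highest derivatives `w` couple only to the highest symmetrised momenta; the first sum does
not involve `w`. -/
theorem momentumPairing_assemble (P : (MultiIndex n r × Fin N) × Fin n → ℝ)
    (u : JetFibre n N r) (w : TopFibre n N (r + 1)) :
    momentumPairing P (assemble u w) =
      ∑ α : MultiIndex n r, ∑ K, symMomentum P α.1 K * u (α, K) +
        ∑ a, topMomentum P a * w a := by
  rw [momentumPairing_eq_sum, sum_multiIndex_succ]
  congr 1
  · refine Finset.sum_congr rfl fun α _ => Finset.sum_congr rfl fun K _ => ?_
    rw [assemble_of_le _ _ _ α.2]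
  · rw [Fintype.sum_prod_type]
    refine Finset.sum_congr rfl fun ν _ => Finset.sum_congr rfl fun K _ => ?_
    rw [assemble_top]
    rfl

end Algebra

end PoincareCartan

namespace PoincareCartan

variable {d N : ℕ}
  {M : Type*} [TopologicalSpace M] [ChartedSpace (EuclideanSpace ℝ (Fin (d + 1))) M]
  {Φ : Type*} [TopologicalSpace Φ] [ChartedSpace (EuclideanSpace ℝ (Fin (d + 1 + N))) Φ]
  {π : Φ → M}

/-! ### Jet prolongations -/

theorem fderiv_eq_sum_partialDeriv {n : ℕ} {F : Type*} [NormedAddCommGroup F] [NormedSpace ℝ F]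
    (f : (Fin n → ℝ) → F) (y ξ : Fin n → ℝ) :
    fderiv ℝ f y ξ = ∑ ν, ξ ν • partialDeriv ν f y := by
  conv_lhs => rw [pi_eq_sum_univ' ξ, map_sum]
  refine Finset.sum_congr rfl fun ν _ => ?_
  rw [map_smul]
  rfl

namespace AdaptedChart

variable (c c' : AdaptedChart d N π) (r : ℕ)

/-- The local expression of the jet prolongation of a section of `Φ`. -/
def prolong (s : M → Φ) (y : Fin (d + 1) → ℝ) : JetModel (d + 1) N r :=
  (y, fun a => multiDeriv a.1.1 (c.rep s) y a.2)

variable {c r} {s : M → Φ} {S : Set (Fin (d + 1) → ℝ)}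

theorem contDiffOn_prolong (hS : IsOpen S) (hs : ContDiffOn ℝ ∞ (c.rep s) S) :
    ContDiffOn ℝ ∞ (c.prolong r s) S :=
  contDiffOn_id.prodMk (contDiffOn_pi.2 fun a =>
    contDiffOn_pi.1 (contDiffOn_multiDeriv hS hs a.1.1) a.2)

/-- The contact forms vanish on prolongations: the tangent vectors to the graph of the `r`-th
prolongation are read off from the `(r + 1)`-jet. -/
theorem fderiv_prolong (hS : IsOpen S) (hs : ContDiffOn ℝ ∞ (c.rep s) S)
    {y : Fin (d + 1) → ℝ} (hy : y ∈ S) (ξ : Fin (d + 1) → ℝ) :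
    fderiv ℝ (c.prolong r s) y ξ =
      (ξ, fun a => ∑ ν, ξ ν * (c.prolong (r + 1) s y).2 (a.1.succ ν, a.2)) := by
  have hd (α : Fin (d + 1) → ℕ) : DifferentiableAt ℝ (multiDeriv α (c.rep s)) y :=
    ((contDiffOn_multiDeriv hS hs α).contDiffAt (hS.mem_nhds hy)).differentiableAt (by simp)
  have hd' (a : MultiIndex (d + 1) r × Fin N) :
      HasFDerivAt (fun y => multiDeriv a.1.1 (c.rep s) y a.2)
        ((ContinuousLinearMap.proj (R := ℝ) (φ := fun _ : Fin N => ℝ) a.2).comp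
          (fderiv ℝ (multiDeriv a.1.1 (c.rep s)) y)) y :=
    (ContinuousLinearMap.proj (R := ℝ) (φ := fun _ : Fin N => ℝ) a.2).hasFDerivAt.comp y
      (hd a.1.1).hasFDerivAt
  have h := ((hasFDerivAt_id (𝕜 := ℝ) y).prodMk (hasFDerivAt_pi.2 hd')).fderiv
  have h2 : (fun y : Fin (d + 1) → ℝ => (id y, fun a : MultiIndex (d + 1) r × Fin N =>
    multiDeriv a.1.1 (c.rep s) y a.2)) = c.prolong r s := rfl
  rw [h2] at h
  rw [h]
  refine Prod.ext rfl (funext fun a => ?_)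
  change fderiv ℝ (multiDeriv a.1.1 (c.rep s)) y ξ a.2 = _
  rw [fderiv_eq_sum_partialDeriv, Finset.sum_apply]
  refine Finset.sum_congr rfl fun ν _ => ?_
  have := multiDeriv_add_single hS hs a.1.1 ν hy
  rw [← this]
  rfl

end AdaptedChart

namespace Jet

variable {r : ℕ} {c c' : AdaptedChart d N π}

theorem coord_jetOf {s : LocalSection d N π} (h : jetOf r s ∈ dom c) :
    (jetOf r s).coord c = c.prolong r s.toFun (c.base s.pt) :=
  Prod.ext rfl (funext fun a => fibreCoord_jetOf h a)

/-- The local expressions of a prolonged section in two charts are related by the coordinate change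
of jets. -/
theorem prolong_trans {s : LocalSection d N π} (h : s.toFun s.pt ∈ c.total.source)
    (h' : s.toFun s.pt ∈ c'.total.source) :
    ∀ᶠ y in 𝓝 (c.base s.pt), c'.prolong r s.toFun (c.transBase c' y) =
      c.jetTrans c' r (c.prolong r s.toFun y) := by
  obtain ⟨S, hSo, hxS, hSt, -, hS⟩ := c.exists_isOpen_rep h s.isSection s.smooth
  have hb : s.pt ∈ c.base.source := base_mem (q := jetOf r s) h
  have hcont : ContinuousAt s.toFun s.pt := s.smooth.self_of_nhds.continuousAt
  have hev : ∀ᶠ y in 𝓝 (c.base s.pt), s.toFun (c.base.symm y) ∈ c'.total.source := by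
    have h1 : Filter.Tendsto c.base.symm (𝓝 (c.base s.pt)) (𝓝 s.pt) := c.base.tendsto_symm hb
    exact h1.eventually (hcont.preimage_mem_nhds (c'.total.open_source.mem_nhds h'))
  filter_upwards [hSo.mem_nhds hxS, hev] with y hy hy'
  let t : LocalSection d N π :=
    { pt := c.base.symm y
      toFun := s.toFun
      isSection := (hS y hy).2.mono fun _ h => h.1
      smooth := (hS y hy).2.mono fun _ h => h.2 }
  have ht : jetOf r t ∈ dom c := (hS y hy).1
  have ht' : jetOf r t ∈ dom c' := hy'
  have h1 := coord_trans ht ht'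
  rw [coord_jetOf ht, coord_jetOf ht'] at h1
  have h2 : c.base t.pt = y := c.base.right_inv (hSt hy)
  rw [h2] at h1
  exact h1

theorem fderiv_jetTrans_fst {q : Jet d N π r} (hq : q ∈ dom c) (hq' : q ∈ dom c')
    (b : JetModel (d + 1) N r) :
    (fderiv ℝ (c.jetTrans c' r) (q.coord c) b).1 = fderiv ℝ (c.transBase c') (c.base q.base) b.1 := by
  have h1 := ((hasFDerivAt_fst (𝕜 := ℝ)).comp (q.coord c) (hasFDerivAt_jetTrans hq hq')).fderiv
  have hov := (c.overlap_fst c' (coord_mem_overlap hq hq')).1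
  have hd : DifferentiableAt ℝ (c.transBase c') (q.coord c).1 :=
    ((c.contDiffOn_transBase c').contDiffAt
      ((c.isOpen_overlapBase c').mem_nhds hov)).differentiableAt (by simp)
  have h2 := (hd.hasFDerivAt.comp (q.coord c) (hasFDerivAt_fst (𝕜 := ℝ))).fderiv
  have h3 : (Prod.fst ∘ c.jetTrans c' r) = c.transBase c' ∘ Prod.fst := rfl
  rw [h3, h2] at h1
  exact (congrArg (fun A => A b) h1).symm

/-- The contact forms are intrinsic. -/
theorem contactPart_trans {s : LocalSection d N π} (h : jetOf r s ∈ dom c)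
    (h' : jetOf r s ∈ dom c') (b : JetModel (d + 1) N r) :
    contactPart ((jetOf (r + 1) s).fibreCoord c')
      (fderiv ℝ (c.jetTrans c' r) ((jetOf r s).coord c) b).1
      (fderiv ℝ (c.jetTrans c' r) ((jetOf r s).coord c) b).2 =
    (fderiv ℝ (c.jetTrans c' r) ((jetOf r s).coord c)
      (0, contactPart ((jetOf (r + 1) s).fibreCoord c) b.1 b.2)).2 := by
  -- The contact part of `b` is what remains after subtracting the vector tangent to the prolonged
  -- section with the same base component.
  have key {c : AdaptedChart d N π} (h : jetOf r s ∈ dom c) (b : JetModel (d + 1) N r) :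
      (0, contactPart ((jetOf (r + 1) s).fibreCoord c) b.1 b.2) =
        b - fderiv ℝ (c.prolong r s.toFun) (c.base s.pt) b.1 := by
    obtain ⟨S, hSo, hxS, -, hs, -⟩ := c.exists_isOpen_rep h s.isSection s.smooth
    rw [AdaptedChart.fderiv_prolong hSo hs hxS]
    refine Prod.ext (sub_self _).symm (funext fun a => ?_)
    have h1 := congrArg Prod.snd (coord_jetOf (r := r + 1) (c := c) (s := s) h)
    change (jetOf (r + 1) s).fibreCoord c = _ at h1
    rw [h1]
    rfl
  have hb : s.pt ∈ c.base.source := base_mem (q := jetOf r s) h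
  have hbase : c.transBase c' (c.base s.pt) = c'.base s.pt := by
    simp only [AdaptedChart.transBase, c.base.left_inv hb]
  have hd {c : AdaptedChart d N π} (h : jetOf r s ∈ dom c) :
      DifferentiableAt ℝ (c.prolong r s.toFun) (c.base s.pt) := by
    obtain ⟨S, hSo, hxS, -, hs, -⟩ := c.exists_isOpen_rep h s.isSection s.smooth
    exact ((AdaptedChart.contDiffOn_prolong hSo hs).contDiffAt
      (hSo.mem_nhds hxS)).differentiableAt (by simp)
  have hT := hasFDerivAt_jetTrans h h'
  rw [coord_jetOf h] at hT
  have hov := (c.overlap_fst c' (coord_mem_overlap h h')).1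
  have hdB : DifferentiableAt ℝ (c.transBase c') (c.base s.pt) :=
    ((c.contDiffOn_transBase c').contDiffAt
      ((c.isOpen_overlapBase c').mem_nhds hov)).differentiableAt (by simp)
  have h1 := (hT.comp (c.base s.pt) (hd h).hasFDerivAt).fderiv
  have hd' := (hd h').hasFDerivAt
  rw [← hbase] at hd'
  have h2 := (hd'.comp (c.base s.pt) hdB.hasFDerivAt).fderiv
  -- The transition map carries one prolonged graph to the other, so its differential carries the
  -- vector subtracted in the first chart to the one subtracted in the second.
  have h3 : (c'.prolong r s.toFun ∘ c.transBase c') =ᶠ[𝓝 (c.base s.pt)]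
      (c.jetTrans c' r ∘ c.prolong r s.toFun) := prolong_trans h h'
  rw [h3.fderiv_eq, h1, hbase] at h2
  have h4 := congrArg (fun A => A b.1) h2
  simp only [ContinuousLinearMap.comp_apply] at h4
  have h5 := key h' (fderiv ℝ (c.jetTrans c' r) ((jetOf r s).coord c) b)
  rw [fderiv_jetTrans_fst h h'] at h5
  rw [fderiv_jetTrans_fst h h']
  have h6 : (jetOf r s).base = s.pt := rfl
  rw [h6] at h5
  rw [← h4] at h5
  rw [key h b, map_sub, coord_jetOf h]
  rw [coord_jetOf h] at h5
  exact congrArg Prod.snd h5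

end Jet

/-! ### Transformation laws of the momenta and of the Lagrangian -/

namespace Phase

variable {r : ℕ} {c c' : AdaptedChart d N π} {z : Phase d N π r}

/-- Both sides are the value of the intrinsic `z.form` on the same vertical vector and the same base
vectors. -/
theorem densityPairing_trans (hz : z ∈ dom c) (hz' : z ∈ dom c') (w : JetFibre (d + 1) N r)
    (X : Fin d → Fin (d + 1) → ℝ) :
    densityPairing (z.momentum c') (fderiv ℝ (c.jetTrans c' r) (z.jet.coord c) (0, w)).2
      (fun j => fderiv ℝ (c.transBase c') (c.base z.jet.base) (X j)) =
    densityPairing (z.momentum c) w X := by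
  obtain ⟨v, rfl⟩ := Jet.exists_vertical (c := c) hz w
  have hb : z.jet.base ∈ c.base.source := Jet.base_mem hz
  have hb' : z.jet.base ∈ c'.base.source := Jet.base_mem hz'
  have h1 := form_apply_eq hz v (fun j => c.baseSymmDiff _ (X j))
  have h2 := form_apply_eq hz' v (fun j => c.baseSymmDiff _ (X j))
  simp only [AdaptedChart.baseDiff_baseSymmDiff hb] at h1
  simp only [AdaptedChart.baseDiff_coordVec hb' hb] at h2
  rw [← h1, h2, ← Jet.vertical_trans hz hz' v.2]

end Phase

namespace Lagrangian

variable {k : ℕ} (𝓛 : Lagrangian d N π k) {c c' : AdaptedChart d N π}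

theorem fn_coord {j : Jet d N π k} (hj : j ∈ Jet.dom c) :
    𝓛.fn c (j.coord c) = 𝓛.toFun j (c.coordVec j.base) := by
  have hinj : Function.Injective (fun j : (Jet.dom c : Set (Jet d N π k)) => j.1.coord c) :=
    fun a b h => Subtype.ext (Jet.coord_injOn a.2 b.2 h)
  exact hinj.extend_apply (fun j => 𝓛.toFun j.1 (c.coordVec j.1.base)) 0 ⟨j, hj⟩

theorem contDiffOn_fn (c : AdaptedChart d N π) : ContDiffOn ℝ ∞ (𝓛.fn c) (c.jetTarget k) := by
  obtain ⟨f, hf, hf'⟩ := 𝓛.smooth c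
  rw [Jet.image_coord] at hf
  refine hf.congr fun b hb => ?_
  obtain ⟨j, hj, rfl⟩ := (Jet.image_coord (c := c) (r := k)).ge hb
  rw [fn_coord 𝓛 hj, hf' j hj]

/-- Both sides are the value of the density at `j` on the same tangent vectors of the base. -/
theorem fn_trans {j : Jet d N π k} (hj : j ∈ Jet.dom c) (hj' : j ∈ Jet.dom c')
    (X : Fin (d + 1) → Fin (d + 1) → ℝ) :
    𝓛.fn c' (j.coord c') *
      (Matrix.of fun i => fderiv ℝ (c.transBase c') (c.base j.base) (X i)).det =
    𝓛.fn c (j.coord c) * (Matrix.of X).det := by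
  have hb : j.base ∈ c.base.source := Jet.base_mem hj
  have hb' : j.base ∈ c'.base.source := Jet.base_mem hj'
  have h1 := AdaptedChart.top_form_eq hb (𝓛.toFun j) (fun i => c.baseSymmDiff _ (X i))
  have h2 := AdaptedChart.top_form_eq hb' (𝓛.toFun j) (fun i => c.baseSymmDiff _ (X i))
  simp only [AdaptedChart.baseDiff_baseSymmDiff hb] at h1
  simp only [AdaptedChart.baseDiff_coordVec hb' hb] at h2
  rw [fn_coord 𝓛 hj, fn_coord 𝓛 hj']
  exact h2.symm.trans h1

variable {r : ℕ} (𝓛 : Lagrangian d N π (r + 1)) {z : Phase d N π r}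

/-- For every `(r + 1)`-jet over the base point of `z` the value of the potential of the
Poincaré–Cartan form does not depend on the chart. -/
theorem cartanPotential_trans (hz : z ∈ Phase.dom c) (hz' : z ∈ Phase.dom c')
    {s : LocalSection d N π} (hs : jetOf r s = z.jet) (b : Fin (d + 1) → JetModel (d + 1) N r) :
    cartanPotential (z.momentum c') (momentumPairing (z.momentum c')
        ((jetOf (r + 1) s).fibreCoord c') - 𝓛.fn c' ((jetOf (r + 1) s).coord c'))
      (fun i => (fderiv ℝ (c.jetTrans c' r) (z.jet.coord c) (b i)).1)
      (fun i => (fderiv ℝ (c.jetTrans c' r) (z.jet.coord c) (b i)).2) =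
    cartanPotential (z.momentum c) (momentumPairing (z.momentum c)
        ((jetOf (r + 1) s).fibreCoord c) - 𝓛.fn c ((jetOf (r + 1) s).coord c))
      (fun i => (b i).1) (fun i => (b i).2) := by
  have hq : jetOf r s ∈ Jet.dom c := by rw [hs]; exact hz
  have hq' : jetOf r s ∈ Jet.dom c' := by rw [hs]; exact hz'
  have hj : jetOf (r + 1) s ∈ Jet.dom c := hq
  have hj' : jetOf (r + 1) s ∈ Jet.dom c' := hq'
  have hbase : (jetOf (r + 1) s).base = z.jet.base := by rw [← hs]; rfl
  rw [cartanPotential_eq, cartanPotential_eq]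
  congr 1
  · refine Finset.sum_congr rfl fun i _ => ?_
    have h1 := Jet.contactPart_trans hq hq' (b i)
    rw [hs] at h1
    rw [h1]
    simp only [Jet.fderiv_jetTrans_fst (q := z.jet) hz hz']
    rw [Phase.densityPairing_trans hz hz' _ (fun j => (b (i.succAbove j)).1)]
  · simp only [Jet.fderiv_jetTrans_fst (q := z.jet) hz hz']
    rw [← hbase]
    exact 𝓛.fn_trans hj hj' (fun i => (b i).1)

end Lagrangian

end PoincareCartan

namespace PoincareCartan

variable {d N : ℕ}
  {M : Type*} [TopologicalSpace M] [ChartedSpace (EuclideanSpace ℝ (Fin (d + 1))) M]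
  {Φ : Type*} [TopologicalSpace Φ] [ChartedSpace (EuclideanSpace ℝ (Fin (d + 1 + N))) Φ]
  {π : Φ → M} {r : ℕ} {c c' : AdaptedChart d N π}

/-! ### The Legendre transformation -/

theorem AdaptedChart.assemble_mem_jetTarget {b : JetModel (d + 1) N r} (hb : b ∈ c.jetTarget r)
    (w : TopFibre (d + 1) N (r + 1)) : (b.1, assemble b.2 w) ∈ c.jetTarget (r + 1) := by
  change (b.1, (assemble b.2 w).zeroPart) ∈ c.total.target
  rw [zeroPart_assemble]
  exact hb

namespace Jet

theorem lowPart_fibreCoord {s : LocalSection d N π} (h : jetOf r s ∈ dom c) :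
    lowPart ((jetOf (r + 1) s).fibreCoord c) = (jetOf r s).fibreCoord c := by
  funext a
  rw [fibreCoord_jetOf h, lowPart, fibreCoord_jetOf h]

theorem exists_prolongation {q : Jet d N π r} (hq : q ∈ dom c) (w : TopFibre (d + 1) N (r + 1)) :
    ∃ s : LocalSection d N π, jetOf r s = q ∧
      (jetOf (r + 1) s).coord c = ((q.coord c).1, assemble (q.fibreCoord c) w) := by
  obtain ⟨s, h1, h2, -⟩ := exists_localSection (AdaptedChart.assemble_mem_jetTarget (coord_mem hq) w)
  refine ⟨s, ?_, h2⟩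
  have h3 : jetOf r s ∈ dom c := h1
  refine coord_injOn h3 hq (Prod.ext (congrArg Prod.fst h2 :) ?_)
  have h4 : (jetOf (r + 1) s).fibreCoord c = assemble (q.fibreCoord c) w :=
    (congrArg Prod.snd h2 :)
  change (jetOf r s).fibreCoord c = q.fibreCoord c
  rw [← lowPart_fibreCoord h3, h4, lowPart_assemble]

end Jet

theorem contDiff_topMomentum {n : ℕ} : ContDiff ℝ ∞
    (topMomentum : ((MultiIndex n r × Fin N) × Fin n → ℝ) → TopFibre n N (r + 1)) := by
  refine contDiff_pi.2 fun a => ContDiff.sum fun α _ => ContDiff.sum fun μ _ => ?_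
  split_ifs <;> fun_prop

namespace Lagrangian

variable (𝓛 : Lagrangian d N π (r + 1))

/-- The fibre coordinates of the `(r + 1)`-jet determined by a point of the phase bundle. -/
def solvedJet (c : AdaptedChart d N π) (y : PhaseModel (d + 1) N r) : JetFibre (d + 1) N (r + 1) :=
  assemble y.2.1 (𝓛.solve c (y.1, y.2.1) (topMomentum y.2.2))

theorem hamiltonian_eq (c : AdaptedChart d N π) (y : PhaseModel (d + 1) N r) :
    𝓛.hamiltonian c y = momentumPairing y.2.2 (𝓛.solvedJet c y) -
      𝓛.fn c (y.1, 𝓛.solvedJet c y) := rfl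

/-- Separates an explicit bilinear term from `h`, so that smoothness and derivatives of `H` reduce
to those of `h`. -/
theorem hamiltonian_eq_legendre (c : AdaptedChart d N π) (y : PhaseModel (d + 1) N r) :
    𝓛.hamiltonian c y = ∑ α : MultiIndex (d + 1) r, ∑ K, symMomentum y.2.2 α.1 K * y.2.1 (α, K) +
      𝓛.legendre c (y.1, y.2.1, topMomentum y.2.2) := by
  rw [hamiltonian_eq, solvedJet, momentumPairing_assemble, legendre, add_sub_assoc]

variable {𝓛}

theorem IsRegular.solve_topDerivative (h : 𝓛.IsRegular) {b : JetModel (d + 1) N r}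
    (hb : b ∈ c.jetTarget r) (w : TopFibre (d + 1) N (r + 1)) :
    𝓛.solve c b (𝓛.topDerivative c b w) = w :=
  Function.leftInverse_invFun ((h c).1 b (by rwa [Jet.image_coord])).1 w

theorem IsRegular.topDerivative_solve (h : 𝓛.IsRegular) {b : JetModel (d + 1) N r}
    (hb : b ∈ c.jetTarget r) (p : TopFibre (d + 1) N (r + 1)) :
    𝓛.topDerivative c b (𝓛.solve c b p) = p :=
  Function.rightInverse_invFun ((h c).1 b (by rwa [Jet.image_coord])).2 p

theorem IsRegular.contDiffOn_solve (h : 𝓛.IsRegular) (c : AdaptedChart d N π) :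
    ContDiffOn ℝ ∞ (fun y : JetModel (d + 1) N r × TopFibre (d + 1) N (r + 1) =>
      𝓛.solve c y.1 y.2) (c.jetTarget r ×ˢ Set.univ) := by
  have := (h c).2
  rwa [Jet.image_coord] at this

theorem IsRegular.contDiffOn_legendre (h : 𝓛.IsRegular) (c : AdaptedChart d N π) :
    ContDiffOn ℝ ∞ (𝓛.legendre c) {y | (y.1, y.2.1) ∈ c.jetTarget r} := by
  have h1 : ContDiffOn ℝ ∞ (fun y : (Fin (d + 1) → ℝ) × JetFibre (d + 1) N r ×
      TopFibre (d + 1) N (r + 1) => 𝓛.solve c (y.1, y.2.1) y.2.2)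
      {y | (y.1, y.2.1) ∈ c.jetTarget r} :=
    (h.contDiffOn_solve c).comp (f := fun y : (Fin (d + 1) → ℝ) × JetFibre (d + 1) N r ×
      TopFibre (d + 1) N (r + 1) => ((y.1, y.2.1), y.2.2)) (by fun_prop) fun y hy => ⟨hy, trivial⟩
  have h2 : ContDiffOn ℝ ∞ (fun y : (Fin (d + 1) → ℝ) × JetFibre (d + 1) N r ×
      TopFibre (d + 1) N (r + 1) => (y.1, assemble y.2.1 (𝓛.solve c (y.1, y.2.1) y.2.2)))
      {y | (y.1, y.2.1) ∈ c.jetTarget r} :=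
    contDiffOn_fst.prodMk ((assembleL (d + 1) N r).contDiff.comp_contDiffOn
      (contDiffOn_snd.fst.prodMk h1))
  refine ContDiffOn.sub (ContDiffOn.sum fun a _ => ContDiffOn.mul (by fun_prop)
    (contDiffOn_pi.1 h1 a)) ((𝓛.contDiffOn_fn c).comp h2 fun y hy => ?_)
  exact AdaptedChart.assemble_mem_jetTarget hy _

theorem IsRegular.contDiffOn_hamiltonian (h : 𝓛.IsRegular) (c : AdaptedChart d N π) :
    ContDiffOn ℝ ∞ (𝓛.hamiltonian c) (c.phaseTarget r) := by
  have h1 : ContDiffOn ℝ ∞ (fun y : PhaseModel (d + 1) N r =>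
      𝓛.legendre c (y.1, y.2.1, topMomentum y.2.2)) (c.phaseTarget r) :=
    (h.contDiffOn_legendre c).comp (f := fun y : PhaseModel (d + 1) N r =>
      (y.1, y.2.1, topMomentum y.2.2)) (contDiffOn_fst.prodMk (contDiffOn_snd.fst.prodMk
        (contDiff_topMomentum.comp_contDiffOn contDiffOn_snd.snd))) fun y hy => hy
  have h2 : 𝓛.hamiltonian c = fun y => ∑ α : MultiIndex (d + 1) r, ∑ K,
      symMomentum y.2.2 α.1 K * y.2.1 (α, K) + 𝓛.legendre c (y.1, y.2.1, topMomentum y.2.2) :=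
    funext (𝓛.hamiltonian_eq_legendre c)
  rw [h2]
  refine ContDiffOn.add (ContDiffOn.sum fun α _ => ContDiffOn.sum fun K _ =>
    ContDiffOn.mul (ContDiffOn.sum fun β _ => ContDiffOn.sum fun μ _ => ?_) (by fun_prop)) h1
  split_ifs <;> fun_prop

variable (𝓛)

/-- The function `∑ p^{αμ}_K φ^K_{αμ} - L` of the derivatives of highest order. -/
def energy (c : AdaptedChart d N π) (b : JetModel (d + 1) N r)
    (P : (MultiIndex (d + 1) r × Fin N) × Fin (d + 1) → ℝ) (w : TopFibre (d + 1) N (r + 1)) : ℝ :=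
  momentumPairing P (assemble b.2 w) - 𝓛.fn c (b.1, assemble b.2 w)

/-- The pairing is affine in `w` with slope the top momenta, so the gradient measures the failure of
`∂L/∂φ_ν = p^ν`. -/
theorem differentiableAt_energy {b : JetModel (d + 1) N r} (hb : b ∈ c.jetTarget r)
    (P : (MultiIndex (d + 1) r × Fin N) × Fin (d + 1) → ℝ) (w : TopFibre (d + 1) N (r + 1)) :
    DifferentiableAt ℝ (𝓛.energy c b P) w ∧ ∀ a, fderiv ℝ (𝓛.energy c b P) w (Pi.single a 1) =
      topMomentum P a - 𝓛.topDerivative c b w a := by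
  have hmem := AdaptedChart.assemble_mem_jetTarget hb w
  have hfn : HasFDerivAt (𝓛.fn c) (fderiv ℝ (𝓛.fn c) (b.1, assemble b.2 w)) (b.1, assemble b.2 w) :=
    (((𝓛.contDiffOn_fn c).contDiffAt
      ((c.isOpen_jetTarget (r + 1)).mem_nhds hmem)).differentiableAt (by simp)).hasFDerivAt
  have hA : HasFDerivAt (fun w : TopFibre (d + 1) N (r + 1) => assemble b.2 w)
      ((assembleL (d + 1) N r).comp (ContinuousLinearMap.inr ℝ _ _)) w :=
    (assembleL (d + 1) N r).hasFDerivAt.comp w (hasFDerivAt_prodMk_right b.2 w)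
  have h1 := hfn.comp w ((hasFDerivAt_const b.1 w).prodMk hA)
  have h2 : HasFDerivAt (fun w : TopFibre (d + 1) N (r + 1) =>
      ∑ α : MultiIndex (d + 1) r, ∑ K, symMomentum P α.1 K * b.2 (α, K) + ∑ a, topMomentum P a * w a)
      (∑ a, topMomentum P a • ContinuousLinearMap.proj (R := ℝ)
        (φ := fun _ : TopIndex (d + 1) (r + 1) × Fin N => ℝ) a) w :=
    (HasFDerivAt.fun_sum fun a _ => ((ContinuousLinearMap.proj (R := ℝ)
        (φ := fun _ : TopIndex (d + 1) (r + 1) × Fin N => ℝ) a).hasFDerivAt.const_mul _)).const_add _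
  have h3 : 𝓛.energy c b P = fun w : TopFibre (d + 1) N (r + 1) =>
      (∑ α : MultiIndex (d + 1) r, ∑ K, symMomentum P α.1 K * b.2 (α, K) +
        ∑ a, topMomentum P a * w a) - 𝓛.fn c (b.1, assemble b.2 w) := by
    funext w
    rw [energy, momentumPairing_assemble]
  have h4 := (h2.sub h1).congr_of_eventuallyEq (Filter.EventuallyEq.of_eq h3)
  refine ⟨h4.differentiableAt, fun a => ?_⟩
  rw [h4.fderiv, topDerivative, ← assemble_zero_single]
  change (∑ a, topMomentum P a • ContinuousLinearMap.proj (R := ℝ)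
    (φ := fun _ : TopIndex (d + 1) (r + 1) × Fin N => ℝ) a) (Pi.single a 1) - _ = _
  congr 1
  rw [sum_apply, Finset.sum_eq_single a]
  · simp
  · intro b _ hb
    simp [hb]
  · simp

/-- Restates the Legendre relation as criticality of a function on the fibre of `(r + 1)`-jets; in
this form it can be compared between charts. -/
theorem fderiv_energy_eq_zero_iff {b : JetModel (d + 1) N r} (hb : b ∈ c.jetTarget r)
    (P : (MultiIndex (d + 1) r × Fin N) × Fin (d + 1) → ℝ) (w : TopFibre (d + 1) N (r + 1)) :
    fderiv ℝ (𝓛.energy c b P) w = 0 ↔ 𝓛.topDerivative c b w = topMomentum P := by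
  have h := (𝓛.differentiableAt_energy hb P w).2
  constructor
  · intro h0
    funext a
    have := h a
    rw [h0] at this
    exact (sub_eq_zero.1 this.symm).symm
  · intro h0
    refine ContinuousLinearMap.ext fun W => ?_
    rw [pi_eq_sum_univ' W, map_sum]
    refine Finset.sum_eq_zero fun a _ => ?_
    rw [map_smul, h, h0, sub_self, smul_zero]

variable {𝓛} {z : Phase d N π r}

/-- The Legendre transformation does not depend on the chart. -/
theorem IsRegular.solvedJet_trans (h : 𝓛.IsRegular) (hz : z ∈ Phase.dom c) (hz' : z ∈ Phase.dom c')
    {s : LocalSection d N π} (hs : jetOf r s = z.jet)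
    (hs' : (jetOf (r + 1) s).fibreCoord c' = 𝓛.solvedJet c' (z.coord c')) :
    (jetOf (r + 1) s).fibreCoord c = 𝓛.solvedJet c (z.coord c) := by
  have hq : jetOf r s ∈ Jet.dom c := by rw [hs]; exact hz
  have hq' : jetOf r s ∈ Jet.dom c' := by rw [hs]; exact hz'
  have hb : z.jet.coord c ∈ c.jetTarget r := Jet.coord_mem hz
  have hb' : z.jet.coord c' ∈ c'.jetTarget r := Jet.coord_mem hz'
  set w₀ := topPart ((jetOf (r + 1) s).fibreCoord c) with hw₀
  have hlow : (jetOf (r + 1) s).fibreCoord c = assemble (z.jet.fibreCoord c) w₀ := by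
    rw [← hs, ← Jet.lowPart_fibreCoord hq, hw₀, assemble_lowPart_topPart]
  -- `g` is the change of the highest derivatives between the charts, with the `r`-jet held fixed.
  set g : TopFibre (d + 1) N (r + 1) → TopFibre (d + 1) N (r + 1) := fun w =>
    topPart (c.jetTrans c' (r + 1) ((z.jet.coord c).1, assemble (z.jet.coord c).2 w)).2 with hg
  have hg₀ : g w₀ = 𝓛.solve c' (z.jet.coord c') (topMomentum (z.momentum c')) := by
    have h1 := Jet.coord_trans (q := jetOf (r + 1) s) hq hq'
    have h2 : (jetOf (r + 1) s).coord c = ((z.jet.coord c).1, assemble (z.jet.coord c).2 w₀) := by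
      refine Prod.ext ?_ hlow
      rw [← hs]; rfl
    rw [h2] at h1
    simp only [hg, ← h1]
    change topPart ((jetOf (r + 1) s).fibreCoord c') = _
    rw [hs', solvedJet, topPart_assemble]
    rfl
  have hcrit : fderiv ℝ (𝓛.energy c' (z.jet.coord c') (z.momentum c')) (g w₀) = 0 := by
    rw [fderiv_energy_eq_zero_iff 𝓛 hb', hg₀, h.topDerivative_solve hb']
  have hdg : DifferentiableAt ℝ g w₀ := by
    have h1 : DifferentiableAt ℝ (c.jetTrans c' (r + 1))
        ((z.jet.coord c).1, assemble (z.jet.coord c).2 w₀) := by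
      refine ((c.contDiffOn_jetTrans c' (r + 1)).contDiffAt
        ((c.isOpen_jetOverlap c' (r + 1)).mem_nhds ?_)).differentiableAt (by simp)
      change (_, (assemble (z.jet.coord c).2 w₀).zeroPart) ∈ c.overlap c'
      rw [zeroPart_assemble]
      exact Jet.coord_mem_overlap hz hz'
    have h2 : DifferentiableAt ℝ (fun w : TopFibre (d + 1) N (r + 1) =>
        ((z.jet.coord c).1, assemble (z.jet.coord c).2 w)) w₀ :=
      (differentiableAt_const _).prodMk ((assembleL (d + 1) N r).differentiableAt.comp w₀
        ((differentiableAt_const (z.jet.coord c).2).prodMk differentiableAt_id))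
    have h3 := (h1.comp w₀ h2).snd
    exact differentiableAt_pi.2 fun a => differentiableAt_pi.1 h3 (a.1.toMultiIndex, a.2)
  let B : Fin (d + 1) → JetModel (d + 1) N r := fun i => (Pi.single i 1, 0)
  let ξ' : Fin (d + 1) → Fin (d + 1) → ℝ := fun i =>
    (fderiv ℝ (c.jetTrans c' r) (z.jet.coord c) (B i)).1
  -- Invariance of the potential for every prolongation is evaluated on the vectors `B i`, whose
  -- base components have determinant `1`. Only the energy terms depend on `w`; the momentum terms
  -- make up the constant `C`.
  obtain ⟨C, hC⟩ : ∃ C, ∀ w, 𝓛.energy c (z.jet.coord c) (z.momentum c) w =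
      𝓛.energy c' (z.jet.coord c') (z.momentum c') (g w) * (Matrix.of ξ').det + C := by
    have hdet : (Matrix.of fun i => (B i).1).det = 1 := by
      rw [← Matrix.det_one (R := ℝ) (n := Fin (d + 1))]
      congr 1
      ext i j
      simp [B, Matrix.one_apply, Pi.single_apply, eq_comm]
    refine ⟨cartanPotential (z.momentum c) 0 (fun i => (B i).1) (fun i => (B i).2) -
      cartanPotential (z.momentum c') 0 ξ'
        (fun i => (fderiv ℝ (c.jetTrans c' r) (z.jet.coord c) (B i)).2), fun w => ?_⟩
    obtain ⟨t, ht, htw⟩ := Jet.exists_prolongation (q := z.jet) hz w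
    have htq : jetOf r t ∈ Jet.dom c := by rw [ht]; exact hz
    have htq' : jetOf r t ∈ Jet.dom c' := by rw [ht]; exact hz'
    have h1 := 𝓛.cartanPotential_trans hz hz' ht B
    have h2 : (jetOf (r + 1) t).fibreCoord c = assemble (z.jet.coord c).2 w :=
      (congrArg Prod.snd htw :)
    have h3 := Jet.coord_trans (q := jetOf (r + 1) t) htq htq'
    rw [htw] at h3
    have h4 : (jetOf (r + 1) t).fibreCoord c' = assemble (z.jet.coord c').2 (g w) := by
      have h5 : topPart ((jetOf (r + 1) t).fibreCoord c') = g w := by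
        change topPart ((jetOf (r + 1) t).coord c').2 = _
        rw [h3]
        rfl
      have h6 := Jet.lowPart_fibreCoord htq'
      rw [ht] at h6
      rw [← h5, ← assemble_lowPart_topPart ((jetOf (r + 1) t).fibreCoord c'), h6]
      simp only [topPart_assemble]
      rfl
    have h7 : (jetOf (r + 1) t).coord c' =
        ((z.jet.coord c').1, assemble (z.jet.coord c').2 (g w)) := by
      refine Prod.ext ?_ h4
      rw [← ht]; rfl
    rw [h7, h4, htw, h2] at h1
    simp only [cartanPotential] at h1 ⊢
    rw [hdet] at h1 ⊢
    simp only [energy]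
    change _ - _ * (Matrix.of ξ').det = _ at h1
    have h8 : (Jet.coord c z.jet).2 = z.jet.fibreCoord c := rfl
    rw [h8] at h1 ⊢
    have h9 : (Jet.coord c z.jet).1 = c.base z.jet.base := rfl
    rw [h9] at h1 ⊢
    linarith
  -- The energy in `c` is an affine function of the energy in `c'` composed with `g`, so a critical
  -- point at `g w₀` gives one at `w₀`. Neither `g` nor the determinant needs to be invertible.
  have hfd : fderiv ℝ (𝓛.energy c (z.jet.coord c) (z.momentum c)) w₀ = 0 := by
    have h1 := (𝓛.differentiableAt_energy hb' (z.momentum c') (g w₀)).1.hasFDerivAt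
    rw [hcrit] at h1
    have h2 := (h1.comp w₀ hdg.hasFDerivAt).mul_const ((Matrix.of ξ').det)
    rw [ContinuousLinearMap.zero_comp, smul_zero] at h2
    exact ((h2.add_const C).congr_of_eventuallyEq
      (Filter.EventuallyEq.of_eq (funext hC))).fderiv
  rw [fderiv_energy_eq_zero_iff 𝓛 hb] at hfd
  rw [hlow, solvedJet]
  congr 1
  rw [← h.solve_topDerivative hb w₀, hfd]
  rfl

/-- The value of the potential of the Poincaré–Cartan form does not depend on the chart. -/
theorem IsRegular.cartanPotential_hamiltonian_trans (h : 𝓛.IsRegular) (hz : z ∈ Phase.dom c)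
    (hz' : z ∈ Phase.dom c') (b : Fin (d + 1) → JetModel (d + 1) N r) :
    cartanPotential (z.momentum c') (𝓛.hamiltonian c' (z.coord c'))
      (fun i => (fderiv ℝ (c.jetTrans c' r) (z.jet.coord c) (b i)).1)
      (fun i => (fderiv ℝ (c.jetTrans c' r) (z.jet.coord c) (b i)).2) =
    cartanPotential (z.momentum c) (𝓛.hamiltonian c (z.coord c))
      (fun i => (b i).1) (fun i => (b i).2) := by
  -- A single jet is taken that satisfies the Legendre relation in `c'`, hence also in `c`. For this
  -- jet the potential with a fixed prolongation is the one with the Hamiltonian, in both charts.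
  obtain ⟨s, hs, hs'⟩ := Jet.exists_prolongation (q := z.jet) hz'
    (𝓛.solve c' (z.jet.coord c') (topMomentum (z.momentum c')))
  have h1 : (jetOf (r + 1) s).fibreCoord c' = 𝓛.solvedJet c' (z.coord c') :=
    (congrArg Prod.snd hs' :)
  have h2 := h.solvedJet_trans hz hz' hs h1
  have h3 := 𝓛.cartanPotential_trans hz hz' hs b
  have h4 : (jetOf (r + 1) s).coord c' = ((z.coord c').1, 𝓛.solvedJet c' (z.coord c')) := hs'
  have h5 : (jetOf (r + 1) s).coord c = ((z.coord c).1, 𝓛.solvedJet c (z.coord c)) := by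
    refine Prod.ext ?_ h2
    change c.base (jetOf r s).base = _
    rw [hs]
    rfl
  rw [h1, h2, h4, h5] at h3
  exact h3

end Lagrangian

end PoincareCartan

namespace PoincareCartan

/-! ### The Poincaré–Cartan form as an exterior derivative -/

/-- The exterior product of linear forms as a continuous alternating map. -/
def wedgeL {E : Type*} [NormedAddCommGroup E] [NormedSpace ℝ E] [FiniteDimensional ℝ E] {m : ℕ}
    (a : Fin m → (E →ₗ[ℝ] ℝ)) : E [⋀^Fin m]→L[ℝ] ℝ where
  __ := wedge a
  cont := by
    change Continuous fun v : Fin m → E => (Matrix.of fun i j => a j (v i)).det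
    refine Continuous.matrix_det (continuous_matrix fun i j => ?_)
    exact (a j).continuous_of_finiteDimensional.comp (continuous_apply i)

theorem wedgeL_apply {E : Type*} [NormedAddCommGroup E] [NormedSpace ℝ E] [FiniteDimensional ℝ E]
    {m : ℕ} (a : Fin m → (E →ₗ[ℝ] ℝ)) (v : Fin m → E) : wedgeL a v = wedge a v := rfl

theorem wedge_dx {n N r : ℕ} (v : Fin n → PhaseModel n N r) :
    wedge dx v = (Matrix.of fun i => (v i).1).det := rfl

theorem wedge_update_dx {n N r : ℕ} (μ : Fin n) (a : MultiIndex n r × Fin N)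
    (v : Fin n → PhaseModel n N r) :
    wedge (Function.update dx μ (dφ a)) v =
      ((Matrix.of fun i => (v i).1).updateCol μ fun i => (v i).2.1 a).det := by
  rw [wedge_apply]
  congr 1
  ext i j
  by_cases h : j = μ
  · subst h
    simp [dφ]
  · simp [dx, h]

variable {d N : ℕ}
  {M : Type*} [TopologicalSpace M] [ChartedSpace (EuclideanSpace ℝ (Fin (d + 1))) M]
  {Φ : Type*} [TopologicalSpace Φ] [ChartedSpace (EuclideanSpace ℝ (Fin (d + 1 + N))) Φ]
  {π : Φ → M} {r : ℕ} {c c' : AdaptedChart d N π}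

namespace Phase

variable {z : Phase d N π r}

/-- The transition map of `P` covers that of `J^rΦ`. This suffices for comparing potentials, since
they contain no `dp`. -/
theorem fderiv_phaseTrans_jet (hz : z ∈ dom c) (hz' : z ∈ dom c') (v : PhaseModel (d + 1) N r) :
    ((fderiv ℝ (c.phaseTrans c' r) (z.coord c) v).1,
      (fderiv ℝ (c.phaseTrans c' r) (z.coord c) v).2.1) =
    fderiv ℝ (c.jetTrans c' r) (z.jet.coord c) (v.1, v.2.1) := by
  let A : PhaseModel (d + 1) N r →L[ℝ] JetModel (d + 1) N r :=
    (ContinuousLinearMap.fst ℝ _ _).prod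
      ((ContinuousLinearMap.fst ℝ _ _).comp (ContinuousLinearMap.snd ℝ _ _))
  have h1 := (A.hasFDerivAt.comp (z.coord c) (hasFDerivAt_phaseTrans hz hz')).fderiv
  have h2 := (HasFDerivAt.comp (z.coord c) (g := c.jetTrans c' r)
    (Jet.hasFDerivAt_jetTrans (q := z.jet) hz hz') A.hasFDerivAt).fderiv
  have h3 : (A ∘ c.phaseTrans c' r) = c.jetTrans c' r ∘ A := rfl
  rw [h3, h2] at h1
  exact (congrArg (fun B => B v) h1).symm

end Phase

namespace Lagrangian

variable (𝓛 : Lagrangian d N π (r + 1))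

/-- The potential `∑ p^{αμ}_K dx^1 ∧ ⋯ ∧ dφ^K_α ∧ ⋯ ∧ dx^n - H dx^1 ∧ ⋯ ∧ dx^n` of the
Poincaré–Cartan form. -/
def potential (c : AdaptedChart d N π) (y : PhaseModel (d + 1) N r) :
    PhaseModel (d + 1) N r [⋀^Fin (d + 1)]→L[ℝ] ℝ :=
  ∑ a : (MultiIndex (d + 1) r × Fin N) × Fin (d + 1),
    y.2.2 a • wedgeL (Function.update dx a.2 (dφ a.1)) - 𝓛.hamiltonian c y • wedgeL dx

theorem potential_apply (c : AdaptedChart d N π) (y : PhaseModel (d + 1) N r)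
    (v : Fin (d + 1) → PhaseModel (d + 1) N r) :
    𝓛.potential c y v = cartanPotential y.2.2 (𝓛.hamiltonian c y) (fun i => (v i).1)
      (fun i => (v i).2.1) := by
  simp only [potential, cartanPotential]
  rw [ContinuousAlternatingMap.sub_apply, ContinuousAlternatingMap.sum_apply,
    Fintype.sum_prod_type]
  simp only [ContinuousAlternatingMap.smul_apply, wedgeL_apply, wedge_update_dx, wedge_dx,
    smul_eq_mul]

variable {𝓛}

theorem IsRegular.hasFDerivAt_potential (h : 𝓛.IsRegular) {y : PhaseModel (d + 1) N r}
    (hy : y ∈ c.phaseTarget r) :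
    HasFDerivAt (𝓛.potential c)
      (∑ a : (MultiIndex (d + 1) r × Fin N) × Fin (d + 1),
        ((dp a.1 a.2).toContinuousLinearMap).smulRight
          (wedgeL (Function.update dx a.2 (dφ a.1))) -
        (fderiv ℝ (𝓛.hamiltonian c) y).smulRight (wedgeL dx)) y := by
  have hH : HasFDerivAt (𝓛.hamiltonian c) (fderiv ℝ (𝓛.hamiltonian c) y) y :=
    (((h.contDiffOn_hamiltonian c).contDiffAt
      ((c.isOpen_phaseTarget r).mem_nhds hy)).differentiableAt (by simp)).hasFDerivAt
  have key (w : PhaseModel (d + 1) N r [⋀^Fin (d + 1)]→L[ℝ] ℝ) {f : PhaseModel (d + 1) N r → ℝ}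
      {f' : PhaseModel (d + 1) N r →L[ℝ] ℝ} (hf : HasFDerivAt f f' y) :
      HasFDerivAt (fun y => f y • w) (f'.smulRight w) y :=
    (((ContinuousLinearMap.id ℝ ℝ).smulRight w).hasFDerivAt).comp y hf
  refine (HasFDerivAt.fun_sum fun a _ => ?_).sub (key _ hH)
  exact key _ (dp a.1 a.2).toContinuousLinearMap.hasFDerivAt

/-- The coefficients of the potential are `p` and `H` and its wedge factors are constant, so
alternating its derivative is the Laplace expansion of `dp ∧ ⋯` and `dH ∧ ⋯` along the first factor.
-/
theorem IsRegular.extDeriv_potential (h : 𝓛.IsRegular) {y : PhaseModel (d + 1) N r}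
    (hy : y ∈ c.phaseTarget r) (v : Fin (d + 1 + 1) → PhaseModel (d + 1) N r) :
    extDeriv (𝓛.potential c) y v = 𝓛.cartanForm c y v := by
  rw [extDeriv, (h.hasFDerivAt_potential hy).fderiv,
    ContinuousAlternatingMap.alternatizeUncurryFin_apply]
  have h1 : 𝓛.cartanForm c y v = ∑ a : (MultiIndex (d + 1) r × Fin N) × Fin (d + 1),
      wedge (Fin.cons (dp a.1 a.2) (Function.update dx a.2 (dφ a.1))) v -
        wedge (Fin.cons (fderiv ℝ (𝓛.hamiltonian c) y).toLinearMap dx) v := by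
    simp only [cartanForm, AlternatingMap.sub_apply, alternating_sum_apply, Fintype.sum_prod_type]
  rw [h1]
  simp only [wedge_cons]
  rw [Finset.sum_comm, ← Finset.sum_sub_distrib]
  refine Finset.sum_congr rfl fun i _ => ?_
  rw [← Finset.mul_sum, ← mul_sub, sub_apply, sum_apply,
    ContinuousAlternatingMap.sub_apply, ContinuousAlternatingMap.sum_apply]
  simp only [zsmul_eq_mul, Int.cast_pow, Int.cast_neg, Int.cast_one]
  rfl

/-- The coordinate expression of the Poincaré–Cartan form does not depend on the chart. -/
theorem IsRegular.cartanForm_trans (h : 𝓛.IsRegular) {z : Phase d N π r} (hz : z ∈ Phase.dom c)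
    (hz' : z ∈ Phase.dom c') :
    (𝓛.cartanForm c' (z.coord c')).compLinearMap (z.dcoord c') =
      (𝓛.cartanForm c (z.coord c)).compLinearMap (z.dcoord c) := by
  -- The potentials are pull-backs of one another on a neighbourhood, as is required for taking
  -- exterior derivatives.
  have hev : 𝓛.potential c =ᶠ[𝓝 (z.coord c)] fun y =>
      (𝓛.potential c' (c.phaseTrans c' r y)).compContinuousLinearMap
        (fderiv ℝ (c.phaseTrans c' r) y) := by
    filter_upwards [(c.isOpen_phaseOverlap c' r).mem_nhds (Phase.coord_mem_overlap hz hz')]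
      with y hy
    obtain ⟨x, hx, rfl⟩ := Phase.exists_coord (c := c) (show y ∈ c.phaseTarget r from hy.1)
    have hx' : x ∈ Phase.dom c' := Phase.mem_dom_of_overlap hx hy
    ext v
    rw [ContinuousAlternatingMap.compContinuousLinearMap_apply, potential_apply, potential_apply,
      ← Phase.coord_trans hx hx']
    have h1 := h.cartanPotential_hamiltonian_trans hx hx' (fun i => ((v i).1, (v i).2.1))
    simp only [← Phase.fderiv_phaseTrans_jet hx hx'] at h1
    exact h1.symm
  have hd : DifferentiableAt ℝ (𝓛.potential c') (c.phaseTrans c' r (z.coord c)) := by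
    rw [← Phase.coord_trans hz hz']
    exact (h.hasFDerivAt_potential (Phase.coord_mem hz')).differentiableAt
  have h1 := extDeriv_pullback hd (Phase.contDiffAt_phaseTrans hz hz')
    (by simpa using ENat.LEInfty.out)
  rw [← hev.extDeriv_eq] at h1
  ext v
  rw [AlternatingMap.compLinearMap_apply, AlternatingMap.compLinearMap_apply,
    ← h.extDeriv_potential (Phase.coord_mem hz), h1, Phase.coord_trans hz hz',
    ← h.extDeriv_potential (by rw [← Phase.coord_trans hz hz']; exact Phase.coord_mem hz'),
    ContinuousAlternatingMap.compContinuousLinearMap_apply]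
  congr 1
  funext i
  exact Phase.dcoord_trans hz hz' (v i)

theorem IsRegular.contDiffOn_cartanForm (h : 𝓛.IsRegular) (c : AdaptedChart d N π)
    (v : Fin (d + 1 + 1) → PhaseModel (d + 1) N r) :
    ContDiffOn ℝ ∞ (fun y => 𝓛.cartanForm c y v) (c.phaseTarget r) := by
  simp only [cartanForm, AlternatingMap.sub_apply]
  have h1 : ContDiffOn ℝ ∞ (fderiv ℝ (𝓛.hamiltonian c)) (c.phaseTarget r) :=
    (h.contDiffOn_hamiltonian c).fderiv_of_isOpen (c.isOpen_phaseTarget r) (by simp)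
  refine ContDiffOn.sub contDiffOn_const ?_
  simp only [wedge_cons]
  exact ContDiffOn.sum fun i _ => contDiffOn_const.mul
    ((h1.clm_apply contDiffOn_const).mul contDiffOn_const)

/-- There is exactly one form on the phase bundle with the coordinate expressions of the
Poincaré–Cartan form. -/
theorem IsRegular.existsUnique_cartanForm (h : 𝓛.IsRegular) (hπ : IsFibredManifold d N π) :
    ∃! Ω : PhaseForm d N π r (d + 1 + 1), 𝓛.IsCartanForm Ω := by
  -- The form is defined at each point through some chart around it; `cartanForm_trans` makes the
  -- choice irrelevant.
  choose chart hchart using fun z : Phase d N π r => hπ.exists_chart z.jet.val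
  have hform (c : AdaptedChart d N π) (z : Phase d N π r) (hz : z ∈ Phase.dom c) :
      (𝓛.cartanForm (chart z) (z.coord (chart z))).compLinearMap (z.dcoord (chart z)) =
        (𝓛.cartanForm c (z.coord c)).compLinearMap (z.dcoord c) :=
    h.cartanForm_trans hz (hchart z)
  refine ⟨⟨fun z => (𝓛.cartanForm (chart z) (z.coord (chart z))).compLinearMap
    (z.dcoord (chart z)), fun c => ⟨𝓛.cartanForm c, fun v => ?_, hform c⟩⟩, hform, ?_⟩
  · rw [Phase.image_coord]
    exact h.contDiffOn_cartanForm c v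
  · rintro ⟨Ω, hΩ⟩ hc
    congr 1
    funext z
    exact hc (chart z) z (hchart z)

end Lagrangian

end PoincareCartan

namespace PoincareCartan

/-! ### The Poincaré–Cartan form on the graph of a section -/

section Algebra

variable {n N r : ℕ}

/-- In the expansion `b` takes either `v` or some `F j`. In the latter case moving `v` into the slot
`j` costs `(-1)^j`, which against the sign `(-1)^(j+1)` leaves `-1`. -/
theorem wedge_cons_cons {E : Type*} [AddCommGroup E] [Module ℝ E] {m : ℕ} (b : E →ₗ[ℝ] ℝ)
    (a : Fin (m + 1) → (E →ₗ[ℝ] ℝ)) (v : E) (F : Fin (m + 1) → E) :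
    wedge (Fin.cons b a) (Fin.cons v F) =
      b v * wedge a F - ∑ j, b (F j) * wedge a (Function.update F j v) := by
  rw [wedge_cons, Fin.sum_univ_succ, sub_eq_add_neg, ← Finset.sum_neg_distrib]
  congr 1
  · simp
  · refine Finset.sum_congr rfl fun j _ => ?_
    have h1 : (Fin.succ j).removeNth (Fin.cons v F : Fin (m + 2) → E) =
        Matrix.vecCons v (j.removeNth F) := by
      funext i
      refine Fin.cases ?_ (fun i => ?_) i
      · simp [Fin.removeNth]
      · simp [Fin.removeNth]
    have h2 := (wedge a).neg_one_pow_smul_map_insertNth j v (j.removeNth F)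
    rw [Fin.insertNth_removeNth] at h2
    rw [h1, ← h2, Fin.cons_succ, Fin.val_succ, pow_succ, zsmul_eq_mul]
    push_cast
    have h3 : ((-1 : ℝ) ^ (j : ℕ)) * (-1) ^ (j : ℕ) = 1 := by
      rw [← pow_add, Even.neg_one_pow ⟨_, rfl⟩]
    linear_combination (-(b (F j) * wedge a (Function.update F j v))) * h3

variable {F : Fin (n + 1) → PhaseModel (n + 1) N r} {v : PhaseModel (n + 1) N r}

theorem wedge_dx_graph (hF : ∀ μ, (F μ).1 = Pi.single μ 1) : wedge dx F = 1 := by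
  rw [wedge_dx]
  have : (Matrix.of fun i => (F i).1) = (1 : Matrix (Fin (n + 1)) (Fin (n + 1)) ℝ) := by
    ext i j
    simp [hF, Matrix.one_apply, Pi.single_apply, eq_comm]
  rw [this, Matrix.det_one]

theorem wedge_dx_update (hv : v.1 = 0) (j : Fin (n + 1)) :
    wedge dx (Function.update F j v) = 0 := by
  rw [wedge_dx]
  exact Matrix.det_eq_zero_of_row_eq_zero j fun k => by simp [hv]

theorem det_one_updateCol (μ : Fin (n + 1)) (s : Fin (n + 1) → ℝ) :
    ((1 : Matrix (Fin (n + 1)) (Fin (n + 1)) ℝ).updateCol μ s).det = s μ := by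
  rw [← Matrix.cramer_apply, Matrix.cramer_one]
  rfl

theorem wedge_update_dx_graph (hF : ∀ μ, (F μ).1 = Pi.single μ 1) (μ : Fin (n + 1))
    (a : MultiIndex (n + 1) r × Fin N) :
    wedge (Function.update dx μ (dφ a)) F = (F μ).2.1 a := by
  rw [wedge_update_dx]
  have : (Matrix.of fun i => (F i).1) = (1 : Matrix (Fin (n + 1)) (Fin (n + 1)) ℝ) := by
    ext i j
    simp [hF, Matrix.one_apply, Pi.single_apply, eq_comm]
  rw [this, det_one_updateCol]

theorem wedge_update_dx_update (hF : ∀ μ, (F μ).1 = Pi.single μ 1) (hv : v.1 = 0)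
    (μ j : Fin (n + 1)) (a : MultiIndex (n + 1) r × Fin N) :
    wedge (Function.update dx μ (dφ a)) (Function.update F j v) =
      if j = μ then v.2.1 a else 0 := by
  rw [wedge_update_dx]
  split_ifs with h
  · subst h
    have : ((Matrix.of fun i => (Function.update F j v i).1).updateCol j
        fun i => (Function.update F j v i).2.1 a) =
        (1 : Matrix (Fin (n + 1)) (Fin (n + 1)) ℝ).updateCol j
        fun i => (Function.update F j v i).2.1 a := by
      ext i k
      by_cases hk : k = j
      · subst hk; simp
      · by_cases hi : i = j
        · subst hi; simp [hk, hv, Ne.symm hk]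
        · simp [hk, hi, hF, Matrix.one_apply, Pi.single_apply, eq_comm]
    rw [this, det_one_updateCol]
    simp
  · refine Matrix.det_eq_zero_of_column_eq_zero j fun i => ?_
    by_cases hi : i = j
    · subst hi; simp [h, hv]
    · simp [h, hi, hF, Ne.symm hi]

theorem phaseModel_eq_sum (v : PhaseModel (n + 1) N r) (hv : v.1 = 0) :
    v = ∑ a, v.2.1 a • ((0, Pi.single a 1, 0) : PhaseModel (n + 1) N r) +
      ∑ b, v.2.2 b • ((0, 0, Pi.single b 1) : PhaseModel (n + 1) N r) := by
  obtain ⟨v₀, V, W⟩ := v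
  subst hv
  have h1 : ∀ {ι : Type} [Fintype ι] [DecidableEq ι] (V : ι → ℝ),
      ∑ a, V a • (Pi.single a 1 : ι → ℝ) = V := fun V => by
    simpa using (pi_eq_sum_univ' V).symm
  refine Prod.ext ?_ (Prod.ext ?_ ?_)
  · simp [Prod.fst_sum]
  · simp only [Prod.snd_add, Prod.fst_add, Prod.snd_sum, Prod.fst_sum, Prod.smul_snd,
      Prod.smul_fst, smul_zero, Finset.sum_const_zero, add_zero]
    exact (h1 V).symm
  · simp only [Prod.snd_add, Prod.snd_sum, Prod.smul_snd,
      smul_zero, Finset.sum_const_zero, zero_add]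
    exact (h1 W).symm

end Algebra

variable {d N : ℕ}
  {M : Type*} [TopologicalSpace M] [ChartedSpace (EuclideanSpace ℝ (Fin (d + 1))) M]
  {Φ : Type*} [TopologicalSpace Φ] [ChartedSpace (EuclideanSpace ℝ (Fin (d + 1 + N))) Φ]
  {π : Φ → M} {r : ℕ} {c c' : AdaptedChart d N π}

namespace Lagrangian

variable (𝓛 : Lagrangian d N π (r + 1)) {F : Fin (d + 1) → PhaseModel (d + 1) N r}

/-- The base components of the `F μ` form the identity matrix and `v` has none, so each determinant
collapses to a single entry. The tuple `F` stands for the partial derivatives of a section. -/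
theorem cartanForm_cons (c : AdaptedChart d N π) (y v : PhaseModel (d + 1) N r)
    (hF : ∀ μ, (F μ).1 = Pi.single μ 1) (hv : v.1 = 0) :
    𝓛.cartanForm c y (Fin.cons v F) =
      ∑ a, (∑ μ, v.2.2 (a, μ) * (F μ).2.1 a - (∑ μ, (F μ).2.2 (a, μ)) * v.2.1 a) -
        fderiv ℝ (𝓛.hamiltonian c) y v := by
  simp only [cartanForm, AlternatingMap.sub_apply, alternating_sum_apply, wedge_cons_cons,
    wedge_dx_graph hF, wedge_dx_update hv, wedge_update_dx_graph hF,
    wedge_update_dx_update hF hv, Fintype.sum_prod_type, Finset.sum_sub_distrib, mul_zero,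
    Finset.sum_const_zero, mul_ite, Finset.sum_ite_eq', Finset.mem_univ, if_true, sub_zero, mul_one,
    Finset.sum_mul]
  rfl

/-- The contractions of the Poincaré–Cartan form that vanish on a graph. -/
theorem cartanForm_cons_eq_zero_iff (c : AdaptedChart d N π) (y : PhaseModel (d + 1) N r)
    (hF : ∀ μ, (F μ).1 = Pi.single μ 1) :
    (∀ v, 𝓛.cartanForm c y (Fin.cons v F) = 0) ↔
      (∀ a μ, (F μ).2.1 a = fderiv ℝ (𝓛.hamiltonian c) y (0, 0, Pi.single (a, μ) 1)) ∧
      ∀ a, ∑ μ, (F μ).2.2 (a, μ) = - fderiv ℝ (𝓛.hamiltonian c) y (0, Pi.single a 1, 0) := by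
  constructor
  · intro h
    refine ⟨fun a μ => ?_, fun a => ?_⟩
    · have h1 := h (0, 0, Pi.single (a, μ) 1)
      rw [𝓛.cartanForm_cons c y _ hF rfl] at h1
      simp only [Pi.zero_apply, mul_zero, sub_zero] at h1
      rw [← Fintype.sum_prod_type' (f := fun a' μ' =>
        (Pi.single (a, μ) (1 : ℝ) : _ → ℝ) (a', μ') * (F μ').2.1 a')] at h1
      simp only [Prod.mk.eta, Pi.single_apply, ite_mul, one_mul, zero_mul, Finset.sum_ite_eq',
        Finset.mem_univ, if_true] at h1
      exact sub_eq_zero.1 h1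
    · have h1 := h (0, Pi.single a 1, 0)
      rw [𝓛.cartanForm_cons c y _ hF rfl] at h1
      simp only [Pi.zero_apply, zero_mul, Finset.sum_const_zero, zero_sub,
        Finset.sum_neg_distrib, Pi.single_apply, mul_ite, mul_one, mul_zero, Finset.sum_ite_eq',
        Finset.mem_univ, if_true] at h1
      linarith
  · rintro ⟨h1, h2⟩ v
    have hvert (v : PhaseModel (d + 1) N r) (hv : v.1 = 0) :
        𝓛.cartanForm c y (Fin.cons v F) = 0 := by
      have h3 : fderiv ℝ (𝓛.hamiltonian c) y v =
          ∑ a, v.2.1 a * fderiv ℝ (𝓛.hamiltonian c) y (0, Pi.single a 1, 0) +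
            ∑ b, v.2.2 b * fderiv ℝ (𝓛.hamiltonian c) y (0, 0, Pi.single b 1) := by
        conv_lhs => rw [phaseModel_eq_sum v hv]
        simp only [map_add, map_sum, map_smul, smul_eq_mul]
      rw [𝓛.cartanForm_cons c y v hF hv, h3,
        Fintype.sum_prod_type (f := fun b => v.2.2 b *
          fderiv ℝ (𝓛.hamiltonian c) y (0, 0, Pi.single b 1)), Finset.sum_sub_distrib]
      simp only [h1, h2, neg_mul, Finset.sum_neg_distrib, sub_neg_eq_add]
      simp only [mul_comm (v.2.1 _)]
      ring
    -- A vector already among the `F μ` contributes nothing, by alternation; this reduces arbitrary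
    -- `v` to vertical ones.
    have hgraph (μ : Fin (d + 1)) : 𝓛.cartanForm c y (Fin.cons (F μ) F) = 0 :=
      (𝓛.cartanForm c y).map_eq_zero_of_eq _ (i := 0) (j := μ.succ) (by simp)
        (Fin.succ_ne_zero μ).symm
    have hlin (u w : PhaseModel (d + 1) N r) (t : Fin (d + 1) → ℝ)
        (h : u = w + ∑ μ, t μ • F μ) : (𝓛.cartanForm c y).curryLeft u F =
        (𝓛.cartanForm c y).curryLeft w F + ∑ μ, t μ * (𝓛.cartanForm c y).curryLeft (F μ) F := by
      rw [h, map_add, map_sum, AlternatingMap.add_apply, alternating_sum_apply]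
      simp only [map_smul, AlternatingMap.smul_apply, smul_eq_mul]
    -- Subtracting the combination of the `F μ` with the base components of `v` leaves a vertical
    -- vector.
    have h4 := hlin v (v - ∑ μ, v.1 μ • F μ) v.1 (by simp)
    change 𝓛.cartanForm c y (Fin.cons _ F) = 𝓛.cartanForm c y (Fin.cons _ F) +
      ∑ μ, v.1 μ * 𝓛.cartanForm c y (Fin.cons (F μ) F) at h4
    rw [h4, hvert]
    · simp [hgraph]
    · rw [Prod.fst_sub, Prod.fst_sum]
      simp only [Prod.smul_fst, hF]
      rw [sub_eq_zero]
      simpa using pi_eq_sum_univ' v.1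

end Lagrangian

end PoincareCartan

namespace PoincareCartan

variable {d N : ℕ}
  {M : Type*} [TopologicalSpace M] [ChartedSpace (EuclideanSpace ℝ (Fin (d + 1))) M]
  {Φ : Type*} [TopologicalSpace Φ] [ChartedSpace (EuclideanSpace ℝ (Fin (d + 1 + N))) Φ]
  {π : Φ → M} {r : ℕ} {U : TopologicalSpace.Opens M}

/-! ### Sections of the phase bundle in coordinates -/

namespace PhaseSection

variable (σ : PhaseSection d N π r U) (c : AdaptedChart d N π) {x : M}

/-- The points of `U` that a section maps to the domain of a chart. -/
def chartSource : Set M := {x | x ∈ U ∧ σ.toFun x ∈ Phase.dom c}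

theorem isOpen_chartSource : IsOpen (σ.chartSource c) :=
  isOpen_iff_eventually.2 fun _ hx => σ.eventually_mem_dom hx.1 c hx.2

/-- The coordinates of the points of `U` that a section maps to the domain of a chart. -/
def chartDomain : Set (Fin (d + 1) → ℝ) := c.base.target ∩ c.base.symm ⁻¹' σ.chartSource c

theorem isOpen_chartDomain : IsOpen (σ.chartDomain c) :=
  c.base.symm.isOpen_inter_preimage (σ.isOpen_chartSource c)

variable {σ c}

theorem mem_base_source (hx : x ∈ σ.chartSource c) : x ∈ c.base.source := by
  have := Jet.base_mem (q := (σ.toFun x).jet) hx.2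
  rwa [σ.base_eq x hx.1] at this

theorem mem_chartDomain (hx : x ∈ σ.chartSource c) : c.base x ∈ σ.chartDomain c := by
  refine ⟨c.base.map_source (mem_base_source hx), ?_⟩
  rwa [Set.mem_preimage, c.base.left_inv (mem_base_source hx)]

theorem localRep_base (hx : x ∈ σ.chartSource c) :
    σ.localRep c (c.base x) = (σ.toFun x).coord c := by
  rw [localRep, c.base.left_inv (mem_base_source hx)]

theorem localRep_fst {y : Fin (d + 1) → ℝ} (hy : y ∈ σ.chartDomain c) : (σ.localRep c y).1 = y := by
  change c.base (σ.toFun (c.base.symm y)).jet.base = y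
  rw [σ.base_eq _ hy.2.1, c.base.right_inv hy.1]

theorem localRep_mem {y : Fin (d + 1) → ℝ} (hy : y ∈ σ.chartDomain c) :
    σ.localRep c y ∈ c.phaseTarget r := Phase.coord_mem hy.2.2

theorem contDiffOn_localRep : ContDiffOn ℝ ∞ (σ.localRep c) (σ.chartDomain c) := by
  rw [← contMDiffOn_iff_contDiffOn]
  exact (σ.smooth_coord c).comp (c.smooth_base_symm.mono Set.inter_subset_left) fun y hy => hy.2

theorem differentiableAt_localRep {y : Fin (d + 1) → ℝ} (hy : y ∈ σ.chartDomain c) :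
    DifferentiableAt ℝ (σ.localRep c) y :=
  (contDiffOn_localRep.contDiffAt ((σ.isOpen_chartDomain c).mem_nhds hy)).differentiableAt (by simp)

theorem partialDeriv_localRep_fst {y : Fin (d + 1) → ℝ} (hy : y ∈ σ.chartDomain c)
    (μ : Fin (d + 1)) : (partialDeriv μ (σ.localRep c) y).1 = Pi.single μ 1 := by
  have h1 := ((differentiableAt_localRep hy).hasFDerivAt.fst).fderiv
  have h2 : (fun y => (σ.localRep c y).1) =ᶠ[𝓝 y] id :=
    Filter.eventually_of_mem ((σ.isOpen_chartDomain c).mem_nhds hy) fun y hy => localRep_fst hy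
  rw [h2.fderiv_eq, fderiv_id] at h1
  exact (congrArg (fun A => A (Pi.single μ 1)) h1).symm

theorem partialDeriv_localRep_snd {y : Fin (d + 1) → ℝ} (hy : y ∈ σ.chartDomain c)
    (μ : Fin (d + 1)) (a : MultiIndex (d + 1) r × Fin N) :
    partialDeriv μ (fun y => (σ.localRep c y).2.1 a) y =
      (partialDeriv μ (σ.localRep c) y).2.1 a := by
  have h1 := (hasFDerivAt_pi'.1 (differentiableAt_localRep hy).hasFDerivAt.snd.fst a).fderiv
  rw [partialDeriv, h1]
  rfl

theorem partialDeriv_localRep_momentum {y : Fin (d + 1) → ℝ} (hy : y ∈ σ.chartDomain c)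
    (μ : Fin (d + 1)) (a : (MultiIndex (d + 1) r × Fin N) × Fin (d + 1)) :
    partialDeriv μ (fun y => (σ.localRep c y).2.2 a) y =
      (partialDeriv μ (σ.localRep c) y).2.2 a := by
  have h1 := (hasFDerivAt_pi'.1 (differentiableAt_localRep hy).hasFDerivAt.snd.snd a).fderiv
  rw [partialDeriv, h1]
  rfl

theorem dcoord_diff (hx : x ∈ σ.chartSource c) (w : TangentSpace (𝓡 (d + 1)) x) :
    (σ.toFun x).dcoord c (σ.diff hx.1 w) = σ.coordDeriv x c w := if_pos hx.2

theorem coordDeriv_coordVec (hx : x ∈ σ.chartSource c) (μ : Fin (d + 1)) :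
    σ.coordDeriv x c (c.coordVec x μ) = partialDeriv μ (σ.localRep c) (c.base x) := by
  have hb := mem_base_source hx
  have hmd : MDifferentiableAt (𝓡 (d + 1)) 𝓘(ℝ, PhaseModel (d + 1) N r)
      (fun y => (σ.toFun y).coord c) x :=
    ((σ.smooth_coord c).contMDiffAt ((σ.isOpen_chartSource c).mem_nhds hx)).mdifferentiableAt
      (by simp)
  have hxx : c.base.symm (c.base x) = x := c.base.left_inv hb
  have h1 := mfderiv_comp_of_eq (x := c.base x) hmd
    (AdaptedChart.mdifferentiableAt_base_symm hb) hxx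
  rw [mfderiv_eq_fderiv] at h1
  have h2 := congrArg (fun A => A (Pi.single μ 1)) h1
  refine Eq.trans ?_ h2.symm
  change mfderiv (𝓡 (d + 1)) 𝓘(ℝ, PhaseModel (d + 1) N r) (fun y => (σ.toFun y).coord c) x _ =
    mfderiv (𝓡 (d + 1)) 𝓘(ℝ, PhaseModel (d + 1) N r) (fun y => (σ.toFun y).coord c)
      (c.base.symm (c.base x)) _
  rw [mfderiv_congr_point hxx]
  rfl

/-- The pull-back is a form of top degree on the base, so it vanishes as soon as it vanishes on the
coordinate vectors, which the section maps to its partial derivatives. -/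
theorem pullbackContraction_eq_zero_iff {𝓛 : Lagrangian d N π (r + 1)}
    {Ω : PhaseForm d N π r (d + 1 + 1)} (hΩ : 𝓛.IsCartanForm Ω) (hx : x ∈ σ.chartSource c)
    (X : PhaseVectorField d N π r) :
    σ.pullbackContraction X Ω hx.1 = 0 ↔
      𝓛.cartanForm c (σ.localRep c (c.base x))
        (Fin.cons ((σ.toFun x).dcoord c (X.toFun (σ.toFun x)))
          fun μ => partialDeriv μ (σ.localRep c) (c.base x)) = 0 := by
  have h1 : σ.pullbackContraction X Ω hx.1 (c.coordVec x) =
      𝓛.cartanForm c (σ.localRep c (c.base x))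
        (Fin.cons ((σ.toFun x).dcoord c (X.toFun (σ.toFun x)))
          fun μ => partialDeriv μ (σ.localRep c) (c.base x)) := by
    change Ω.toFun (σ.toFun x) (Matrix.vecCons (X.toFun (σ.toFun x))
      fun μ => σ.diff hx.1 (c.coordVec x μ)) = _
    rw [hΩ c _ hx.2, AlternatingMap.compLinearMap_apply, localRep_base hx]
    congr 1
    funext i
    refine Fin.cases rfl (fun μ => ?_) i
    change (σ.toFun x).dcoord c (σ.diff hx.1 (c.coordVec x μ)) = _
    rw [dcoord_diff hx, coordDeriv_coordVec hx]
    rfl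
  rw [← h1]
  constructor
  · intro h
    rw [h]
    rfl
  · intro h
    ext u
    rw [AdaptedChart.top_form_eq (mem_base_source hx), h, zero_mul]
    rfl

end PhaseSection

/-! ### Vector fields on the phase bundle with a given value -/

section VectorField

variable [T2Space Φ] [IsManifold (𝓡 (d + 1 + N)) ∞ Φ]

/-- The field has constant components `v` in the chart `c`, cut off by a bump function on `Φ`. The
domain of `c` on `P` is the preimage of its domain in `Φ`, so no cut-off in the higher jet or
momentum directions is needed. -/
theorem exists_vectorField {c : AdaptedChart d N π} {z : Phase d N π r} (hz : z ∈ Phase.dom c)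
    (v : PhaseModel (d + 1) N r) :
    ∃ X : PhaseVectorField d N π r, z.dcoord c (X.toFun z) = v := by
  classical
  obtain ⟨ψ, -, hψ⟩ := (SmoothBumpFunction.nhds_basis_tsupport (I := 𝓡 (d + 1 + N))
    z.jet.val).mem_iff.1 (c.total.open_source.mem_nhds hz)
  choose e he using fun w : Phase.dom (r := r) c => Phase.exists_tangent w.2 v
  let X : ∀ w : Phase d N π r, w.tangent := fun w =>
    if h : w ∈ Phase.dom c then ψ w.jet.val • e ⟨w, h⟩ else 0
  have hX (w : Phase d N π r) (hw : w ∈ Phase.dom c) : w.dcoord c (X w) = ψ w.jet.val • v := by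
    simp only [X, dif_pos hw, map_smul]
    exact congrArg _ (he ⟨w, hw⟩)
  have hX' (w : Phase d N π r) (hw : w ∉ Phase.dom c) : X w = 0 := dif_neg hw
  refine ⟨⟨X, fun c' => ?_⟩, ?_⟩
  · have hf (w : Phase d N π r) (hw' : w ∈ Phase.dom c') (hw : w ∈ Phase.dom c) :
        w.dcoord c' (X w) = ψ (c'.total.symm ((w.coord c').1, (w.coord c').2.1.zeroPart)) •
          fderiv ℝ (c.phaseTrans c' r) (c'.phaseTrans c r (w.coord c')) v := by
      rw [Phase.dcoord_trans hw hw', hX w hw, map_smul, ← Phase.coord_trans hw' hw]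
      congr 2
      exact (Jet.symm_coord (q := w.jet) hw').symm
    let f : PhaseModel (d + 1) N r → PhaseModel (d + 1) N r := fun y =>
      if y ∈ c'.phaseOverlap c r then ψ (c'.total.symm (y.1, y.2.1.zeroPart)) •
          fderiv ℝ (c.phaseTrans c' r) (c'.phaseTrans c r y) v else 0
    refine ⟨f, ?_, fun w hw' => ?_⟩
    · rw [Phase.image_coord]
      have hsymm : ContMDiffOn 𝓘(ℝ, PhaseModel (d + 1) N r) (𝓡 (d + 1 + N)) ∞
          (fun y : PhaseModel (d + 1) N r => c'.total.symm (y.1, y.2.1.zeroPart))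
          (c'.phaseTarget r) := by
        refine c'.smooth_total_symm.comp (t := c'.total.target) ?_ fun y hy => hy
        refine ContDiff.contMDiff ?_ |>.contMDiffOn
        exact contDiff_fst.prodMk (contDiff_zeroPart.comp (contDiff_fst.comp contDiff_snd))
      intro y hy
      refine ContDiffAt.contDiffWithinAt ?_
      -- Over the closed support of `ψ` the point lies in the overlap with `c`, where the explicit
      -- formula is smooth; off it `ψ`, and with it the field, vanishes on a neighbourhood.
      by_cases hy' : c'.total.symm (y.1, y.2.1.zeroPart) ∈ tsupport ψ
      · have hyo : y ∈ c'.phaseOverlap c r := ⟨hy, hψ hy'⟩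
        have hev : f =ᶠ[𝓝 y] fun y => ψ (c'.total.symm (y.1, y.2.1.zeroPart)) •
            fderiv ℝ (c.phaseTrans c' r) (c'.phaseTrans c r y) v :=
          Filter.eventually_of_mem ((c'.isOpen_phaseOverlap c r).mem_nhds hyo)
            fun y hy => if_pos hy
        refine ContDiffAt.congr_of_eventuallyEq ?_ hev
        have hψy : ContDiffAt ℝ ∞ (fun y : PhaseModel (d + 1) N r =>
            ψ (c'.total.symm (y.1, y.2.1.zeroPart))) y := by
          rw [← contMDiffAt_iff_contDiffAt]
          exact ψ.contMDiff.contMDiffAt.comp y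
            (hsymm.contMDiffAt ((c'.isOpen_phaseTarget r).mem_nhds hy))
        refine hψy.smul (ContDiffAt.clm_apply ?_ contDiffAt_const)
        obtain ⟨w, hw', rfl⟩ := Phase.exists_coord hy
        have hw : w ∈ Phase.dom c := Phase.mem_dom_of_overlap hw' hyo
        refine ContDiffAt.comp (g := fderiv ℝ (c.phaseTrans c' r)) _ ?_
          (Phase.contDiffAt_phaseTrans hw' hw)
        rw [← Phase.coord_trans hw' hw]
        exact (((c.contDiffOn_phaseTrans c' r).fderiv_of_isOpen (m := ∞)
          (c.isOpen_phaseOverlap c' r) (by simp)).contDiffAt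
          ((c.isOpen_phaseOverlap c' r).mem_nhds (Phase.coord_mem_overlap hw hw')))
      · have hev : f =ᶠ[𝓝 y] fun _ => 0 := by
          have h1 := (hsymm.contMDiffAt ((c'.isOpen_phaseTarget r).mem_nhds hy)).continuousAt
          filter_upwards [h1.eventually_mem ((isClosed_tsupport ψ).isOpen_compl.mem_nhds hy')]
            with y' hy'
          simp only [f, image_eq_zero_of_notMem_tsupport hy', zero_smul, ite_self]
        exact contDiffAt_const.congr_of_eventuallyEq hev
    · by_cases hw : w ∈ Phase.dom c
      · rw [hf w hw' hw]
        exact (if_pos (Phase.coord_mem_overlap hw' hw)).symm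
      · rw [hX' w hw, map_zero]
        exact (if_neg fun h => hw (Phase.mem_dom_of_overlap hw' h)).symm
  · rw [hX z hz, ψ.eq_one, one_smul]

end VectorField

/-! ### The multi-symplectic equation in coordinates. -/

namespace PhaseSection

variable [T2Space Φ] [IsManifold (𝓡 (d + 1 + N)) ∞ Φ] {𝓛 : Lagrangian d N π (r + 1)}

/-- The multi-symplectic equation in coordinates. -/
theorem isMultisymplectic_iff (hπ : IsFibredManifold d N π) (σ : PhaseSection d N π r U)
    {Ω : PhaseForm d N π r (d + 1 + 1)} (hΩ : 𝓛.IsCartanForm Ω) :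
    σ.IsMultisymplectic Ω ↔ ∀ c : AdaptedChart d N π, ∀ y ∈ σ.chartDomain c,
      (∀ a μ, partialDeriv μ (fun y => (σ.localRep c y).2.1 a) y =
        fderiv ℝ (𝓛.hamiltonian c) (σ.localRep c y) (0, 0, Pi.single (a, μ) 1)) ∧
      ∀ a, ∑ μ, partialDeriv μ (fun y => (σ.localRep c y).2.2 (a, μ)) y =
        - fderiv ℝ (𝓛.hamiltonian c) (σ.localRep c y) (0, Pi.single a 1, 0) := by
  have key (c : AdaptedChart d N π) {y : Fin (d + 1) → ℝ} (hy : y ∈ σ.chartDomain c) :=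
    𝓛.cartanForm_cons_eq_zero_iff c (σ.localRep c y) (partialDeriv_localRep_fst hy)
  constructor
  · intro h c y hy
    -- At a given point every coordinate vector `v` is the value of a global smooth field, so the
    -- equation holds with arbitrary `v` inserted.
    have h1 := (key c hy).1 fun v => by
      obtain ⟨X, hX⟩ := exists_vectorField hy.2.2 v
      have h2 := (pullbackContraction_eq_zero_iff (c := c) hΩ hy.2 X).1 (h X _ hy.2.1)
      rwa [hX, c.base.right_inv hy.1] at h2
    simp only [partialDeriv_localRep_snd hy, partialDeriv_localRep_momentum hy]
    exact h1
  · intro h X x hx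
    obtain ⟨c, hc⟩ := hπ.exists_chart (σ.toFun x).jet.val
    have hxc : x ∈ σ.chartSource c := ⟨hx, hc⟩
    have hy := mem_chartDomain hxc
    have h1 := h c _ hy
    simp only [partialDeriv_localRep_snd hy, partialDeriv_localRep_momentum hy] at h1
    exact (pullbackContraction_eq_zero_iff hΩ hxc X).2 ((key c hy).2 h1 _)

end PhaseSection

end PoincareCartan

namespace PoincareCartan

/-! ### Jet prolongations as a first order system -/

section Calculus

variable {n N r : ℕ}

theorem exists_succ_eq {m : ℕ} (α : Fin n → ℕ) (h : ∑ i, α i = m + 1) :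
    ∃ (β : Fin n → ℕ) (μ : Fin n), ∑ i, β i = m ∧ α = β + Pi.single μ 1 := by
  obtain ⟨μ, -, hμ⟩ : ∃ μ ∈ Finset.univ, α μ ≠ 0 :=
    Finset.exists_ne_zero_of_sum_ne_zero (by omega)
  have h1 : α = (α - Pi.single μ 1) + Pi.single μ 1 := by
    funext i
    by_cases hi : i = μ
    · subst hi
      simp
      omega
    · simp [hi]
  refine ⟨_, μ, ?_, h1⟩
  rw [h1] at h
  simpa [Finset.sum_add_distrib] using h

/-- Induction on `|α|`: the first order equation at `(β, μ)` turns `u_β = ∂^β u_0` into the same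
statement for `βμ`. At `|β| = r` the right side is `w`, so the last step yields the derivatives of
order `r + 1` instead. -/
theorem prolongation_iff {S : Set (Fin n → ℝ)} (hS : IsOpen S)
    {u : (Fin n → ℝ) → JetFibre n N r} (hu : ContDiffOn ℝ ∞ u S)
    (w : (Fin n → ℝ) → TopFibre n N (r + 1)) :
    (∀ y ∈ S, ∀ a μ, partialDeriv μ (fun y => u y a) y = assemble (u y) (w y) (a.1.succ μ, a.2)) ↔
      (∀ y ∈ S, ∀ a : MultiIndex n r × Fin N,
        multiDeriv a.1.1 (fun y => u y (MultiIndex.zero n r, a.2)) y = u y a) ∧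
      ∀ y ∈ S, ∀ (ν : TopIndex n (r + 1)) (K : Fin N),
        multiDeriv ν.1 (fun y => u y (MultiIndex.zero n r, K)) y = w y (ν, K) := by
  have h0 (K : Fin N) : ContDiffOn ℝ ∞ (fun y => u y (MultiIndex.zero n r, K)) S :=
    contDiffOn_pi.1 hu _
  constructor
  · intro h
    have h1 : ∀ (m : ℕ) (α : Fin n → ℕ) (hα : ∑ i, α i = m) (hm : m ≤ r) (K : Fin N), ∀ y ∈ S,
        multiDeriv α (fun y => u y (MultiIndex.zero n r, K)) y = u y (⟨α, hα.trans_le hm⟩, K) := by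
      intro m
      induction m with
      | zero =>
        intro α hα hm K y hy
        obtain rfl : α = 0 := by
          funext i
          exact (Finset.sum_eq_zero_iff.1 hα) i (Finset.mem_univ i)
        rw [multiDeriv_zero]
        rfl
      | succ m ih =>
        intro α hα hm K y hy
        obtain ⟨β, μ, hβ, rfl⟩ := exists_succ_eq α hα
        rw [multiDeriv_add_single hS (h0 K) β μ hy,
          eqOn_partialDeriv hS (fun y hy => ih β hβ (by omega) K y hy) μ hy, h y hy]
        exact assemble_of_le _ _ _ (hα.trans_le hm) K
    refine ⟨fun y hy a => ?_, fun y hy ν K => ?_⟩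
    · exact h1 _ a.1.1 rfl a.1.2 a.2 y hy
    · obtain ⟨β, μ, hβ, hν⟩ := exists_succ_eq ν.1 ν.2
      rw [hν, multiDeriv_add_single hS (h0 K) β μ hy,
        eqOn_partialDeriv hS (fun y hy => h1 r β hβ le_rfl K y hy) μ hy, h y hy]
      have : MultiIndex.succ ⟨β, hβ.le⟩ μ = ν.toMultiIndex := Subtype.ext hν.symm
      rw [this, assemble_top]
  · rintro ⟨h1, h2⟩ y hy a μ
    rw [← eqOn_partialDeriv hS (fun y hy => h1 y hy a) μ hy,
      ← multiDeriv_add_single hS (h0 a.2) a.1.1 μ hy]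
    by_cases h : ∑ i, (a.1.succ μ).1 i ≤ r
    · rw [assemble_of_le _ _ _ h, ← h1 y hy]
      rfl
    · obtain ⟨ν, hν⟩ : ∃ ν : TopIndex n (r + 1), ν.toMultiIndex = a.1.succ μ :=
        ⟨⟨(a.1.succ μ).1, le_antisymm (a.1.succ μ).2 (not_le.1 h)⟩, rfl⟩
      rw [← hν, assemble_top, ← h2 y hy, ← show ν.1 = a.1.1 + Pi.single μ 1 from
        congrArg Subtype.val hν]

/-- The symmetrised momenta as continuous linear forms. -/
def symMomentumL (ν : Fin n → ℕ) (K : Fin N) :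
    ((MultiIndex n r × Fin N) × Fin n → ℝ) →L[ℝ] ℝ :=
  ∑ α : MultiIndex n r, ∑ μ : Fin n,
    if (α.succ μ).1 = ν then ContinuousLinearMap.proj ((α, K), μ) else 0

theorem symMomentumL_apply (ν : Fin n → ℕ) (K : Fin N)
    (P : (MultiIndex n r × Fin N) × Fin n → ℝ) : symMomentumL ν K P = symMomentum P ν K := by
  simp only [symMomentumL, symMomentum, sum_apply]
  refine Finset.sum_congr rfl fun α _ => Finset.sum_congr rfl fun μ _ => ?_
  split_ifs <;> rfl

end Calculus

variable {d N : ℕ}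
  {M : Type*} [TopologicalSpace M] [ChartedSpace (EuclideanSpace ℝ (Fin (d + 1))) M]
  {Φ : Type*} [TopologicalSpace Φ] [ChartedSpace (EuclideanSpace ℝ (Fin (d + 1 + N))) Φ]
  {π : Φ → M} {r : ℕ} {c : AdaptedChart d N π}

/-! ### The derivatives of the Hamiltonian -/

namespace Lagrangian

variable {𝓛 : Lagrangian d N π (r + 1)} {y : PhaseModel (d + 1) N r}

theorem IsRegular.fderiv_hamiltonian (h : 𝓛.IsRegular) (hy : y ∈ c.phaseTarget r)
    (v : PhaseModel (d + 1) N r) :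
    fderiv ℝ (𝓛.hamiltonian c) y v =
      ∑ α : MultiIndex (d + 1) r, ∑ K, (symMomentum y.2.2 α.1 K * v.2.1 (α, K) +
        y.2.1 (α, K) * symMomentum v.2.2 α.1 K) +
      fderiv ℝ (𝓛.legendre c) (y.1, y.2.1, topMomentum y.2.2)
        (v.1, v.2.1, topMomentum v.2.2) := by
  have hP (ν : Fin (d + 1) → ℕ) (K : Fin N) :
      HasFDerivAt (fun y : PhaseModel (d + 1) N r => symMomentum y.2.2 ν K)
        ((symMomentumL ν K).comp ((ContinuousLinearMap.snd ℝ _ _).comp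
          (ContinuousLinearMap.snd ℝ _ _))) y := by
    simp only [← symMomentumL_apply]
    let B : PhaseModel (d + 1) N r →L[ℝ] ((MultiIndex (d + 1) r × Fin N) × Fin (d + 1) → ℝ) :=
      (ContinuousLinearMap.snd ℝ _ _).comp (ContinuousLinearMap.snd ℝ _ _)
    exact ((symMomentumL ν K).comp B).hasFDerivAt
  have hφ (α : MultiIndex (d + 1) r) (K : Fin N) :
      HasFDerivAt (fun y : PhaseModel (d + 1) N r => y.2.1 (α, K))
        ((ContinuousLinearMap.proj (α, K)).comp ((ContinuousLinearMap.fst ℝ _ _).comp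
          (ContinuousLinearMap.snd ℝ _ _))) y :=
    ((ContinuousLinearMap.proj (R := ℝ) (φ := fun _ : MultiIndex (d + 1) r × Fin N => ℝ)
      (α, K)).hasFDerivAt).comp y (hasFDerivAt_snd.fst)
  have htop : HasFDerivAt (fun y : PhaseModel (d + 1) N r => topMomentum y.2.2)
      (ContinuousLinearMap.pi fun a : TopIndex (d + 1) (r + 1) × Fin N =>
        (symMomentumL a.1.1 a.2).comp ((ContinuousLinearMap.snd ℝ _ _).comp
          (ContinuousLinearMap.snd ℝ _ _))) y :=
    hasFDerivAt_pi.2 fun a => hP a.1.1 a.2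
  have hy' : (y.1, y.2.1, topMomentum y.2.2) ∈ {y : (Fin (d + 1) → ℝ) × JetFibre (d + 1) N r ×
      TopFibre (d + 1) N (r + 1) | (y.1, y.2.1) ∈ c.jetTarget r} := hy
  have hleg : HasFDerivAt (𝓛.legendre c)
      (fderiv ℝ (𝓛.legendre c) (y.1, y.2.1, topMomentum y.2.2))
      (y.1, y.2.1, topMomentum y.2.2) :=
    (((h.contDiffOn_legendre c).contDiffAt (((c.isOpen_jetTarget r).preimage
      (by fun_prop)).mem_nhds hy')).differentiableAt (by simp)).hasFDerivAt
  have h1 := (HasFDerivAt.fun_sum (u := Finset.univ) fun α _ =>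
    HasFDerivAt.fun_sum (u := Finset.univ) fun K _ => (hP α.1 K).mul (hφ α K)).add
      (HasFDerivAt.comp (f := fun y : PhaseModel (d + 1) N r => (y.1, y.2.1, topMomentum y.2.2)) y
        hleg (hasFDerivAt_fst.prodMk (hasFDerivAt_snd.fst.prodMk htop)))
  have h2 := (h1.congr_of_eventuallyEq
    (Filter.Eventually.of_forall (𝓛.hamiltonian_eq_legendre c))).fderiv
  rw [h2]
  simp only [add_apply, sum_apply, smul_apply, smul_eq_mul]
  congr 1
  · simp only [← symMomentumL_apply]
    rfl
  · exact congrArg (fderiv ℝ (𝓛.legendre c) (y.1, y.2.1, topMomentum y.2.2))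
      (Prod.ext rfl (Prod.ext rfl (funext fun a => symMomentumL_apply _ _ _)))

/-- The derivatives of the Legendre transform by the highest order momenta. -/
def momentumGradient (𝓛 : Lagrangian d N π (r + 1)) (c : AdaptedChart d N π)
    (y : PhaseModel (d + 1) N r) : TopFibre (d + 1) N (r + 1) :=
  fun a => fderiv ℝ (𝓛.legendre c) (y.1, y.2.1, topMomentum y.2.2) (0, 0, Pi.single a 1)

/-- In the momentum directions `dH` is the pairing with the jet made of the lower derivatives and
the gradient `∂h/∂p^ν`. So `∂H/∂p^{αμ}` is `φ_{αμ}` for `|α| < r` and `∂h/∂p^{αμ}` for `|α| = r`. -/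
theorem IsRegular.fderiv_hamiltonian_momentum (h : 𝓛.IsRegular) (hy : y ∈ c.phaseTarget r)
    (a : MultiIndex (d + 1) r × Fin N) (μ : Fin (d + 1)) :
    fderiv ℝ (𝓛.hamiltonian c) y (0, 0, Pi.single (a, μ) 1) =
      assemble y.2.1 (𝓛.momentumGradient c y) (a.1.succ μ, a.2) := by
  have h1 : ∀ P : (MultiIndex (d + 1) r × Fin N) × Fin (d + 1) → ℝ,
      fderiv ℝ (𝓛.hamiltonian c) y (0, 0, P) =
        momentumPairing P (assemble y.2.1 (𝓛.momentumGradient c y)) := fun P => by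
    have h2 : ((0, 0, topMomentum P) : (Fin (d + 1) → ℝ) × JetFibre (d + 1) N r ×
        TopFibre (d + 1) N (r + 1)) = ∑ a, topMomentum P a • (0, 0, Pi.single a 1) := by
      refine Prod.ext ?_ (Prod.ext ?_ ?_)
      · simp [Prod.fst_sum]
      · simp [Prod.snd_sum, Prod.fst_sum]
      · simp only [Prod.snd_sum, Prod.smul_snd]
        simpa using pi_eq_sum_univ' (topMomentum P)
    rw [h.fderiv_hamiltonian hy, momentumPairing_assemble, h2, map_sum]
    simp only [Pi.zero_apply, mul_zero, zero_add, map_smul, smul_eq_mul]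
    congr 1
    exact Finset.sum_congr rfl fun α _ => Finset.sum_congr rfl fun K _ => mul_comm _ _
  rw [h1, momentumPairing, Finset.sum_eq_single a.1, Finset.sum_eq_single a.2,
    Finset.sum_eq_single μ]
  · simp
  · intro ν _ hν
    simp [hν, Prod.ext_iff]
  · simp
  · intro K _ hK
    simp [hK, Prod.ext_iff]
  · simp
  · intro α _ hα
    simp [hα, Prod.ext_iff]
  · simp

/-- The bilinear part of `H` contributes `p^α`, which is `0` for `α = 0`; this is the left side of
the second field equation. -/
theorem IsRegular.fderiv_hamiltonian_field (h : 𝓛.IsRegular) (hy : y ∈ c.phaseTarget r)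
    (a : MultiIndex (d + 1) r × Fin N) :
    fderiv ℝ (𝓛.hamiltonian c) y (0, Pi.single a 1, 0) = symMomentum y.2.2 a.1.1 a.2 +
      fderiv ℝ (𝓛.legendre c) (y.1, y.2.1, topMomentum y.2.2) (0, Pi.single a 1, 0) := by
  have h0 : ∀ (ν : Fin (d + 1) → ℕ) (K : Fin N),
      symMomentum (0 : (MultiIndex (d + 1) r × Fin N) × Fin (d + 1) → ℝ) ν K = 0 :=
    fun ν K => by rw [← symMomentumL_apply, map_zero]
  have h1 : topMomentum (0 : (MultiIndex (d + 1) r × Fin N) × Fin (d + 1) → ℝ) = 0 :=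
    funext fun b => h0 b.1.1 b.2
  rw [h.fderiv_hamiltonian hy, h1]
  simp only [h0, mul_zero, add_zero]
  congr 1
  rw [← Fintype.sum_prod_type' (f := fun α K =>
    symMomentum y.2.2 α.1 K * (Pi.single a (1 : ℝ) : _ → ℝ) (α, K))]
  simp [Pi.single_apply]

end Lagrangian

/-! ### The equivalence -/

namespace PhaseSection

variable {U : TopologicalSpace.Opens M} {σ : PhaseSection d N π r U}

theorem contDiffOn_localRep_fibre :
    ContDiffOn ℝ ∞ (fun y => (σ.localRep c y).2.1) (σ.chartDomain c) :=
  contDiffOn_localRep.snd.fst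

theorem rep_eq {s : M → Φ} (hs : ∀ x ∈ U, s x = (σ.toFun x).jet.val) :
    Set.EqOn (c.rep s) (fun y => (σ.localRep c y).2.1.zeroPart) (σ.chartDomain c) := by
  intro y hy
  rw [AdaptedChart.rep, hs _ hy.2.1, Jet.total_val hy.2.2]
  rfl

theorem multiDeriv_rep {s : M → Φ} (hs : ∀ x ∈ U, s x = (σ.toFun x).jet.val)
    {y : Fin (d + 1) → ℝ} (hy : y ∈ σ.chartDomain c) (α : Fin (d + 1) → ℕ) (K : Fin N) :
    multiDeriv α (c.rep s) y K =
      multiDeriv α (fun y => (σ.localRep c y).2.1 (MultiIndex.zero (d + 1) r, K)) y := by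
  have hS := σ.isOpen_chartDomain c
  have h1 : ContDiffOn ℝ ∞ (fun y => (σ.localRep c y).2.1.zeroPart) (σ.chartDomain c) :=
    contDiff_zeroPart.comp_contDiffOn contDiffOn_localRep_fibre
  rw [multiDeriv_congr (Filter.eventually_of_mem (hS.mem_nhds hy) (rep_eq hs)) α,
    ← multiDeriv_apply hS h1 α K hy]
  rfl

/-- The section of `Φ` can only be the order zero projection of `σ`, so the existential statement
becomes equations between the components of `σ`. -/
theorem isHolonomic_iff : σ.IsHolonomic ↔ ∀ c : AdaptedChart d N π, ∀ y ∈ σ.chartDomain c,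
    ∀ a : MultiIndex (d + 1) r × Fin N,
      multiDeriv a.1.1 (fun y => (σ.localRep c y).2.1 (MultiIndex.zero (d + 1) r, a.2)) y =
        (σ.localRep c y).2.1 a := by
  constructor
  · rintro ⟨s, hs⟩ c y hy a
    have hval : ∀ x ∈ U, s x = (σ.toFun x).jet.val := fun x hx => by
      obtain ⟨b, hb, rfl, hj⟩ := hs x hx
      rw [hj, ← hb]
      rfl
    obtain ⟨b, hb, rfl, hj⟩ := hs _ hy.2.1
    have hdom : b.toFun b.pt ∈ c.total.source := by
      rw [hb, hval _ hy.2.1]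
      exact hy.2.2
    rw [← multiDeriv_rep hval hy]
    change _ = (σ.toFun (c.base.symm y)).jet.fibreCoord c a
    rw [hj, Jet.fibreCoord_jetOf hdom, hb, c.base.right_inv hy.1]
  · intro h
    refine ⟨fun x => (σ.toFun x).jet.val, fun x hx => ?_⟩
    have hUx : ∀ᶠ y in 𝓝 x, y ∈ U := U.isOpen.mem_nhds hx
    let b : LocalSection d N π :=
      { pt := x
        toFun := fun x => (σ.toFun x).jet.val
        isSection := hUx.mono fun y hy => (Jet.proj_val _).trans (σ.base_eq y hy)
        smooth := hUx.mono fun y hy => σ.smooth_val.contMDiffAt (U.isOpen.mem_nhds hy) }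
    refine ⟨b, rfl, rfl, Jet.data_injective (Prod.ext (σ.base_eq x hx) (Prod.ext rfl ?_))⟩
    funext c
    change (σ.toFun x).jet.fibreCoord c = (jetOf r b).fibreCoord c
    by_cases hc : (σ.toFun x).jet.val ∈ c.total.source
    · have hxc : x ∈ σ.chartSource c := ⟨hx, hc⟩
      have hy := mem_chartDomain hxc
      funext a
      have h1 : b.toFun b.pt ∈ c.total.source := hc
      rw [Jet.fibreCoord_jetOf h1]
      refine Eq.trans ?_ (multiDeriv_rep (σ := σ) (fun _ _ => rfl) hy a.1.1 a.2).symm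
      rw [h c _ hy a, localRep_base hxc]
      rfl
    · rw [Jet.fibreCoord_of_notMem (q := (σ.toFun x).jet) hc,
        Jet.fibreCoord_of_notMem (q := jetOf r b) hc]

theorem isMultisymplectic_iff_fieldEquations [T2Space Φ] [IsManifold (𝓡 (d + 1 + N)) ∞ Φ]
    (hπ : IsFibredManifold d N π) {𝓛 : Lagrangian d N π (r + 1)} (h𝓛 : 𝓛.IsRegular)
    {Ω : PhaseForm d N π r (d + 1 + 1)} (hΩ : 𝓛.IsCartanForm Ω) :
    σ.IsMultisymplectic Ω ↔ σ.IsHolonomic ∧ 𝓛.FieldEquations σ := by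
  -- The field equations are rewritten over coordinate domains, with `∂h/∂φ` in the second one
  -- exchanged for `∂H/∂φ - p^α`.
  have hfield : 𝓛.FieldEquations σ ↔ ∀ c : AdaptedChart d N π,
      (∀ y ∈ σ.chartDomain c, ∀ (ν : TopIndex (d + 1) (r + 1)) (K : Fin N),
        multiDeriv ν.1 (fun y => (σ.localRep c y).2.1 (MultiIndex.zero (d + 1) r, K)) y =
          𝓛.momentumGradient c (σ.localRep c y) (ν, K)) ∧
      ∀ y ∈ σ.chartDomain c, ∀ a, ∑ μ, partialDeriv μ (fun y => (σ.localRep c y).2.2 (a, μ)) y =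
        - fderiv ℝ (𝓛.hamiltonian c) (σ.localRep c y) (0, Pi.single a 1, 0) := by
    refine forall_congr' fun c => ?_
    have hiff (y : Fin (d + 1) → ℝ) (hy : y ∈ σ.chartDomain c)
        (a : MultiIndex (d + 1) r × Fin N) :
        (∑ μ, partialDeriv μ (fun y => (σ.localRep c y).2.2 (a, μ)) y =
          - fderiv ℝ (𝓛.hamiltonian c) (σ.localRep c y) (0, Pi.single a 1, 0)) ↔
        symMomentum (σ.localRep c y).2.2 a.1.1 a.2 =
          - fderiv ℝ (𝓛.legendre c) (y, (σ.localRep c y).2.1, topMomentum (σ.localRep c y).2.2)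
            (0, Pi.single a 1, 0) -
          ∑ μ, partialDeriv μ (fun y' => (σ.localRep c y').2.2 (a, μ)) y := by
      rw [h𝓛.fderiv_hamiltonian_field (localRep_mem hy), localRep_fst hy]
      constructor <;> intro h <;> linarith
    constructor
    · intro h
      have h' (y : Fin (d + 1) → ℝ) (hy : y ∈ σ.chartDomain c) := by
        have := h _ hy.2.1 hy.2.2
        simp only [c.base.right_inv hy.1] at this
        exact this
      refine ⟨fun y hy ν K => ?_, fun y hy a => (hiff y hy a).2 ((h' y hy).2 a.1 a.2)⟩
      rw [(h' y hy).1 ν K, Lagrangian.momentumGradient, localRep_fst hy]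
    · rintro ⟨h1, h2⟩ x hx hc
      have hy := mem_chartDomain (σ := σ) (c := c) ⟨hx, hc⟩
      refine ⟨fun ν K => ?_, fun α K => (hiff _ hy (α, K)).1 (h2 _ hy (α, K))⟩
      rw [h1 _ hy ν K, Lagrangian.momentumGradient, localRep_fst hy]
  rw [isMultisymplectic_iff hπ σ hΩ, isHolonomic_iff, hfield, ← forall_and]
  refine forall_congr' fun c => ?_
  -- Holonomy and the first field equation merge into the first order system with `w = ∂h/∂p^ν`,
  -- which is exactly the family `∂_μ φ_α = ∂H/∂p^{αμ}`.
  rw [← and_assoc, ← prolongation_iff (σ.isOpen_chartDomain c) contDiffOn_localRep_fibre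
    (fun y => 𝓛.momentumGradient c (σ.localRep c y)), forall₂_and]
  refine and_congr_left' (forall₂_congr fun y hy => forall₂_congr fun a μ => ?_)
  rw [h𝓛.fderiv_hamiltonian_momentum (localRep_mem hy)]

end PhaseSection

end PoincareCartan

end

theorem mainTheorem4
    {d N r : ℕ}
    {M : Type*} [TopologicalSpace M] [T2Space M]
    [ChartedSpace (EuclideanSpace ℝ (Fin (d + 1))) M] [IsManifold (𝓡 (d + 1)) ∞ M]
    {Φ : Type*} [TopologicalSpace Φ] [T2Space Φ]
    [ChartedSpace (EuclideanSpace ℝ (Fin (d + 1 + N))) Φ] [IsManifold (𝓡 (d + 1 + N)) ∞ Φ]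
    (π : Φ → M) (hπ : IsFibredManifold d N π)
    (𝓛 : Lagrangian d N π (r + 1)) (h𝓛 : 𝓛.IsRegular) :
    (∃! Ω : PhaseForm d N π r (d + 1 + 1), 𝓛.IsCartanForm Ω) ∧
    ∀ Ω : PhaseForm d N π r (d + 1 + 1), 𝓛.IsCartanForm Ω →
      ∀ (U : TopologicalSpace.Opens M) (σ : PhaseSection d N π r U),
        σ.IsMultisymplectic Ω ↔ σ.IsHolonomic ∧ 𝓛.FieldEquations σ := by
  exact ⟨h𝓛.existsUnique_cartanForm hπ, fun _ hΩ _ _ =>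
    PhaseSection.isMultisymplectic_iff_fieldEquations hπ h𝓛 hΩ⟩
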